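/- Let $\mathfrak g=\mathfrak v\oplus\mathfrak z$ be a finite-dimensional real Lie algebra of step two with centre $\mathfrak z$ and $[\mathfrak v,\mathfrak v]=\mathfrak z$, with inner products on $\mathfrak v$ and $\mathfrak z$, and of Heisenberg type: for every $\lambda\in\mathfrak z^*$ the endomorphism $B(\lambda)$ of $\mathfrak v$ representing the skew form $(U,W)\mapsto\lambda([U,W])$ satisfies $B(\lambda)^2=-|\lambda|^2\,\mathrm{Id}$. Put $\dim\mathfrak v=2d$, $\dim\mathfrak z=p$. Let $G$ be the corresponding connected simply connected group, identified with $\mathfrak v\times\mathfrak z$ by the exponential map, with law $(v,z)(v',z')=(v+v',\,z+z'+\tfrac12[v,v'])$ and Lebesgue (Haar) measure. For every $\lambda\in\mathfrak z^*\setminus\{0\}$ fix an orthonormal basis $(P_1,\dots,P_d,Q_1,\dots,Q_d)=(P^\lambda,Q^\lambda)$ of $\mathfrak v$ in which $B(\lambda)$ is the form $|\lambda|J$, $J=\begin{pmatrix}0&\mathrm{Id}\\-\mathrm{Id}&0\end{pmatrix}$, chosen so that it depends only on $\lambda/|\lambda|$. Let $p_j^\lambda,q_j^\lambda$ be the corresponding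 coordinate functions on $G$ and define the unitary representation $\pi^\lambda$ of $G$ on $L^2(\mathbb R^d)$ by $$\pi^\lambda_x\Phi(\xi)=\exp\Big[i\lambda(z)+\tfrac i2|\lambda|\,p\cdot q+i\sqrt{|\lambda|}\,\xi\cdot q\Big]\,\Phi\big(\xi+\sqrt{|\lambda|}\,p\big),\qquad \mathcal Ff(\lambda)=\int_G f(x)(\pi^\lambda_x)^*\,dx .$$ Let $\mathcal A_0$ be the set of fields of operators $\sigma(x,\lambda)=\mathcal F\kappa_x(\lambda)$, $x\in G$, $\lambda\in\mathfrak z^*\setminus\{0\}$, where $x\mapsto\kappa_x$ is a smooth compactly supported map from $G$ to the Schwartz space $\mathcal S(G)$; $\kappa$ is determined by $\sigma$. Write $\sigma^*(x,\lambda)=\sigma(x,\lambda)^*$ and $(\sigma_1\sigma_2)(x,\lambda)=\sigma_1(x,\lambda)\sigma_2(x,\lambda)$. For $\sigma\in\mathcal A_0$ put $$\Delta^\lambda_{p_j}\sigma(x,\lambda)=\mathcal F(p_j^\lambda\kappa_x)(\lambda),\qquad \Delta^\lambda_{q_j}\sigma(x,\lambda)=\mathcal F(q_j^\lambda\kappa_x)(\lambda),$$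 let $P_j,Q_j$ act on the variable $x$ as left-invariant vector fields, $(U\tau)(x)=\frac{d}{dt}\tau(x\,\mathrm{Exp}(tU))|_{t=0}$, and set $$P\cdot\Delta^\lambda_p\sigma+Q\cdot\Delta_q^\lambda\sigma=\sum_{j=1}^d\big(P_j\Delta^\lambda_{p_j}\sigma+Q_j\Delta^\lambda_{q_j}\sigma\big),\qquad \Delta^\lambda_p\sigma_1\cdot P\sigma_2+\Delta^\lambda_q\sigma_1\cdot Q\sigma_2=\sum_{j=1}^d\big(\Delta^\lambda_{p_j}\sigma_1\,P_j\sigma_2+\Delta^\lambda_{q_j}\sigma_1\,Q_j\sigma_2\big).$$ For $\varepsilon>0$ and $f\in\mathcal S(G)$ let $$\mathrm{Op}_\varepsilon(\sigma)f(x)=c_0\int_{\mathfrak z^*\setminus\{0\}}\mathrm{Tr}\big(\pi^\lambda_x\,\sigma(x,\varepsilon^2\lambda)\,\mathcal Ff(\lambda)\big)|\lambda|^d\,d\lambda,\qquad c_0=(2\pi)^{-(d+p)} .$$ Then for every $\sigma\in\mathcal A_0$ and $\varepsilon>0$, $\mathrm{Op}_\varepsilon(\sigma)$ extends uniquely to a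 bounded operator on $L^2(G)$, still denoted $\mathrm{Op}_\varepsilon(\sigma)$, and the following hold. 1. For every $\sigma\in\mathcal A_0$, the symbols $\sigma^*$ and $P\cdot\Delta_p^\lambda\sigma^*+Q\cdot\Delta_q^\lambda\sigma^*$ belong to $\mathcal A_0$, and there is a constant $C$ such that for all $\varepsilon>0$ $$\Big\|\mathrm{Op}_\varepsilon(\sigma)^*-\mathrm{Op}_\varepsilon(\sigma^*)+\varepsilon\,\mathrm{Op}_\varepsilon\big(P\cdot\Delta_p^\lambda\sigma^*+Q\cdot\Delta_q^\lambda\sigma^*\big)\Big\|_{\mathcal L(L^2(G))}\le C\varepsilon^2 .$$ 2. For all $\sigma_1,\sigma_2\in\mathcal A_0$, the symbols $\sigma_1\sigma_2$ and $\Delta_p^\lambda\sigma_1\cdot P\sigma_2+\Delta_q^\lambda\sigma_1\cdot Q\sigma_2$ belong to $\mathcal A_0$, and there is a constant $C$ such that for all $\varepsilon>0$ $$\Big\|\mathrm{Op}_\varepsilon(\sigma_1)\circ\mathrm{Op}_\varepsilon(\sigma_2)-\mathrm{Op}_\varepsilon(\sigma_1\sigma_2)+\varepsilon\,\mathrm{Op}_\varepsilon\big(\Delta_p^\lambda\sigma_1\cdot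 P\sigma_2+\Delta_q^\lambda\sigma_1\cdot Q\sigma_2\big)\Big\|_{\mathcal L(L^2(G))}\le C\varepsilon^2 .$$ -/

import Mathlib

open MeasureTheory Filter Topology
open scoped SchwartzMap InnerProductSpace ENNReal

noncomputable section

/-! ### Smooth maps into a topological vector space -/

/-- `C^n` maps from a (finite-dimensional) space `E` into a real topological vector space `F`:
continuous maps all of whose directional derivatives exist, as limits of difference quotients in
the topology of `F`, and are `C^(n-1)`. -/
def IsContDiffTVS {E F : Type*} [NormedAddCommGroup E] [NormedSpace ℝ E]
    [AddCommGroup F] [Module ℝ F] [TopologicalSpace F] : ℕ → (E → F) → Prop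
  | 0, f => Continuous f
  | n + 1, f => Continuous f ∧ ∀ e : E, ∃ g : E → F,
      (∀ x, Tendsto (fun t : ℝ => t⁻¹ • (f (x + t • e) - f x)) (𝓝[≠] 0) (𝓝 (g x))) ∧
        IsContDiffTVS n g

/-- Smooth maps from a finite-dimensional space into a real topological vector space. -/
def IsSmoothTVS {E F : Type*} [NormedAddCommGroup E] [NormedSpace ℝ E]
    [AddCommGroup F] [Module ℝ F] [TopologicalSpace F] (f : E → F) : Prop :=
  ∀ n : ℕ, IsContDiffTVS n f

/-! ### The trace and the unitary operators of the representations -/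

/-- The Hilbert space `L²(ℝ^d)`. -/
abbrev L2 (d : ℕ) : Type := Lp ℂ 2 (volume : Measure (EuclideanSpace ℝ (Fin d)))

/-- Bounded operators on `L²(ℝ^d)`. -/
abbrev BddOp (d : ℕ) : Type := L2 d →L[ℂ] L2 d

/-- The trace of an operator, computed in a Hilbert basis (for trace-class operators the series
converges unconditionally and does not depend on the basis). -/
def opTrace {H : Type*} [NormedAddCommGroup H] [InnerProductSpace ℂ H] [CompleteSpace H]
    (A : H →L[ℂ] H) : ℂ :=
  ∑' i, ⟪(exists_hilbertBasis ℂ H).choose_spec.choose i,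
    A ((exists_hilbertBasis ℂ H).choose_spec.choose i)⟫_ℂ

theorem memLp_modulate {d : ℕ} {c : EuclideanSpace ℝ (Fin d) → ℝ} (hc : Continuous c)
    (Φ : L2 d) :
    MemLp (fun ξ => Complex.exp (Complex.I * (c ξ : ℂ)) * Φ ξ) 2 volume := by
  refine (Lp.memLp Φ).of_le ?_ ?_
  · exact (by fun_prop : Continuous fun ξ =>
      Complex.exp (Complex.I * (c ξ : ℂ))).aestronglyMeasurable.mul (Lp.aestronglyMeasurable Φ)
  · refine Eventually.of_forall fun ξ => ?_
    rw [norm_mul, mul_comm Complex.I, Complex.norm_exp_ofReal_mul_I, one_mul]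

/-- The operator `Φ ↦ (ξ ↦ exp (i c(ξ)) Φ(ξ))` on `L²(ℝ^d)`. -/
def modulate {d : ℕ} (c : EuclideanSpace ℝ (Fin d) → ℝ) (hc : Continuous c) : BddOp d :=
  LinearMap.mkContinuous
    { toFun := fun Φ => (memLp_modulate hc Φ).toLp _
      map_add' := by
        intro Φ Ψ
        rw [← MemLp.toLp_add]
        refine MemLp.toLp_congr _ _ ?_
        filter_upwards [Lp.coeFn_add Φ Ψ] with ξ h
        simp only [h, Pi.add_apply, mul_add]
      map_smul' := by
        intro a Φ
        rw [RingHom.id_apply, ← MemLp.toLp_const_smul]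
        refine MemLp.toLp_congr _ _ ?_
        filter_upwards [Lp.coeFn_smul a Φ] with ξ h
        simp only [h, Pi.smul_apply, smul_eq_mul]
        ring }
    1 (by
      intro Φ
      rw [one_mul]
      refine Lp.norm_le_norm_of_ae_le ?_
      filter_upwards [(memLp_modulate hc Φ).coeFn_toLp] with ξ h
      simp only [LinearMap.coe_mk, AddHom.coe_mk]
      rw [h, norm_mul, mul_comm Complex.I, Complex.norm_exp_ofReal_mul_I, one_mul])

/-- The operator `Φ ↦ (ξ ↦ Φ(ξ + a))` on `L²(ℝ^d)`. -/
def shift {d : ℕ} (a : EuclideanSpace ℝ (Fin d)) : BddOp d :=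
  (Lp.compMeasurePreservingₗᵢ ℂ (fun ξ => ξ + a)
    (measurePreserving_add_right volume a)).toContinuousLinearMap

/-! ### Groups of Heisenberg type -/

/-- The Lie algebra `𝔤 = 𝔳 ⊕ 𝔷` of a group of Heisenberg type, given by its bracket
`𝔳 × 𝔳 → 𝔷`: `𝔷` is the centre and `[𝔳,𝔳] = 𝔷`, the algebra is of step two, and, for every
`λ ∈ 𝔷^*`, the endomorphism `B(λ)` of `𝔳` given by the skew-symmetric form `λ([U,W])` has
`B(λ)² = -|λ|² Id`. The inner product of `𝔷` is used to identify `𝔷^*` with `𝔷`. -/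
structure HTypeAlgebra (V Z : Type*) [NormedAddCommGroup V] [InnerProductSpace ℝ V]
    [FiniteDimensional ℝ V] [NormedAddCommGroup Z] [InnerProductSpace ℝ Z] where
  bracket : V →L[ℝ] V →L[ℝ] Z
  bracket_self : ∀ U, bracket U U = 0
  step_two : ∃ U W, bracket U W ≠ 0
  span_bracket : Submodule.span ℝ {z : Z | ∃ U W, bracket U W = z} = ⊤
  center : ∀ U, (∀ W, bracket U W = 0) → U = 0
  hType : ∀ (l : Z) (B : V →ₗ[ℝ] V), (∀ U W, ⟪B U, W⟫_ℝ = ⟪l, bracket U W⟫_ℝ) →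
    ∀ U, B (B U) = -(‖l‖ ^ 2) • U

namespace HTypeAlgebra

/-- Lebesgue measure on `𝔳 × 𝔷` is a Haar measure for the addition. -/
instance instIsAddHaarVolumeProd {V Z : Type*} [NormedAddCommGroup V] [InnerProductSpace ℝ V]
    [FiniteDimensional ℝ V] [MeasurableSpace V] [BorelSpace V]
    [NormedAddCommGroup Z] [InnerProductSpace ℝ Z] [FiniteDimensional ℝ Z]
    [MeasurableSpace Z] [BorelSpace Z] :
    (volume : Measure (V × Z)).IsAddHaarMeasure :=
  inferInstanceAs ((volume : Measure V).prod (volume : Measure Z)).IsAddHaarMeasure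

variable {V Z : Type*} [NormedAddCommGroup V] [InnerProductSpace ℝ V] [FiniteDimensional ℝ V]
  [MeasurableSpace V] [BorelSpace V]
  [NormedAddCommGroup Z] [InnerProductSpace ℝ Z] [FiniteDimensional ℝ Z]
  [MeasurableSpace Z] [BorelSpace Z]

/-- The group law of `G`, identified with `𝔳 × 𝔷` by the exponential map. -/
def mul (𝔤 : HTypeAlgebra V Z) (x y : V × Z) : V × Z :=
  (x.1 + y.1, x.2 + y.2 + (2⁻¹ : ℝ) • 𝔤.bracket x.1 y.1)

/-- A choice, for every `λ ∈ 𝔷^* \ {0}`, of an orthonormal basis `(P_1,…,P_d,Q_1,…,Q_d)` of `𝔳`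
in which the form `B(λ)` is `|λ| J`, with `J = (0, Id; -Id, 0)`. The choice depends on the
direction of `λ` only, so that the representations at `λ` and at `ε² λ` act on functions on the
same space `𝔭_λ`. The index `Sum.inl j` is that of `P_j` and `Sum.inr j` that of `Q_j`;
the value at `λ = 0` is immaterial. -/
structure Frame (𝔤 : HTypeAlgebra V Z) (d : ℕ) where
  basis : Z → OrthonormalBasis (Fin d ⊕ Fin d) ℝ V
  basis_form : ∀ l, l ≠ 0 → ∀ i j, ⟪l, 𝔤.bracket (basis l i) (basis l j)⟫_ℝ =
    ‖l‖ * Matrix.fromBlocks (0 : Matrix (Fin d) (Fin d) ℝ) 1 (-1) 0 i j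
  basis_smul : ∀ l, l ≠ 0 → ∀ r : ℝ, 0 < r → basis (r • l) = basis l

namespace Frame

variable {𝔤 : HTypeAlgebra V Z} {d : ℕ} (F : 𝔤.Frame d)

/-- The coordinates `p = (p_1,…,p_d)` of a group element in the basis attached to `λ`. -/
def pCoord (l : Z) (x : V × Z) : EuclideanSpace ℝ (Fin d) :=
  WithLp.toLp 2 fun j => ⟪F.basis l (Sum.inl j), x.1⟫_ℝ

/-- The coordinates `q = (q_1,…,q_d)` of a group element in the basis attached to `λ`. -/
def qCoord (l : Z) (x : V × Z) : EuclideanSpace ℝ (Fin d) :=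
  WithLp.toLp 2 fun j => ⟪F.basis l (Sum.inr j), x.1⟫_ℝ

/-- The phase `λ(z) + |λ| p·q / 2 + √|λ| ξ·q`. -/
def phase (l : Z) (x : V × Z) (ξ : EuclideanSpace ℝ (Fin d)) : ℝ :=
  ⟪l, x.2⟫_ℝ + 2⁻¹ * ‖l‖ * ⟪F.pCoord l x, F.qCoord l x⟫_ℝ + √‖l‖ * ⟪ξ, F.qCoord l x⟫_ℝ

theorem continuous_phase (l : Z) (x : V × Z) : Continuous (F.phase l x) := by
  unfold phase
  fun_prop

/-- The representation
`π^λ_x Φ(ξ) = exp(i λ(z) + i |λ| p·q / 2 + i √|λ| ξ·q) Φ(ξ + √|λ| p)` on `L²(ℝ^d)`. -/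
def rep (l : Z) (x : V × Z) : BddOp d :=
  (modulate (F.phase l x) (F.continuous_phase l x)).comp (shift (√‖l‖ • F.pCoord l x))

/-- The group Fourier transform `𝓕 f(λ) = ∫ f(x) (π^λ_x)^* dx`: the integral is taken in the
weak sense, since `x ↦ π^λ_x` is not continuous for the operator norm. -/
def fourier (f : V × Z → ℂ) (l : Z) : BddOp d :=
  open Classical in
  if h : ∃ A : BddOp d, ∀ Φ Ψ : L2 d,
      ⟪Ψ, A Φ⟫_ℂ = ∫ x, f x * ⟪Ψ, ContinuousLinearMap.adjoint (F.rep l x) Φ⟫_ℂ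
  then h.choose else 0

/-- `κ` is a convolution kernel of the field of operators `σ(x, λ)`, `λ ≠ 0`: the map `x ↦ κ_x`
is smooth and compactly supported from `G` to the Schwartz space, and `σ(x, λ) = 𝓕 κ_x(λ)`. -/
def IsKernel (σ : V × Z → Z → BddOp d) (κ : V × Z → 𝓢(V × Z, ℂ)) : Prop :=
  IsSmoothTVS κ ∧ HasCompactSupport κ ∧ ∀ x l, l ≠ 0 → σ x l = F.fourier (κ x) l

/-- The algebra of symbols `𝓐₀`. Symbols are fields of operators over `G × (𝔷^* \ {0})`;
values at `λ = 0` are immaterial. -/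
def A0 : Set (V × Z → Z → BddOp d) := {σ | ∃ κ, F.IsKernel σ κ}

/-- The convolution kernel of a symbol of `𝓐₀` (unique, as the Fourier transform is injective). -/
def kernel (σ : V × Z → Z → BddOp d) : V × Z → 𝓢(V × Z, ℂ) :=
  open Classical in
  if h : ∃ κ, F.IsKernel σ κ then h.choose else 0

/-- The difference operator `Δ_φ σ(x, λ) = 𝓕(φ κ_x)(λ)`, where `κ` is the kernel of `σ`. -/
def diffOp (φ : V × Z → ℝ) (σ : V × Z → Z → BddOp d) (x : V × Z) (l : Z) : BddOp d :=
  F.fourier (fun y => (φ y : ℂ) * F.kernel σ x y) l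

/-- `Δ_{p_j}^λ σ(x, λ)`: the difference operator of the coordinate `p_j` of the basis attached
to `λ`, taken at the same `λ`. -/
def diffP (j : Fin d) (σ : V × Z → Z → BddOp d) (x : V × Z) (l : Z) : BddOp d :=
  F.diffOp (fun y => F.pCoord l y j) σ x l

/-- `Δ_{q_j}^λ σ(x, λ)`. -/
def diffQ (j : Fin d) (σ : V × Z → Z → BddOp d) (x : V × Z) (l : Z) : BddOp d :=
  F.diffOp (fun y => F.qCoord l y j) σ x l

end Frame

/-- The left-invariant vector field of `U ∈ 𝔳`, `U τ(x) = d/dt τ(x Exp(tU))` at `t = 0`, acting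
on functions of `x` with values in a normed space. -/
def leftDeriv {E : Type*} [NormedAddCommGroup E] [NormedSpace ℝ E] (𝔤 : HTypeAlgebra V Z)
    (U : V) (τ : V × Z → E) (x : V × Z) : E :=
  deriv (fun t : ℝ => τ (𝔤.mul x (t • U, 0))) 0

namespace Frame

variable {𝔤 : HTypeAlgebra V Z} {d : ℕ} (F : 𝔤.Frame d)

/-- The symbol `P · Δ_p^λ τ + Q · Δ_q^λ τ`, where `P_j = P_j^λ` and `Q_j = Q_j^λ` act on `x`. -/
def adjointTerm (τ : V × Z → Z → BddOp d) (x : V × Z) (l : Z) : BddOp d :=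
  ∑ j : Fin d,
    (𝔤.leftDeriv (F.basis l (Sum.inl j)) (fun y => F.diffP j τ y l) x +
      𝔤.leftDeriv (F.basis l (Sum.inr j)) (fun y => F.diffQ j τ y l) x)

/-- The symbol `Δ_p^λ σ₁ · P σ₂ + Δ_q^λ σ₁ · Q σ₂`. -/
def compTerm (σ₁ σ₂ : V × Z → Z → BddOp d) (x : V × Z) (l : Z) : BddOp d :=
  ∑ j : Fin d,
    ((F.diffP j σ₁ x l).comp (𝔤.leftDeriv (F.basis l (Sum.inl j)) (fun y => σ₂ y l) x) +
      (F.diffQ j σ₁ x l).comp (𝔤.leftDeriv (F.basis l (Sum.inr j)) (fun y => σ₂ y l) x))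

/-- The Plancherel constant `c₀ = (2π)^{-(d+p)}`, `p = dim 𝔷`. -/
def plancherelConst (_ : 𝔤.Frame d) : ℝ := ((2 * Real.pi) ^ (d + Module.finrank ℝ Z))⁻¹

/-- The quantization formula
`c₀ ∫_{𝔷^* \ {0}} Tr(π^λ_x σ(x, ε²λ) 𝓕f(λ)) |λ|^d dλ`. -/
def quantize (ε : ℝ) (σ : V × Z → Z → BddOp d) (f : 𝓢(V × Z, ℂ)) (x : V × Z) : ℂ :=
  (F.plancherelConst : ℂ) * ∫ l in ({0}ᶜ : Set Z),
    opTrace ((F.rep l x).comp ((σ x (ε ^ 2 • l)).comp (F.fourier f l))) * ((‖l‖ ^ d : ℝ) : ℂ)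

/-- `T` is a bounded operator on `L²(G)` given on Schwartz functions by the quantization of
`σ`. -/
def IsQuantization (ε : ℝ) (σ : V × Z → Z → BddOp d)
    (T : Lp ℂ 2 (volume : Measure (V × Z)) →L[ℂ] Lp ℂ 2 (volume : Measure (V × Z))) : Prop :=
  ∀ f : 𝓢(V × Z, ℂ), T (f.toLp 2 volume) =ᵐ[volume] F.quantize ε σ f

/-- `Op_ε(σ)` as a bounded operator on `L²(G)`: the unique bounded extension of the
quantization of `σ` from the Schwartz space. -/
def op (ε : ℝ) (σ : V × Z → Z → BddOp d) :
    Lp ℂ 2 (volume : Measure (V × Z)) →L[ℂ] Lp ℂ 2 (volume : Measure (V × Z)) :=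
  open Classical in
  if h : ∃ T, F.IsQuantization ε σ T then h.choose else 0

/-- The bounded extension is unique. -/
theorem IsQuantization.unique {ε : ℝ} {σ : V × Z → Z → BddOp d}
    {T T' : Lp ℂ 2 (volume : Measure (V × Z)) →L[ℂ] Lp ℂ 2 (volume : Measure (V × Z))}
    (hT : F.IsQuantization ε σ T) (hT' : F.IsQuantization ε σ T') : T = T' := by
  have hd := SchwartzMap.denseRange_toLpCLM (E := V × Z) (F := ℂ) (p := 2)
    (μ := (volume : Measure (V × Z))) (by simp)
  refine ContinuousLinearMap.ext fun u => ?_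
  refine congrFun (hd.equalizer T.continuous T'.continuous ?_) u
  funext f
  exact Lp.ext ((hT f).trans (hT' f).symm)

end Frame

end HTypeAlgebra

end

/-! On the side of convolution kernels the calculus is elementary. If σ has kernel κ, the inversion
formula `quantize_eq` gives Op_ε(σ)f(x) = ∫ κ_x(y) f(x (δ_ε y)⁻¹) dy, where δ_ε(v, z) = (εv, ε²z)
and y⁻¹ = -y. For fixed y the map x ↦ x (δ_ε y)⁻¹ preserves the measure, so a kernel dominated by an
integrable m(y) gives an operator on L² of norm at most ∫ m, uniformly in ε (`IsKernelOp.norm_le`).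

If κ is the kernel of τ, then Op_ε(τ*)* has kernel κ_{x(δ_ε y)⁻¹}(y). The composition
Op_ε(σ₁)Op_ε(σ₂) integrates κ₁_x(w) κ₂_{x(δ_ε w)⁻¹}(y) against f(x(δ_ε w)⁻¹(δ_ε y)⁻¹). Both
expansions follow from a Taylor formula in the base point (`exists_norm_taylor_le`): κ_{x(δ_ε w)⁻¹}
= κ_x - ε(Wκ)_x + O(ε²), where W is the left-invariant field of the 𝔳-component of w; the central
component of δ_ε w is already of size ε². The remainder grows like (1+|w|)², which the Schwartz
decay of the kernels absorbs.

The first-order terms are the announced symbols because W = ∑ ⟨b_i, w⟩ B_i for every orthonormal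
basis of 𝔳, with B_i the left-invariant field of b_i. Hence the sums over P_j and Q_j, although
written in a basis depending on λ, have a kernel independent of λ, and these symbols stay in 𝓐₀.

For the inversion formula, the frame depends only on the direction of λ, so π^{ε²λ}_x = π^λ_{δ_ε x}
and ε moves from the symbol to the kernel. The trace becomes a Hilbert–Schmidt inner product of two
Fourier transforms. In the Schrödinger realization, 𝓕f(λ) is an integral operator whose kernel is
|λ|^{-d/2} times the partial Fourier transform of f in z and q, up to a measure-preserving change of
variables. The density |λ|^d removes the powers of |λ|, Plancherel in q and in z produces (2π)^d and
(2π)^p, and c₀ cancels both. -/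

open scoped FourierTransform

set_option linter.unusedSectionVars false

noncomputable section

/-! ### Calculus of smooth maps into a topological vector space -/

section TVSCalculus

variable {E F G H : Type*} [NormedAddCommGroup E] [NormedSpace ℝ E]
  [AddCommGroup F] [Module ℝ F] [TopologicalSpace F]
  [AddCommGroup G] [Module ℝ G] [TopologicalSpace G]
  [AddCommGroup H] [Module ℝ H] [TopologicalSpace H]

/-- `g` is the derivative of `f` in the direction `e` at every point. -/
def HasDirDeriv (f : E → F) (e : E) (g : E → F) : Prop :=
  ∀ x, Tendsto (fun t : ℝ => t⁻¹ • (f (x + t • e) - f x)) (𝓝[≠] 0) (𝓝 (g x))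

theorem IsContDiffTVS.of_succ {n : ℕ} {f : E → F} (hf : IsContDiffTVS (n + 1) f) :
    IsContDiffTVS n f := by
  induction n generalizing f with
  | zero => exact hf.1
  | succ n ih => exact ⟨hf.1, fun e => let ⟨g, hg, hgn⟩ := hf.2 e; ⟨g, hg, ih hgn⟩⟩

theorem IsContDiffTVS.clm_comp {n : ℕ} {f : E → F} (hf : IsContDiffTVS n f) (L : F →L[ℝ] G) :
    IsContDiffTVS n fun x => L (f x) := by
  induction n generalizing f with
  | zero => exact L.continuous.comp hf
  | succ n ih =>
    refine ⟨L.continuous.comp hf.1, fun e => ?_⟩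
    obtain ⟨g, hg, hgn⟩ := hf.2 e
    refine ⟨fun x => L (g x), fun x => ?_, ih hgn⟩
    simpa [Function.comp_def] using (L.continuous.tendsto _).comp (hg x)

theorem HasDirDeriv.add [ContinuousAdd F] {f₁ f₂ g₁ g₂ : E → F} {e : E}
    (h₁ : HasDirDeriv f₁ e g₁) (h₂ : HasDirDeriv f₂ e g₂) :
    HasDirDeriv (fun x => f₁ x + f₂ x) e fun x => g₁ x + g₂ x := fun x => by
  refine ((h₁ x).add (h₂ x)).congr fun t => ?_
  rw [← smul_add, add_sub_add_comm]

theorem IsContDiffTVS.add [ContinuousAdd F] {n : ℕ} {f₁ f₂ : E → F}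
    (h₁ : IsContDiffTVS n f₁) (h₂ : IsContDiffTVS n f₂) :
    IsContDiffTVS n fun x => f₁ x + f₂ x := by
  induction n generalizing f₁ f₂ with
  | zero => exact Continuous.add h₁ h₂
  | succ n ih =>
    refine ⟨h₁.1.add h₂.1, fun e => ?_⟩
    obtain ⟨g₁, hg₁, k₁⟩ := h₁.2 e
    obtain ⟨g₂, hg₂, k₂⟩ := h₂.2 e
    exact ⟨_, HasDirDeriv.add hg₁ hg₂, ih k₁ k₂⟩

theorem IsContDiffTVS.const (n : ℕ) (c : F) : IsContDiffTVS n fun _ : E => c := by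
  induction n generalizing c with
  | zero => exact continuous_const
  | succ n ih =>
    exact ⟨continuous_const, fun e => ⟨fun _ => 0, fun x => by simp [tendsto_const_nhds], ih 0⟩⟩

theorem tendsto_add_smul_nhdsNE (x e : E) :
    Tendsto (fun t : ℝ => x + t • e) (𝓝[≠] 0) (𝓝 x) := by
  have : Continuous fun t : ℝ => x + t • e := by fun_prop
  simpa using (this.tendsto 0).mono_left nhdsWithin_le_nhds

/-- The increment is split with the second factor at the moving point x + te, which calls for the
joint continuity of `B` and the continuity of `f₂`. -/
theorem HasDirDeriv.bilin [ContinuousAdd H] (B : F →ₗ[ℝ] G →ₗ[ℝ] H)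
    (hB : Continuous fun p : F × G => B p.1 p.2) {f₁ g₁ : E → F} {f₂ g₂ : E → G} {e : E}
    (h₁ : HasDirDeriv f₁ e g₁) (h₂ : HasDirDeriv f₂ e g₂) (c₂ : Continuous f₂) :
    HasDirDeriv (fun x => B (f₁ x) (f₂ x)) e fun x => B (g₁ x) (f₂ x) + B (f₁ x) (g₂ x) :=
  fun x => by
  have t₁ : Tendsto (fun t : ℝ => B (t⁻¹ • (f₁ (x + t • e) - f₁ x)) (f₂ (x + t • e))) (𝓝[≠] 0)
      (𝓝 (B (g₁ x) (f₂ x))) :=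
    (hB.tendsto (g₁ x, f₂ x)).comp ((h₁ x).prodMk_nhds
      ((c₂.tendsto x).comp (tendsto_add_smul_nhdsNE x e)))
  have t₂ : Tendsto (fun t : ℝ => B (f₁ x) (t⁻¹ • (f₂ (x + t • e) - f₂ x))) (𝓝[≠] 0)
      (𝓝 (B (f₁ x) (g₂ x))) :=
    (hB.tendsto (f₁ x, g₂ x)).comp (tendsto_const_nhds.prodMk_nhds (h₂ x))
  refine (t₁.add t₂).congr fun t => ?_
  simp only [map_smul, map_sub, LinearMap.smul_apply, LinearMap.sub_apply]
  rw [← smul_add]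
  congr 1
  abel

theorem IsContDiffTVS.bilin [ContinuousAdd H] (B : F →ₗ[ℝ] G →ₗ[ℝ] H)
    (hB : Continuous fun p : F × G => B p.1 p.2) {n : ℕ} {f₁ : E → F} {f₂ : E → G}
    (h₁ : IsContDiffTVS n f₁) (h₂ : IsContDiffTVS n f₂) :
    IsContDiffTVS n fun x => B (f₁ x) (f₂ x) := by
  induction n generalizing f₁ f₂ with
  | zero => exact hB.comp (Continuous.prodMk h₁ h₂)
  | succ n ih =>
    refine ⟨hB.comp (h₁.1.prodMk h₂.1), fun e => ?_⟩
    obtain ⟨g₁, hg₁, k₁⟩ := h₁.2 e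
    obtain ⟨g₂, hg₂, k₂⟩ := h₂.2 e
    exact ⟨_, HasDirDeriv.bilin B hB hg₁ hg₂ h₂.1, (ih k₁ h₂.of_succ).add (ih h₁.of_succ k₂)⟩

theorem IsContDiffTVS.clm (n : ℕ) (L : E →L[ℝ] F) : IsContDiffTVS n fun x => L x := by
  cases n with
  | zero => exact L.continuous
  | succ n =>
    refine ⟨L.continuous, fun e => ⟨fun _ => L e, fun x => ?_, IsContDiffTVS.const n _⟩⟩
    refine tendsto_const_nhds.congr' ?_
    filter_upwards [self_mem_nhdsWithin] with t ht
    have ht : t ≠ 0 := ht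
    simp [smul_smul, ht]

/-- The derivative of a map into a topological vector space in a direction. -/
def dirDeriv (f : E → F) (e : E) : E → F :=
  open Classical in if h : ∃ g, HasDirDeriv f e g then h.choose else 0

theorem HasDirDeriv.unique [T2Space F] {f g g' : E → F} {e : E} (h : HasDirDeriv f e g)
    (h' : HasDirDeriv f e g') : g = g' :=
  funext fun x => tendsto_nhds_unique (h x) (h' x)

theorem HasDirDeriv.dirDeriv_eq [T2Space F] {f g : E → F} {e : E} (h : HasDirDeriv f e g) :
    dirDeriv f e = g := by
  have hex : ∃ g, HasDirDeriv f e g := ⟨g, h⟩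
  rw [dirDeriv, dif_pos hex]
  exact hex.choose_spec.unique h

theorem IsSmoothTVS.continuous {f : E → F} (hf : IsSmoothTVS f) : Continuous f := hf 0

theorem IsSmoothTVS.hasDirDeriv {f : E → F} (hf : IsSmoothTVS f) (e : E) :
    HasDirDeriv f e (dirDeriv f e) := by
  obtain ⟨g, hg, -⟩ := (hf 1).2 e
  have hex : ∃ g, HasDirDeriv f e g := ⟨g, hg⟩
  rw [dirDeriv, dif_pos hex]
  exact hex.choose_spec

theorem IsSmoothTVS.dirDeriv [T2Space F] {f : E → F} (hf : IsSmoothTVS f) (e : E) :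
    IsSmoothTVS (dirDeriv f e) := fun n => by
  obtain ⟨g, hg, hgn⟩ := (hf (n + 1)).2 e
  rwa [HasDirDeriv.dirDeriv_eq hg]

theorem IsSmoothTVS.clm_comp {f : E → F} (hf : IsSmoothTVS f) (L : F →L[ℝ] G) :
    IsSmoothTVS fun x => L (f x) := fun n => (hf n).clm_comp L

theorem IsSmoothTVS.add [ContinuousAdd F] {f₁ f₂ : E → F}
    (h₁ : IsSmoothTVS f₁) (h₂ : IsSmoothTVS f₂) : IsSmoothTVS fun x => f₁ x + f₂ x :=
  fun n => (h₁ n).add (h₂ n)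

theorem IsSmoothTVS.sum [ContinuousAdd F] {ι : Type*} (s : Finset ι) {f : ι → E → F}
    (h : ∀ i ∈ s, IsSmoothTVS (f i)) : IsSmoothTVS fun x => ∑ i ∈ s, f i x := by
  classical
  induction s using Finset.induction_on with
  | empty => exact fun n => by simpa using IsContDiffTVS.const n (0 : F)
  | insert a s ha ih =>
    simp only [Finset.sum_insert ha]
    exact (h a (by simp)).add (ih fun i hi => h i (by simp [hi]))

theorem IsSmoothTVS.bilin [ContinuousAdd H] (B : F →ₗ[ℝ] G →ₗ[ℝ] H)
    (hB : Continuous fun p : F × G => B p.1 p.2) {f₁ : E → F} {f₂ : E → G}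
    (h₁ : IsSmoothTVS f₁) (h₂ : IsSmoothTVS f₂) : IsSmoothTVS fun x => B (f₁ x) (f₂ x) :=
  fun n => (h₁ n).bilin B hB (h₂ n)

theorem IsSmoothTVS.clm_smul [ContinuousAdd F] [ContinuousSMul ℝ F] {f : E → F}
    (hf : IsSmoothTVS f) (c : E →L[ℝ] ℝ) : IsSmoothTVS fun x => c x • f x :=
  IsSmoothTVS.bilin (LinearMap.lsmul ℝ F) (by simpa using continuous_smul)
    (fun n => IsContDiffTVS.clm n c) hf

theorem HasDirDeriv.clm_comp {f g : E → F} {e : E} (hf : HasDirDeriv f e g) (L : F →L[ℝ] G) :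
    HasDirDeriv (fun x => L (f x)) e fun x => L (g x) := fun x => by
  simpa [Function.comp_def] using (L.continuous.tendsto _).comp (hf x)

theorem HasDirDeriv.smul [ContinuousConstSMul ℝ F] {f g : E → F} {e : E}
    (hf : HasDirDeriv f e g) (c : ℝ) : HasDirDeriv f (c • e) fun x => c • g x := fun x => by
  rcases eq_or_ne c 0 with rfl | hc
  · simp [tendsto_const_nhds]
  · have hm : Tendsto (fun t : ℝ => t * c) (𝓝[≠] 0) (𝓝[≠] 0) := by
      refine tendsto_nhdsWithin_of_tendsto_nhds_of_eventually_within _ ?_ ?_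
      · exact (Continuous.tendsto' (by fun_prop) _ _ (by simp)).mono_left nhdsWithin_le_nhds
      · filter_upwards [self_mem_nhdsWithin] with t ht using mul_ne_zero ht hc
    refine (((hf x).comp hm).const_smul c).congr fun t => ?_
    simp only [Function.comp, smul_smul, mul_inv]
    congr 1
    field_simp

/-- Derivatives do not enlarge supports, so the derived families of kernels remain compactly
supported. -/
theorem dirDeriv_eq_zero_of_notMem_tsupport [T2Space F] {f : E → F} (hf : IsSmoothTVS f) (e : E)
    {x : E} (hx : x ∉ tsupport f) : dirDeriv f e x = 0 := by
  refine tendsto_nhds_unique (hf.hasDirDeriv e x) (tendsto_const_nhds.congr' ?_)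
  have h0 : ∀ᶠ y in 𝓝 x, f y = 0 := by
    filter_upwards [(isClosed_tsupport f).isOpen_compl.mem_nhds hx] with y hy
    exact image_eq_zero_of_notMem_tsupport hy
  filter_upwards [(tendsto_add_smul_nhdsNE x e).eventually h0] with t ht
  rw [ht, h0.self_of_nhds]
  simp

/-! ### Normed spaces -/

theorem HasDirDeriv.hasDerivAt {F : Type*} [NormedAddCommGroup F] [NormedSpace ℝ F]
    {f g : E → F} {e : E} (hf : HasDirDeriv f e g) (x : E) (t : ℝ) :
    HasDerivAt (fun s : ℝ => f (x + s • e)) (g (x + t • e)) t := by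
  rw [hasDerivAt_iff_tendsto_slope_zero]
  refine (hf (x + t • e)).congr fun s => ?_
  rw [add_smul, add_assoc]

/-- Directional derivatives alone need not be additive in the direction. Moving by ta and then by tb
leaves a b-increment from a moving base point, which the continuity of `gb` controls. -/
theorem HasDirDeriv.add_dir {F : Type*} [NormedAddCommGroup F] [NormedSpace ℝ F]
    {f ga gb : E → F} {a b : E} (ha : HasDirDeriv f a ga) (hb : HasDirDeriv f b gb)
    (cb : Continuous gb) : HasDirDeriv f (a + b) fun x => ga x + gb x := fun x => by
  have key : Tendsto (fun t : ℝ => t⁻¹ • (f (x + t • a + t • b) - f (x + t • a))) (𝓝[≠] 0)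
      (𝓝 (gb x)) := by
    rw [Metric.tendsto_nhds]
    intro ε hε
    obtain ⟨δ, hδ, hball⟩ := Metric.continuousAt_iff.1 cb.continuousAt (ε / 2) (half_pos hε)
    have hK : 0 < ‖a‖ + ‖b‖ + 1 := by positivity
    have hsmall : ∀ᶠ t : ℝ in 𝓝[≠] 0, |t| < δ / (‖a‖ + ‖b‖ + 1) := by
      have := Metric.ball_mem_nhds (0 : ℝ) (div_pos hδ hK)
      filter_upwards [nhdsWithin_le_nhds this] with t ht
      simpa [Real.dist_eq] using ht
    filter_upwards [hsmall, self_mem_nhdsWithin] with t ht ht0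
    have ht0 : t ≠ 0 := ht0
    -- Subtracting s • gb x leaves a function whose derivative is at most ε/2 on the segment.
    have hmv := Convex.norm_image_sub_le_of_norm_hasDerivWithin_le
      (f := fun s : ℝ => f (x + t • a + s • b) - s • gb x)
      (f' := fun s : ℝ => gb (x + t • a + s • b) - gb x) (s := Set.uIcc 0 t) (x := 0) (y := t)
      (C := ε / 2)
      (fun s _ => by
        have h := (hb.hasDerivAt (x + t • a) s).sub ((hasDerivAt_id s).smul_const (gb x))
        rw [one_smul] at h
        exact h.hasDerivWithinAt)
      (fun s hs => by
        have hs' : |s| ≤ |t| := by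
          have := Set.abs_sub_left_of_mem_uIcc hs
          simpa using this
        rw [← dist_eq_norm]
        refine (hball ?_).le
        rw [dist_eq_norm]
        have : x + t • a + s • b - x = t • a + s • b := by abel
        rw [this]
        calc ‖t • a + s • b‖ ≤ |t| * ‖a‖ + |s| * ‖b‖ := by
              refine (norm_add_le _ _).trans ?_
              rw [norm_smul, norm_smul, Real.norm_eq_abs, Real.norm_eq_abs]
          _ ≤ |t| * (‖a‖ + ‖b‖ + 1) := by
              nlinarith [norm_nonneg a, norm_nonneg b, abs_nonneg t]
          _ < δ := by rwa [← lt_div_iff₀ hK])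
      (convex_uIcc _ _) Set.left_mem_uIcc Set.right_mem_uIcc
    simp only [zero_smul, add_zero, sub_zero, Real.norm_eq_abs] at hmv
    rw [dist_eq_norm]
    have hid : t⁻¹ • (f (x + t • a + t • b) - f (x + t • a)) - gb x =
        t⁻¹ • (f (x + t • a + t • b) - t • gb x - f (x + t • a)) := by
      rw [smul_sub, smul_sub, smul_sub, smul_smul, inv_mul_cancel₀ ht0, one_smul]
      abel
    rw [hid, norm_smul, norm_inv, Real.norm_eq_abs]
    have htp : 0 < |t| := abs_pos.2 ht0
    calc |t|⁻¹ * ‖f (x + t • a + t • b) - t • gb x - f (x + t • a)‖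
        ≤ |t|⁻¹ * (ε / 2 * |t|) := by gcongr
      _ = ε / 2 := by field_simp
      _ < ε := half_lt_self hε
  refine ((ha x).add key).congr fun t => ?_
  rw [← smul_add, smul_add t a b, ← add_assoc]
  congr 1
  abel

/-- A first-order Taylor formula with a crude constant. -/
theorem norm_sub_sub_smul_le_of_hasDerivAt {F : Type*} [NormedAddCommGroup F] [NormedSpace ℝ F]
    {u u' u'' : ℝ → F} {M : ℝ} (h₁ : ∀ t, HasDerivAt u (u' t) t)
    (h₂ : ∀ t, HasDerivAt u' (u'' t) t) (hM : ∀ t, ‖u'' t‖ ≤ M) (t : ℝ) :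
    ‖u t - u 0 - t • u' 0‖ ≤ M * t ^ 2 := by
  have hM0 : 0 ≤ M := (norm_nonneg _).trans (hM 0)
  have b₁ : ∀ s, ‖u' s - u' 0‖ ≤ M * |s| := fun s => by
    simpa using convex_univ.norm_image_sub_le_of_norm_hasDerivWithin_le
      (fun r _ => (h₂ r).hasDerivWithinAt) (fun r _ => hM r) (Set.mem_univ 0) (Set.mem_univ s)
  -- A second mean value inequality, with |s| ≤ |t| in the bound of the derivative; this crude bound
  -- is why no factor 1/2 appears.
  have hmv := Convex.norm_image_sub_le_of_norm_hasDerivWithin_le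
    (f := fun s : ℝ => u s - s • u' 0) (f' := fun s : ℝ => u' s - u' 0) (s := Set.uIcc 0 t)
    (x := 0) (y := t) (C := M * |t|)
    (fun s _ => by
      have h := (h₁ s).sub ((hasDerivAt_id s).smul_const (u' 0))
      rw [one_smul] at h
      exact h.hasDerivWithinAt)
    (fun s hs => (b₁ s).trans (by
      have := Set.abs_sub_left_of_mem_uIcc hs
      simp only [sub_zero] at this
      gcongr))
    (convex_uIcc _ _) Set.left_mem_uIcc Set.right_mem_uIcc
  simp only [zero_smul, sub_zero, Real.norm_eq_abs] at hmv
  calc ‖u t - u 0 - t • u' 0‖ = ‖u t - t • u' 0 - u 0‖ := by congr 1; abel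
    _ ≤ M * |t| * |t| := hmv
    _ = M * t ^ 2 := by rw [mul_assoc, abs_mul_abs_self]; ring

end TVSCalculus

/-! ### Integrals of Schwartz functions depending on parameters -/

section ParametricIntegral

open scoped ContDiff

variable {E E' W G : Type*} [NormedAddCommGroup E] [NormedSpace ℝ E]
  [NormedAddCommGroup E'] [NormedSpace ℝ E']
  [NormedAddCommGroup G] [NormedSpace ℝ G]

/-- Differentiation under the integral sign at every order, each order with its own bound uniform in
x. The full Taylor series identifies the iterated derivatives of the integral, which is what
Schwartz seminorms require. -/
theorem hasFTaylorSeriesUpTo_integral [CompleteSpace G] [MeasurableSpace W] (μ : Measure W)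
    (h : E → W → G)
    (hs : ∀ w, ContDiff ℝ ∞ fun x => h x w)
    (hm : ∀ (n : ℕ) x, AEStronglyMeasurable (fun w => iteratedFDeriv ℝ n (fun x => h x w) x) μ)
    (hb : ∀ n : ℕ, ∃ b : W → ℝ, Integrable b μ ∧
      ∀ x w, ‖iteratedFDeriv ℝ n (fun x => h x w) x‖ ≤ b w) :
    HasFTaylorSeriesUpTo ∞ (fun x => ∫ w, h x w ∂μ)
      fun x n => ∫ w, iteratedFDeriv ℝ n (fun x => h x w) x ∂μ := by
  have hint : ∀ (n : ℕ) x, Integrable (fun w => iteratedFDeriv ℝ n (fun x => h x w) x) μ := by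
    intro n x
    obtain ⟨b, hbi, hle⟩ := hb n
    exact hbi.mono' (hm n x) (Eventually.of_forall fun w => hle x w)
  have hderiv : ∀ (m : ℕ) x, HasFDerivAt
      (fun x => ∫ w, iteratedFDeriv ℝ m (fun x => h x w) x ∂μ)
      (∫ w, iteratedFDeriv ℝ (m + 1) (fun x => h x w) x ∂μ).curryLeft x := by
    intro m x
    obtain ⟨b, hbi, hle⟩ := hb (m + 1)
    -- Currying is a continuous linear equivalence, hence commutes with the integral.
    have hcurry : (∫ w, iteratedFDeriv ℝ (m + 1) (fun x => h x w) x ∂μ).curryLeft =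
        ∫ w, (iteratedFDeriv ℝ (m + 1) (fun x => h x w) x).curryLeft ∂μ := by
      exact (ContinuousLinearEquiv.integral_comp_comm (𝕜 := ℝ) (μ := μ)
        (E := ContinuousMultilinearMap ℝ (fun _ : Fin (m + 1) => E) G)
        (F := E →L[ℝ] ContinuousMultilinearMap ℝ (fun _ : Fin m => E) G)
        (continuousMultilinearCurryLeftEquiv ℝ (fun _ : Fin (m + 1) => E)
          G).toContinuousLinearEquiv
        (fun w => iteratedFDeriv ℝ (m + 1) (fun x => h x w) x)).symm
    rw [hcurry]
    refine hasFDerivAt_integral_of_dominated_of_fderiv_le (s := Set.univ) (bound := b)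
      (F' := fun x w => (iteratedFDeriv ℝ (m + 1) (fun x => h x w) x).curryLeft) univ_mem
      (Eventually.of_forall fun y => hm m y) (hint m x) ?_ ?_ hbi ?_
    · exact (continuousMultilinearCurryLeftEquiv ℝ (fun _ : Fin (m + 1) => E)
        G).continuous.comp_aestronglyMeasurable (hm (m + 1) x)
    · refine Eventually.of_forall fun w y _ => ?_
      rw [ContinuousMultilinearMap.curryLeft_norm]
      exact hle y w
    · refine Eventually.of_forall fun w y _ => ?_
      have hd : DifferentiableAt ℝ (iteratedFDeriv ℝ m fun x => h x w) y :=
        ((hs w).differentiable_iteratedFDeriv (m := m) (mod_cast WithTop.coe_lt_top m)) y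
      exact hd.hasFDerivAt
  refine ⟨fun x => ?_, fun m _ x => hderiv m x, fun m _ => ?_⟩
  · change continuousMultilinearCurryFin0 ℝ E G
      (∫ w, iteratedFDeriv ℝ 0 (fun x => h x w) x ∂μ) = _
    exact ((continuousMultilinearCurryFin0 ℝ E G).toContinuousLinearEquiv.integral_comp_comm
      (fun w => iteratedFDeriv ℝ 0 (fun x => h x w) x)).symm
  · exact continuous_iff_continuousAt.2 fun x => (hderiv m x).continuousAt

theorem SchwartzMap.iteratedFDeriv_affine (f : 𝓢(E', ℂ)) (L : E →L[ℝ] E') (a : E') (c : ℂ)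
    (n : ℕ) (x : E) :
    iteratedFDeriv ℝ n (fun x => c * f (L x + a)) x =
      c • (iteratedFDeriv ℝ n f (L x + a)).compContinuousLinearMap fun _ => L := by
  have hf : ContDiff ℝ n fun y => f (y + a) := (f.smooth n).comp (contDiff_id.add contDiff_const)
  have h1 := L.iteratedFDeriv_comp_right hf x (le_refl (n : WithTop ℕ∞))
  rw [iteratedFDeriv_comp_add_right] at h1
  have h2 := iteratedFDeriv_const_smul_apply' (𝕜 := ℝ) (R := ℂ) (a := c) (i := n)
    (f := fun x => f (L x + a)) (x := x) ((hf.comp L.contDiff).contDiffAt)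
  simp only [smul_eq_mul] at h2
  rw [h2, ← h1]
  rfl

theorem SchwartzMap.norm_iteratedFDeriv_affine_le (f : 𝓢(E', ℂ)) (L : E →L[ℝ] E') (a : E')
    (c : ℂ) (n : ℕ) (x : E) :
    ‖iteratedFDeriv ℝ n (fun x => c * f (L x + a)) x‖ ≤
      ‖c‖ * (‖iteratedFDeriv ℝ n f (L x + a)‖ * ‖L‖ ^ n) := by
  rw [f.iteratedFDeriv_affine, norm_smul]
  gcongr
  simpa using (iteratedFDeriv ℝ n f (L x + a)).norm_compContinuousLinearMap_le fun _ => L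

/-- Integrals `∫ c(w) f(L_w x + a_w) dw` of affine substitutions in a Schwartz function are
Schwartz functions. -/
theorem SchwartzMap.exists_integral_affine [MeasurableSpace W] [TopologicalSpace W]
    [OpensMeasurableSpace W] [SecondCountableTopology W] (μ : Measure W) (f : 𝓢(E', ℂ))
    (L : W → E →L[ℝ] E') (a : W → E') (c : W → ℂ) (hL : Continuous L) (ha : Continuous a)
    (hc : Continuous c)
    (hb : ∀ k n : ℕ, ∃ b : W → ℝ, Integrable b μ ∧ ∀ x w,
      ‖x‖ ^ k * (‖c w‖ * (‖iteratedFDeriv ℝ n f (L w x + a w)‖ * ‖L w‖ ^ n)) ≤ b w) :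
    ∃ S : 𝓢(E, ℂ), (∀ x, S x = ∫ w, c w * f (L w x + a w) ∂μ) ∧
      ∀ (k n : ℕ) (b : W → ℝ), Integrable b μ → (∀ x w,
        ‖x‖ ^ k * (‖c w‖ * (‖iteratedFDeriv ℝ n f (L w x + a w)‖ * ‖L w‖ ^ n)) ≤ b w) →
        SchwartzMap.seminorm ℝ k n S ≤ ∫ w, b w ∂μ := by
  have hcont : ∀ (n : ℕ) x, Continuous fun w =>
      iteratedFDeriv ℝ n (fun x => c w * f (L w x + a w)) x := by
    intro n x
    simp only [f.iteratedFDeriv_affine]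
    have h1 : Continuous (iteratedFDeriv ℝ n f) :=
      (f.smooth n).continuous_iteratedFDeriv le_rfl
    have h2 : Continuous fun w => L w x + a w := by fun_prop
    have h3 : Continuous fun w => ContinuousMultilinearMap.compContinuousLinearMapContinuousMultilinear
        ℝ (fun _ : Fin n => E) (fun _ : Fin n => E') ℂ (fun _ => L w) :=
      (ContinuousMultilinearMap.cont _).comp (continuous_pi fun _ => hL)
    exact hc.smul (h3.clm_apply (h1.comp h2))
  have hT := hasFTaylorSeriesUpTo_integral μ (fun x w => c w * f (L w x + a w))
    (fun w => contDiff_const.mul ((f.smooth ⊤).comp ((L w).contDiff.add contDiff_const)))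
    (fun n x => (hcont n x).aestronglyMeasurable) (fun n => by
      obtain ⟨b, hbi, hle⟩ := hb 0 n
      refine ⟨b, hbi, fun x w => (f.norm_iteratedFDeriv_affine_le _ _ _ n x).trans ?_⟩
      simpa using hle x w)
  have hbound : ∀ (k n : ℕ) (b : W → ℝ), Integrable b μ → (∀ x w,
        ‖x‖ ^ k * (‖c w‖ * (‖iteratedFDeriv ℝ n f (L w x + a w)‖ * ‖L w‖ ^ n)) ≤ b w) →
        ∀ x, ‖x‖ ^ k * ‖iteratedFDeriv ℝ n (fun x => ∫ w, c w * f (L w x + a w) ∂μ) x‖ ≤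
          ∫ w, b w ∂μ := by
    intro k n b hbi hle x
    rw [← hT.eq_iteratedFDeriv (mod_cast le_top) x]
    have hb' := integral_mono_of_nonneg (μ := μ)
      (f := fun w => ‖x‖ ^ k * ‖iteratedFDeriv ℝ n (fun x => c w * f (L w x + a w)) x‖) (g := b)
      (Eventually.of_forall fun w => by dsimp only [Pi.zero_apply]; positivity) hbi
      (Eventually.of_forall fun w => (mul_le_mul_of_nonneg_left
        (f.norm_iteratedFDeriv_affine_le _ _ _ n x) (by positivity)).trans (hle x w))
    refine le_trans ?_ hb'
    rw [integral_const_mul]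
    gcongr
    exact norm_integral_le_integral_norm _
  refine ⟨⟨fun x => ∫ w, c w * f (L w x + a w) ∂μ, hT.contDiff, fun k n => ?_⟩,
    fun x => rfl, fun k n b hbi hle => ?_⟩
  · obtain ⟨b, hbi, hle⟩ := hb k n
    exact ⟨_, hbound k n b hbi hle⟩
  · refine SchwartzMap.seminorm_le_bound ℝ k n _ ?_ (hbound k n b hbi hle)
    refine integral_nonneg fun w => le_trans ?_ (hle 0 w)
    positivity

/-- The seminorm `sup_{k' ≤ k, n' ≤ n} p_{k',n'}` on the Schwartz space. -/
def schwartzSup (E : Type*) [NormedAddCommGroup E] [NormedSpace ℝ E] (k n : ℕ) :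
    Seminorm ℝ 𝓢(E, ℂ) :=
  (Finset.Iic (k, n)).sup fun m => SchwartzMap.seminorm ℝ m.1 m.2

theorem one_add_pow_mul_le_schwartzSup (f : 𝓢(E, ℂ)) (k n : ℕ) (x : E) :
    (1 + ‖x‖) ^ k * ‖iteratedFDeriv ℝ n f x‖ ≤ 2 ^ k * schwartzSup E k n f :=
  SchwartzMap.one_add_le_sup_seminorm_apply (m := (k, n)) le_rfl le_rfl f x

theorem one_add_pow_mul_norm_le_schwartzSup (f : 𝓢(E, ℂ)) (k : ℕ) (x : E) :
    (1 + ‖x‖) ^ k * ‖f x‖ ≤ 2 ^ k * schwartzSup E k 0 f := by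
  simpa using one_add_pow_mul_le_schwartzSup f k 0 x

theorem continuous_schwartzSup (k n : ℕ) : Continuous (schwartzSup E k n) := by
  have h : ∀ m : ℕ × ℕ, Continuous (SchwartzMap.seminorm ℝ m.1 m.2 : Seminorm ℝ 𝓢(E, ℂ)) :=
    fun m => (schwartz_withSeminorms ℝ E ℂ).continuous_seminorm m
  unfold schwartzSup
  induction (Finset.Iic (k, n)) using Finset.induction_on with
  | empty => exact continuous_zero
  | insert a s ha ih =>
    rw [Finset.sup_insert]
    exact (h a).sup ih

theorem integrable_one_add_norm_pow_inv [FiniteDimensional ℝ E] [MeasurableSpace E]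
    [BorelSpace E] (μ : Measure E) [μ.IsAddHaarMeasure] :
    Integrable (fun x => ((1 + ‖x‖) ^ μ.integrablePower)⁻¹) μ := by
  refine (Measure.integrable_pow_neg_integrablePower μ).congr (Eventually.of_forall fun x => ?_)
  simp [Real.rpow_neg (show 0 ≤ 1 + ‖x‖ by positivity)]

/-- A bilinear map on Schwartz spaces which is bounded for the seminorms is jointly continuous. -/
theorem SchwartzMap.continuous_bilin_of_bound
    {F : Type*} [NormedAddCommGroup F] [NormedSpace ℝ F]
    (B : 𝓢(E, ℂ) →ₗ[ℝ] 𝓢(E', ℂ) →ₗ[ℝ] 𝓢(F, ℂ))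
    (hB : ∀ k n : ℕ, ∃ (C : ℝ) (k₁ n₁ k₂ n₂ : ℕ), ∀ f g,
      SchwartzMap.seminorm ℝ k n (B f g) ≤ C * (schwartzSup E k₁ n₁ f * schwartzSup E' k₂ n₂ g)) :
    Continuous fun p : 𝓢(E, ℂ) × 𝓢(E', ℂ) => B p.1 p.2 := by
  rw [continuous_iff_continuousAt]
  rintro ⟨f₀, g₀⟩
  rw [ContinuousAt, (schwartz_withSeminorms ℝ F ℂ).tendsto_nhds]
  rintro ⟨k, n⟩ ε hε
  obtain ⟨C, k₁, n₁, k₂, n₂, hC⟩ := hB k n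
  have ht : Tendsto (fun p : 𝓢(E, ℂ) × 𝓢(E', ℂ) =>
      C * (schwartzSup E k₁ n₁ (p.1 - f₀) * schwartzSup E' k₂ n₂ p.2) +
        C * (schwartzSup E k₁ n₁ f₀ * schwartzSup E' k₂ n₂ (p.2 - g₀)))
      (𝓝 (f₀, g₀)) (𝓝 0) := by
    have hcont : Continuous (fun p : 𝓢(E, ℂ) × 𝓢(E', ℂ) =>
      C * (schwartzSup E k₁ n₁ (p.1 - f₀) * schwartzSup E' k₂ n₂ p.2) +
        C * (schwartzSup E k₁ n₁ f₀ * schwartzSup E' k₂ n₂ (p.2 - g₀))) := by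
      have h1 : Continuous fun p : 𝓢(E, ℂ) × 𝓢(E', ℂ) => schwartzSup E k₁ n₁ (p.1 - f₀) :=
        (continuous_schwartzSup _ _).comp (continuous_fst.sub continuous_const)
      have h2 : Continuous fun p : 𝓢(E, ℂ) × 𝓢(E', ℂ) => schwartzSup E' k₂ n₂ (p.2 - g₀) :=
        (continuous_schwartzSup _ _).comp (continuous_snd.sub continuous_const)
      have h3 : Continuous fun p : 𝓢(E, ℂ) × 𝓢(E', ℂ) => schwartzSup E' k₂ n₂ p.2 :=
        (continuous_schwartzSup _ _).comp continuous_snd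
      fun_prop
    simpa using hcont.tendsto (f₀, g₀)
  filter_upwards [ht.eventually (gt_mem_nhds hε)] with p hp
  refine lt_of_le_of_lt ?_ hp
  -- Each summand has one factor tending to zero, the other one keeping bounded seminorms.
  have hsplit : B p.1 p.2 - B f₀ g₀ = B (p.1 - f₀) p.2 + B f₀ (p.2 - g₀) := by
    simp only [map_sub, LinearMap.sub_apply]
    abel
  change SchwartzMap.seminorm ℝ k n (B p.1 p.2 - B f₀ g₀) ≤ _
  rw [hsplit]
  exact (map_add_le_add _ _ _).trans (add_le_add (hC _ _) (hC _ _))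

end ParametricIntegral

namespace HTypeAlgebra

variable {V Z : Type*} [NormedAddCommGroup V] [InnerProductSpace ℝ V] [FiniteDimensional ℝ V]
  [MeasurableSpace V] [BorelSpace V]
  [NormedAddCommGroup Z] [InnerProductSpace ℝ Z] [FiniteDimensional ℝ Z]
  [MeasurableSpace Z] [BorelSpace Z]

/-! ### The group law -/

section GroupLaw

omit [MeasurableSpace V] [BorelSpace V] [FiniteDimensional ℝ Z] [MeasurableSpace Z] [BorelSpace Z]

variable (𝔤 : HTypeAlgebra V Z)

theorem bracket_swap (u v : V) : 𝔤.bracket u v = -𝔤.bracket v u := by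
  have h := 𝔤.bracket_self (u + v)
  simp only [map_add, add_apply, 𝔤.bracket_self, zero_add, add_zero] at h
  exact eq_neg_of_add_eq_zero_right h

theorem norm_bracket_le (u v : V) : ‖𝔤.bracket u v‖ ≤ ‖𝔤.bracket‖ * ‖u‖ * ‖v‖ :=
  𝔤.bracket.le_opNorm₂ u v

theorem mul_assoc' (x y w : V × Z) : 𝔤.mul (𝔤.mul x y) w = 𝔤.mul x (𝔤.mul y w) := by
  ext
  · simp [mul, add_assoc]
  · simp only [mul, map_add, add_apply, smul_add]
    abel

@[simp] theorem mul_zero' (x : V × Z) : 𝔤.mul x 0 = x := by simp [mul]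

@[simp] theorem zero_mul' (x : V × Z) : 𝔤.mul 0 x = x := by simp [mul]

@[simp] theorem mul_neg_self (x : V × Z) : 𝔤.mul x (-x) = 0 := by
  simp [mul, 𝔤.bracket_self]

@[simp] theorem neg_mul_self (x : V × Z) : 𝔤.mul (-x) x = 0 := by
  simp [mul, 𝔤.bracket_self]

theorem neg_mul_rev (x y : V × Z) : -𝔤.mul x y = 𝔤.mul (-y) (-x) := by
  ext
  · simp [mul, add_comm]
  · simp only [mul, Prod.neg_mk, Prod.snd_neg, Prod.fst_neg, map_neg,
      neg_apply, neg_neg]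
    rw [𝔤.bracket_swap x.1 y.1, smul_neg]
    abel

@[simp] theorem mul_neg_cancel_right' (x y : V × Z) : 𝔤.mul (𝔤.mul x y) (-y) = x := by
  rw [mul_assoc', mul_neg_self, mul_zero']

@[simp] theorem mul_cancel_neg_right (x y : V × Z) : 𝔤.mul (𝔤.mul x (-y)) y = x := by
  rw [mul_assoc', neg_mul_self, mul_zero']

@[simp] theorem mul_neg_cancel_left' (x y : V × Z) : 𝔤.mul x (𝔤.mul (-x) y) = y := by
  rw [← mul_assoc', mul_neg_self, zero_mul']

@[simp] theorem neg_mul_cancel_left' (x y : V × Z) : 𝔤.mul (-x) (𝔤.mul x y) = y := by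
  rw [← mul_assoc', neg_mul_self, zero_mul']

theorem continuous_mul' : Continuous fun p : (V × Z) × (V × Z) => 𝔤.mul p.1 p.2 := by
  unfold mul
  fun_prop

@[fun_prop]
theorem _root_.Continuous.hmul {X : Type*} [TopologicalSpace X] {𝔤 : HTypeAlgebra V Z}
    {f g : X → V × Z} (hf : Continuous f)
    (hg : Continuous g) : Continuous fun x => 𝔤.mul (f x) (g x) :=
  𝔤.continuous_mul'.comp (hf.prodMk hg)

/-- A Peetre-type inequality, by which polynomial weights pass between x, w and x w⁻¹. -/
theorem norm_mul_le' (x y : V × Z) :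
    ‖𝔤.mul x y‖ ≤ (1 + ‖𝔤.bracket‖) * ((1 + ‖x‖) * (1 + ‖y‖)) := by
  have hx1 := norm_fst_le x
  have hx2 := norm_snd_le x
  have hy1 := norm_fst_le y
  have hy2 := norm_snd_le y
  have hb : ‖𝔤.bracket x.1 y.1‖ ≤ ‖𝔤.bracket‖ * (‖x‖ * ‖y‖) :=
    (𝔤.norm_bracket_le _ _).trans (by rw [mul_assoc]; gcongr)
  have hβ := norm_nonneg 𝔤.bracket
  have h0 := norm_nonneg x
  have h1 := norm_nonneg y
  have hxy : 0 ≤ ‖x‖ * ‖y‖ := by positivity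
  have hbx : 0 ≤ ‖𝔤.bracket‖ * ‖x‖ := by positivity
  have hby : 0 ≤ ‖𝔤.bracket‖ * ‖y‖ := by positivity
  have hbxy : 0 ≤ ‖𝔤.bracket‖ * (‖x‖ * ‖y‖) := by positivity
  rw [Prod.norm_def, mul]
  refine max_le ?_ ?_
  · refine (norm_add_le _ _).trans ?_
    nlinarith
  · refine (norm_add_le _ _).trans ((add_le_add (norm_add_le _ _) le_rfl).trans ?_)
    rw [norm_smul]
    norm_num
    nlinarith

/-- The linear part `x ↦ (x₁, x₂ - [x₁, w₁] / 2)` of the right translation `x ↦ x w⁻¹`. -/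
def rightLin (w : V × Z) : V × Z →L[ℝ] V × Z :=
  ContinuousLinearMap.id ℝ (V × Z) - (2⁻¹ : ℝ) • (ContinuousLinearMap.inr ℝ V Z).comp
    ((𝔤.bracket.flip w.1).comp (ContinuousLinearMap.fst ℝ V Z))

/-- Right translations are affine, which brings convolutions under
`SchwartzMap.exists_integral_affine`. -/
theorem rightLin_add_neg (w x : V × Z) : 𝔤.rightLin w x + -w = 𝔤.mul x (-w) := by
  ext
  · simp [rightLin, mul]
  · simp [rightLin, mul]
    abel

theorem continuous_rightLin : Continuous 𝔤.rightLin := by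
  unfold rightLin
  fun_prop

theorem norm_rightLin_le (w : V × Z) : ‖𝔤.rightLin w‖ ≤ (1 + ‖𝔤.bracket‖) * (1 + ‖w‖) := by
  refine ContinuousLinearMap.opNorm_le_bound _ (by positivity) fun x => ?_
  have hx1 := norm_fst_le x
  have hx2 := norm_snd_le x
  have hw1 := norm_fst_le w
  have hb : ‖𝔤.bracket x.1 w.1‖ ≤ ‖𝔤.bracket‖ * (‖x‖ * ‖w‖) :=
    (𝔤.norm_bracket_le _ _).trans (by rw [mul_assoc]; gcongr)
  have hval : 𝔤.rightLin w x = (x.1, x.2 - (2⁻¹ : ℝ) • 𝔤.bracket x.1 w.1) := by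
    ext <;> simp [rightLin]
  have h0 := norm_nonneg x
  have h1 := norm_nonneg w
  have hβ := norm_nonneg 𝔤.bracket
  have hxy : 0 ≤ ‖x‖ * ‖w‖ := by positivity
  have hbx : 0 ≤ ‖𝔤.bracket‖ * ‖x‖ := by positivity
  have hbxy : 0 ≤ ‖𝔤.bracket‖ * (‖x‖ * ‖w‖) := by positivity
  rw [hval, Prod.norm_def]
  refine max_le ?_ ?_
  · dsimp only
    nlinarith
  · refine (norm_sub_le _ _).trans ?_
    rw [norm_smul]
    norm_num
    nlinarith

/-- The dilation `(v, z) ↦ (ε v, ε² z)`. -/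
def dil (ε : ℝ) : V × Z →L[ℝ] V × Z :=
  (ε • ContinuousLinearMap.id ℝ V).prodMap ((ε ^ 2) • ContinuousLinearMap.id ℝ Z)

@[simp] theorem dil_apply (ε : ℝ) (x : V × Z) : dil ε x = (ε • x.1, ε ^ 2 • x.2) := rfl

theorem dil_mul (ε : ℝ) (x y : V × Z) : dil ε (𝔤.mul x y) = 𝔤.mul (dil ε x) (dil ε y) := by
  ext
  · simp [mul]
  · simp only [mul, dil_apply, map_smul, smul_apply, smul_add, smul_smul]
    congr 2
    ring

/-- The dilation as an equivalence. -/
def dilEquiv (ε : ℝ) (hε : ε ≠ 0) : (V × Z) ≃L[ℝ] (V × Z) :=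
  ContinuousLinearEquiv.equivOfInverse (dil ε) (dil ε⁻¹)
    (fun x => by ext <;> simp [smul_smul, hε])
    (fun x => by ext <;> simp [smul_smul, hε])

end GroupLaw

/-! ### Invariance of Lebesgue measure under group translations -/

section Measure

variable (𝔤 : HTypeAlgebra V Z)

/-- A translation of 𝔳 coupled with, over each point of 𝔳, a translation of 𝔷. -/
theorem measurePreserving_mul_right (y : V × Z) :
    MeasurePreserving (fun x => 𝔤.mul x y) (volume : Measure (V × Z)) volume := by
  have h := (measurePreserving_add_right (volume : Measure V) y.1).skew_product
    (μc := (volume : Measure Z)) (μd := volume)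
    (g := fun v z => z + (y.2 + (2⁻¹ : ℝ) • 𝔤.bracket v y.1))
    (by fun_prop) (Eventually.of_forall fun v =>
      (measurePreserving_add_right (volume : Measure Z) _).map_eq)
  have hfun : (fun x => 𝔤.mul x y) =
      fun p : V × Z => (p.1 + y.1, p.2 + (y.2 + (2⁻¹ : ℝ) • 𝔤.bracket p.1 y.1)) := by
    ext x
    · rfl
    · exact add_assoc _ _ _
  rw [hfun]
  exact h

theorem measurePreserving_mul_left (y : V × Z) :
    MeasurePreserving (fun x => 𝔤.mul y x) (volume : Measure (V × Z)) volume := by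
  have h := (measurePreserving_add_left (volume : Measure V) y.1).skew_product
    (μc := (volume : Measure Z)) (μd := volume)
    (g := fun v z => y.2 + z + (2⁻¹ : ℝ) • 𝔤.bracket y.1 v)
    (by fun_prop) (Eventually.of_forall fun v =>
      ((measurePreserving_add_right (volume : Measure Z) _).comp
        (measurePreserving_add_left (volume : Measure Z) y.2)).map_eq)
  exact h

/-- Right translation as a homeomorphism. -/
def mulRightHomeomorph (y : V × Z) : (V × Z) ≃ₜ (V × Z) where
  toFun x := 𝔤.mul x y
  invFun x := 𝔤.mul x (-y)
  left_inv x := by simp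
  right_inv x := by simp

/-- Left translation as a homeomorphism. -/
def mulLeftHomeomorph (y : V × Z) : (V × Z) ≃ₜ (V × Z) where
  toFun x := 𝔤.mul y x
  invFun x := 𝔤.mul (-y) x
  left_inv x := by simp
  right_inv x := by simp

variable {G : Type*} [NormedAddCommGroup G] [NormedSpace ℝ G]

theorem integral_mul_right' (g : V × Z → G) (y : V × Z) :
    ∫ x, g (𝔤.mul x y) = ∫ x, g x :=
  (𝔤.measurePreserving_mul_right y).integral_comp
    (𝔤.mulRightHomeomorph y).measurableEmbedding g

theorem integral_mul_left' (g : V × Z → G) (y : V × Z) :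
    ∫ x, g (𝔤.mul y x) = ∫ x, g x :=
  (𝔤.measurePreserving_mul_left y).integral_comp
    (𝔤.mulLeftHomeomorph y).measurableEmbedding g

end Measure

/-! ### Convolution of Schwartz functions -/

section Convolution

variable (𝔤 : HTypeAlgebra V Z)

/-- The weight ‖x‖^k is shared between x w⁻¹ and w by `norm_mul_le'`, and further powers of 1 + ‖w‖
taken from `g` make the bound integrable. The estimate is bilinear in the seminorms so as to give
the joint continuity of the convolution. -/
theorem exists_conv (f g : 𝓢(V × Z, ℂ)) :
    ∃ S : 𝓢(V × Z, ℂ), (∀ x, S x = ∫ w, g w * f (𝔤.mul x (-w))) ∧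
      ∀ k n : ℕ, SchwartzMap.seminorm ℝ k n S ≤
        ((1 + ‖𝔤.bracket‖) ^ (k + n) * 2 ^ k *
          2 ^ (k + n + (volume : Measure (V × Z)).integrablePower) *
          ∫ w : V × Z, ((1 + ‖w‖) ^ (volume : Measure (V × Z)).integrablePower)⁻¹) *
        (schwartzSup (V × Z) k n f *
          schwartzSup (V × Z) (k + n + (volume : Measure (V × Z)).integrablePower) 0 g) := by
  set N := (volume : Measure (V × Z)).integrablePower
  set D : ℝ := 1 + ‖𝔤.bracket‖
  have hD : 0 ≤ D := by positivity
  have hint : Integrable (fun w : V × Z => ((1 + ‖w‖) ^ N)⁻¹) :=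
    integrable_one_add_norm_pow_inv volume
  have hbound : ∀ (k n : ℕ) (x w : V × Z), ‖x‖ ^ k * (‖g w‖ *
      (‖iteratedFDeriv ℝ n f (𝔤.rightLin w x + -w)‖ * ‖𝔤.rightLin w‖ ^ n)) ≤
      (D ^ (k + n) * 2 ^ k * 2 ^ (k + n + N) * (schwartzSup (V × Z) k n f *
        schwartzSup (V × Z) (k + n + N) 0 g)) * ((1 + ‖w‖) ^ N)⁻¹ := by
    intro k n x w
    rw [rightLin_add_neg]
    set u := 𝔤.mul x (-w) with hu
    have hx : ‖x‖ ≤ D * ((1 + ‖u‖) * (1 + ‖w‖)) := by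
      conv_lhs => rw [← 𝔤.mul_cancel_neg_right x w]
      exact 𝔤.norm_mul_le' _ _
    have hL := 𝔤.norm_rightLin_le w
    have hf := one_add_pow_mul_le_schwartzSup f k n u
    have hg := one_add_pow_mul_norm_le_schwartzSup g (k + n + N) w
    have hw : 0 < 1 + ‖w‖ := by positivity
    have hSf : 0 ≤ schwartzSup (V × Z) k n f := apply_nonneg _ _
    have hSg : 0 ≤ schwartzSup (V × Z) (k + n + N) 0 g := apply_nonneg _ _
    rw [← div_eq_mul_inv, le_div_iff₀ (by positivity)]
    calc ‖x‖ ^ k * (‖g w‖ * (‖iteratedFDeriv ℝ n f u‖ * ‖𝔤.rightLin w‖ ^ n)) * (1 + ‖w‖) ^ N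
        ≤ (D * ((1 + ‖u‖) * (1 + ‖w‖))) ^ k * (‖g w‖ * (‖iteratedFDeriv ℝ n f u‖ *
          (D * (1 + ‖w‖)) ^ n)) * (1 + ‖w‖) ^ N := by gcongr
      _ = D ^ (k + n) * (((1 + ‖u‖) ^ k * ‖iteratedFDeriv ℝ n f u‖) *
          ((1 + ‖w‖) ^ (k + n + N) * ‖g w‖)) := by
        simp only [mul_pow, pow_add]
        ring
      _ ≤ D ^ (k + n) * ((2 ^ k * schwartzSup (V × Z) k n f) *
          (2 ^ (k + n + N) * schwartzSup (V × Z) (k + n + N) 0 g)) := by gcongr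
      _ = _ := by ring
  obtain ⟨S, hS, hSb⟩ := SchwartzMap.exists_integral_affine (volume : Measure (V × Z)) f
    𝔤.rightLin (fun w => -w) g 𝔤.continuous_rightLin continuous_neg g.continuous
    (fun k n => ⟨_, hint.const_mul _, hbound k n⟩)
  refine ⟨S, fun x => ?_, fun k n => ?_⟩
  · simp only [hS, rightLin_add_neg]
  · refine (hSb k n _ (hint.const_mul _) (hbound k n)).trans_eq ?_
    rw [integral_const_mul]
    ring

/-- The convolution `f * g (x) = ∫ f (x w⁻¹) g w dw` of Schwartz functions. -/
def conv (f g : 𝓢(V × Z, ℂ)) : 𝓢(V × Z, ℂ) := (𝔤.exists_conv f g).choose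

theorem conv_apply (f g : 𝓢(V × Z, ℂ)) (x : V × Z) :
    𝔤.conv f g x = ∫ w, g w * f (𝔤.mul x (-w)) :=
  (𝔤.exists_conv f g).choose_spec.1 x

theorem integrable_conv (f g : 𝓢(V × Z, ℂ)) (x : V × Z) :
    Integrable fun w => g w * f (𝔤.mul x (-w)) := by
  refine Integrable.mul_bdd (c := SchwartzMap.seminorm ℝ 0 0 f) g.integrable ?_ ?_
  · have : Continuous fun w => f (𝔤.mul x (-w)) := by fun_prop
    exact this.aestronglyMeasurable
  · exact Eventually.of_forall fun w => f.norm_le_seminorm ℝ _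

/-- Convolution as a bilinear map. -/
def convₗ : 𝓢(V × Z, ℂ) →ₗ[ℝ] 𝓢(V × Z, ℂ) →ₗ[ℝ] 𝓢(V × Z, ℂ) :=
  LinearMap.mk₂ ℝ 𝔤.conv
    (fun f f' g => by
      ext x
      simp only [conv_apply, add_apply, mul_add]
      exact integral_add (𝔤.integrable_conv f g x) (𝔤.integrable_conv f' g x))
    (fun c f g => by
      ext x
      simp only [conv_apply, smul_apply, mul_smul_comm]
      exact integral_smul c _)
    (fun f g g' => by
      ext x
      simp only [conv_apply, add_apply, add_mul]
      exact integral_add (𝔤.integrable_conv f g x) (𝔤.integrable_conv f g' x))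
    (fun c f g => by
      ext x
      simp only [conv_apply, smul_apply, smul_mul_assoc]
      exact integral_smul c _)

theorem continuous_conv :
    Continuous fun p : 𝓢(V × Z, ℂ) × 𝓢(V × Z, ℂ) => 𝔤.convₗ p.1 p.2 :=
  SchwartzMap.continuous_bilin_of_bound 𝔤.convₗ fun k n => ⟨_, k, n, _, 0, fun f g =>
    (𝔤.exists_conv f g).choose_spec.2 k n⟩

end Convolution

/-! ### The partial Fourier transform in the central variable -/

section PartialFourier

/-- The exponential has modulus one and does not depend on v, so derivatives in v fall on `f` alone
and its decay suffices. -/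
theorem exists_partialFourier (f : 𝓢(V × Z, ℂ)) (l : Z) :
    ∃ S : 𝓢(V, ℂ), ∀ v, S v = ∫ z, Complex.exp (-(⟪l, z⟫_ℝ : ℂ) * Complex.I) * f (v, z) := by
  set N := (volume : Measure Z).integrablePower
  have hint : Integrable (fun w : Z => ((1 + ‖w‖) ^ N)⁻¹) :=
    integrable_one_add_norm_pow_inv volume
  obtain ⟨S, hS, -⟩ := SchwartzMap.exists_integral_affine (volume : Measure Z) f
    (fun _ => ContinuousLinearMap.inl ℝ V Z) (fun z => (0, z))
    (fun z => Complex.exp (-(⟪l, z⟫_ℝ : ℂ) * Complex.I)) continuous_const (by fun_prop)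
    (by fun_prop) (fun k n => by
      refine ⟨_, hint.const_mul (2 ^ (k + N) * schwartzSup (V × Z) (k + N) n f *
        ‖ContinuousLinearMap.inl ℝ V Z‖ ^ n), fun v z => ?_⟩
      have hf := one_add_pow_mul_le_schwartzSup f (k + N) n (v, z)
      have hv : ‖v‖ ≤ 1 + ‖(v, z)‖ := by linarith [norm_fst_le (v, z)]
      have hz : ‖z‖ ≤ ‖(v, z)‖ := norm_snd_le (v, z)
      have hexp : ‖Complex.exp (-(⟪l, z⟫_ℝ : ℂ) * Complex.I)‖ = 1 := by
        rw [← Complex.ofReal_neg, Complex.norm_exp_ofReal_mul_I]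
      have heq : ContinuousLinearMap.inl ℝ V Z v + (0, z) = (v, z) := by simp
      rw [hexp, heq, one_mul, ← div_eq_mul_inv, le_div_iff₀ (by positivity)]
      calc ‖v‖ ^ k * (‖iteratedFDeriv ℝ n f (v, z)‖ * ‖ContinuousLinearMap.inl ℝ V Z‖ ^ n) *
            (1 + ‖z‖) ^ N
          ≤ (1 + ‖(v, z)‖) ^ k * (‖iteratedFDeriv ℝ n f (v, z)‖ *
            ‖ContinuousLinearMap.inl ℝ V Z‖ ^ n) * (1 + ‖(v, z)‖) ^ N := by gcongr
        _ = ((1 + ‖(v, z)‖) ^ (k + N) * ‖iteratedFDeriv ℝ n f (v, z)‖) *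
            ‖ContinuousLinearMap.inl ℝ V Z‖ ^ n := by rw [pow_add]; ring
        _ ≤ _ := by gcongr)
  refine ⟨S, fun v => ?_⟩
  simp [hS]

/-- The partial Fourier transform `v ↦ ∫ f (v, z) e^{-i ⟨l, z⟩} dz`. -/
def partialFourier (f : 𝓢(V × Z, ℂ)) (l : Z) : 𝓢(V, ℂ) := (exists_partialFourier f l).choose

theorem partialFourier_apply (f : 𝓢(V × Z, ℂ)) (l : Z) (v : V) :
    partialFourier f l v = ∫ z, Complex.exp (-(⟪l, z⟫_ℝ : ℂ) * Complex.I) * f (v, z) :=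
  (exists_partialFourier f l).choose_spec v

end PartialFourier

end HTypeAlgebra

/-! ### Modulations and translations of L²(ℝ^d) -/

theorem coeFn_modulate {d : ℕ} {c : EuclideanSpace ℝ (Fin d) → ℝ} (hc : Continuous c)
    (Φ : L2 d) : modulate c hc Φ =ᵐ[volume] fun ξ => Complex.exp (Complex.I * (c ξ : ℂ)) * Φ ξ :=
  (memLp_modulate hc Φ).coeFn_toLp

theorem norm_modulate_le {d : ℕ} {c : EuclideanSpace ℝ (Fin d) → ℝ} (hc : Continuous c) :
    ‖modulate c hc‖ ≤ 1 :=
  LinearMap.mkContinuous_norm_le _ zero_le_one _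

theorem coeFn_shift {d : ℕ} (a : EuclideanSpace ℝ (Fin d)) (Φ : L2 d) :
    shift a Φ =ᵐ[volume] fun ξ => Φ (ξ + a) :=
  Lp.coeFn_compMeasurePreserving Φ (measurePreserving_add_right volume a)

theorem norm_shift_apply {d : ℕ} (a : EuclideanSpace ℝ (Fin d)) (Φ : L2 d) :
    ‖shift a Φ‖ = ‖Φ‖ :=
  (Lp.compMeasurePreservingₗᵢ ℂ (fun ξ => ξ + a)
    (measurePreserving_add_right volume a)).norm_map Φ

namespace HTypeAlgebra

variable {V Z : Type*} [NormedAddCommGroup V] [InnerProductSpace ℝ V] [FiniteDimensional ℝ V]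
  [MeasurableSpace V] [BorelSpace V]
  [NormedAddCommGroup Z] [InnerProductSpace ℝ Z] [FiniteDimensional ℝ Z]
  [MeasurableSpace Z] [BorelSpace Z]

namespace Frame

variable {𝔤 : HTypeAlgebra V Z} {d : ℕ} (F : 𝔤.Frame d)

/-! ### The representations -/

theorem coeFn_rep (l : Z) (x : V × Z) (Φ : L2 d) :
    F.rep l x Φ =ᵐ[volume] fun ξ =>
      Complex.exp (Complex.I * (F.phase l x ξ : ℂ)) * Φ (ξ + √‖l‖ • F.pCoord l x) := by
  filter_upwards [coeFn_modulate (F.continuous_phase l x) (shift (√‖l‖ • F.pCoord l x) Φ),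
    coeFn_shift (√‖l‖ • F.pCoord l x) Φ] with ξ h1 h2
  rw [← h2]
  exact h1

theorem norm_rep_apply_le (l : Z) (x : V × Z) (Φ : L2 d) : ‖F.rep l x Φ‖ ≤ ‖Φ‖ := by
  have h := (modulate (F.phase l x) (F.continuous_phase l x)).le_of_opNorm_le
    (norm_modulate_le _) (shift (√‖l‖ • F.pCoord l x) Φ)
  rw [one_mul, norm_shift_apply] at h
  exact h

theorem pCoord_mul (l : Z) (x y : V × Z) :
    F.pCoord l (𝔤.mul x y) = F.pCoord l x + F.pCoord l y := by
  ext j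
  simp [pCoord, mul, inner_add_right]

theorem qCoord_mul (l : Z) (x y : V × Z) :
    F.qCoord l (𝔤.mul x y) = F.qCoord l x + F.qCoord l y := by
  ext j
  simp [qCoord, mul, inner_add_right]

/-- Both vectors are expanded in the frame, where the form is |λ|J and only pairs P_j, Q_j
contribute. -/
theorem inner_bracket {l : Z} (hl : l ≠ 0) (x y : V × Z) :
    ⟪l, 𝔤.bracket x.1 y.1⟫_ℝ =
      ‖l‖ * (⟪F.pCoord l x, F.qCoord l y⟫_ℝ - ⟪F.pCoord l y, F.qCoord l x⟫_ℝ) := by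
  have hx := (F.basis l).sum_repr' x.1
  have hy := (F.basis l).sum_repr' y.1
  have hexp : 𝔤.bracket x.1 y.1 = ∑ i, ∑ j, (⟪F.basis l i, x.1⟫_ℝ * ⟪F.basis l j, y.1⟫_ℝ) •
      𝔤.bracket (F.basis l i) (F.basis l j) := by
    conv_lhs => rw [← hx, ← hy]
    simp only [map_sum, sum_apply, map_smul, smul_apply, Finset.smul_sum, smul_smul]
    rw [Finset.sum_comm]
    simp only [mul_comm]
  rw [hexp]
  simp only [inner_sum, inner_smul_right, F.basis_form l hl]
  simp [Fintype.sum_sum_type, Matrix.one_apply, pCoord, qCoord, PiLp.inner_apply, mul_sub,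
    Finset.mul_sum]
  rw [← sub_eq_add_neg]
  congr 1 <;> exact Finset.sum_congr rfl fun j _ => by ring

/-- The cocycle identity behind the group property. Shifting ξ by √|λ| p_x creates |λ| p_x·q_y,
which is the mixed part |λ|(p_x·q_y + p_y·q_x)/2 of the product plus the bracket term |λ|(p_x·q_y -
p_y·q_x)/2. -/
theorem phase_mul {l : Z} (hl : l ≠ 0) (x y : V × Z) (ξ : EuclideanSpace ℝ (Fin d)) :
    F.phase l x ξ + F.phase l y (ξ + √‖l‖ • F.pCoord l x) = F.phase l (𝔤.mul x y) ξ := by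
  simp only [phase, pCoord_mul, qCoord_mul, inner_add_left, inner_add_right, inner_smul_left]
  have h1 : ⟪l, (𝔤.mul x y).2⟫_ℝ = ⟪l, x.2⟫_ℝ + ⟪l, y.2⟫_ℝ + 2⁻¹ * ⟪l, 𝔤.bracket x.1 y.1⟫_ℝ := by
    simp [mul, inner_add_right, inner_smul_right]
  have h2 : √‖l‖ * √‖l‖ = ‖l‖ := Real.mul_self_sqrt (norm_nonneg l)
  rw [h1, F.inner_bracket hl]
  simp only [conj_trivial]
  linear_combination ⟪F.pCoord l x, F.qCoord l y⟫_ℝ * h2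

theorem rep_comp {l : Z} (hl : l ≠ 0) (x y : V × Z) :
    (F.rep l x).comp (F.rep l y) = F.rep l (𝔤.mul x y) := by
  refine ContinuousLinearMap.ext fun Φ => Lp.ext ?_
  have hq := (measurePreserving_add_right (volume : Measure (EuclideanSpace ℝ (Fin d)))
    (√‖l‖ • F.pCoord l x)).quasiMeasurePreserving.ae (F.coeFn_rep l y Φ)
  filter_upwards [F.coeFn_rep l x (F.rep l y Φ), hq, F.coeFn_rep l (𝔤.mul x y) Φ] with ξ h1 h2 h3
  rw [ContinuousLinearMap.comp_apply, h1, h2, h3, ← F.phase_mul hl, ← mul_assoc, ← Complex.exp_add,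
    pCoord_mul, smul_add, add_assoc]
  push_cast
  ring_nf

theorem rep_comp_apply {l : Z} (hl : l ≠ 0) (x y : V × Z) (Φ : L2 d) :
    F.rep l x (F.rep l y Φ) = F.rep l (𝔤.mul x y) Φ := by
  rw [← F.rep_comp hl]
  rfl

theorem rep_zero (l : Z) : F.rep l 0 = ContinuousLinearMap.id ℂ (L2 d) := by
  refine ContinuousLinearMap.ext fun Φ => Lp.ext ?_
  have hp : F.pCoord l 0 = 0 := by ext j; simp [pCoord]
  have hq : F.qCoord l 0 = 0 := by ext j; simp [qCoord]
  filter_upwards [F.coeFn_rep l 0 Φ] with ξ h1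
  simp [h1, phase, hp, hq]

/-- π_x is a contraction, and so is its inverse π_{-x}. -/
theorem norm_rep_apply {l : Z} (hl : l ≠ 0) (x : V × Z) (Φ : L2 d) : ‖F.rep l x Φ‖ = ‖Φ‖ := by
  refine le_antisymm (F.norm_rep_apply_le l x Φ) ?_
  have h := F.norm_rep_apply_le l (-x) (F.rep l x Φ)
  rwa [F.rep_comp_apply hl, neg_mul_self, rep_zero] at h

theorem inner_rep_rep {l : Z} (hl : l ≠ 0) (x : V × Z) (Φ Ψ : L2 d) :
    ⟪F.rep l x Φ, F.rep l x Ψ⟫_ℂ = ⟪Φ, Ψ⟫_ℂ :=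
  LinearIsometry.inner_map_map ⟨(F.rep l x).toLinearMap, F.norm_rep_apply hl x⟩ Φ Ψ

theorem inner_rep_left {l : Z} (hl : l ≠ 0) (x : V × Z) (Φ Ψ : L2 d) :
    ⟪F.rep l x Φ, Ψ⟫_ℂ = ⟪Φ, F.rep l (-x) Ψ⟫_ℂ := by
  rw [← F.inner_rep_rep hl (-x), F.rep_comp_apply hl, neg_mul_self, rep_zero]
  rfl

/-- A coefficient is an integral over ξ of a jointly measurable function; no continuity of the
representation is required. -/
theorem stronglyMeasurable_inner_rep (l : Z) (Φ Ψ : L2 d) :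
    StronglyMeasurable fun x : V × Z => ⟪F.rep l x Ψ, Φ⟫_ℂ := by
  have h : ∀ x : V × Z, ⟪F.rep l x Ψ, Φ⟫_ℂ = ∫ ξ, ⟪Complex.exp (Complex.I * (F.phase l x ξ : ℂ)) *
      Ψ (ξ + √‖l‖ • F.pCoord l x), Φ ξ⟫_ℂ := fun x => by
    rw [L2.inner_def]
    refine integral_congr_ae ?_
    filter_upwards [F.coeFn_rep l x Ψ] with ξ hξ
    rw [hξ]
  simp only [h]
  have hp : Continuous fun x : V × Z => F.pCoord l x := by
    unfold pCoord
    fun_prop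
  have hq : Continuous fun x : V × Z => F.qCoord l x := by
    unfold qCoord
    fun_prop
  have hph : Continuous fun p : (V × Z) × EuclideanSpace ℝ (Fin d) =>
      Complex.exp (Complex.I * (F.phase l p.1 p.2 : ℂ)) := by
    unfold phase
    fun_prop
  have harg : Measurable fun p : (V × Z) × EuclideanSpace ℝ (Fin d) =>
      p.2 + √‖l‖ • F.pCoord l p.1 :=
    Continuous.measurable (by fun_prop)
  refine StronglyMeasurable.integral_prod_right'
    (f := fun p : (V × Z) × EuclideanSpace ℝ (Fin d) =>
      ⟪Complex.exp (Complex.I * (F.phase l p.1 p.2 : ℂ)) * Ψ (p.2 + √‖l‖ • F.pCoord l p.1),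
        Φ p.2⟫_ℂ) ?_
  exact (hph.stronglyMeasurable.mul
    ((Lp.stronglyMeasurable Ψ).comp_measurable harg)).inner
    ((Lp.stronglyMeasurable Φ).comp_measurable measurable_snd)

theorem norm_inner_rep_le (l : Z) (x : V × Z) (Φ Ψ : L2 d) :
    ‖⟪F.rep l x Ψ, Φ⟫_ℂ‖ ≤ ‖Ψ‖ * ‖Φ‖ :=
  (norm_inner_le_norm _ _).trans (by gcongr; exact F.norm_rep_apply_le l x Ψ)

theorem integrable_mul_inner_rep {f : V × Z → ℂ} (hf : Integrable f) (l : Z) (Φ Ψ : L2 d) :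
    Integrable fun x => f x * ⟪F.rep l x Ψ, Φ⟫_ℂ :=
  hf.mul_bdd (c := ‖Ψ‖ * ‖Φ‖) (F.stronglyMeasurable_inner_rep l Φ Ψ).aestronglyMeasurable
    (Eventually.of_forall fun x => F.norm_inner_rep_le l x Φ Ψ)

/-! ### The Fourier transform of integrable functions -/

theorem norm_integral_mul_inner_rep_le {f : V × Z → ℂ} (hf : Integrable f) (l : Z)
    (Φ Ψ : L2 d) : ‖∫ x, f x * ⟪F.rep l x Ψ, Φ⟫_ℂ‖ ≤ (∫ x, ‖f x‖) * ‖Ψ‖ * ‖Φ‖ := by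
  rw [mul_assoc, ← integral_mul_const]
  refine norm_integral_le_of_norm_le (hf.norm.mul_const _) (Eventually.of_forall fun x => ?_)
  rw [norm_mul]
  gcongr
  exact F.norm_inner_rep_le l x Φ Ψ

/-- The weak integral is a bounded sesquilinear form, with constant the L¹ norm of `f`. The operator
attached to the form acts on the conjugate-linear variable, whence the adjoint in the witness. -/
theorem exists_fourier {f : V × Z → ℂ} (hf : Integrable f) (l : Z) :
    ∃ A : BddOp d, ∀ Φ Ψ : L2 d, ⟪Ψ, A Φ⟫_ℂ = ∫ x, f x * ⟪F.rep l x Ψ, Φ⟫_ℂ := by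
  let B : L2 d →ₗ⋆[ℂ] L2 d →ₗ[ℂ] ℂ := LinearMap.mk₂'ₛₗ (starRingEnd ℂ) (RingHom.id ℂ)
    (fun Ψ Φ => ∫ x, f x * ⟪F.rep l x Ψ, Φ⟫_ℂ)
    (fun Ψ Ψ' Φ => by
      simp only [map_add, inner_add_left, mul_add]
      exact integral_add (F.integrable_mul_inner_rep hf l Φ Ψ)
        (F.integrable_mul_inner_rep hf l Φ Ψ'))
    (fun c Ψ Φ => by
      simp only [map_smul, inner_smul_left, smul_eq_mul]
      rw [← integral_const_mul]
      congr 1 with x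
      ring)
    (fun Ψ Φ Φ' => by
      simp only [inner_add_right, mul_add]
      exact integral_add (F.integrable_mul_inner_rep hf l Φ Ψ)
        (F.integrable_mul_inner_rep hf l Φ' Ψ))
    (fun c Ψ Φ => by
      simp only [inner_smul_right, smul_eq_mul, RingHom.id_apply]
      rw [← integral_const_mul]
      congr 1 with x
      ring)
  let B' : L2 d →L⋆[ℂ] L2 d →L[ℂ] ℂ := B.mkContinuous₂ (∫ x, ‖f x‖)
    (fun Ψ Φ => F.norm_integral_mul_inner_rep_le hf l Φ Ψ)
  refine ⟨ContinuousLinearMap.adjoint (InnerProductSpace.continuousLinearMapOfBilin B'),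
    fun Φ Ψ => ?_⟩
  rw [ContinuousLinearMap.adjoint_inner_right, InnerProductSpace.continuousLinearMapOfBilin_apply]
  rfl

theorem inner_fourier {f : V × Z → ℂ} (hf : Integrable f) (l : Z) (Φ Ψ : L2 d) :
    ⟪Ψ, F.fourier f l Φ⟫_ℂ = ∫ x, f x * ⟪F.rep l x Ψ, Φ⟫_ℂ := by
  have h : ∃ A : BddOp d, ∀ Φ Ψ : L2 d,
      ⟪Ψ, A Φ⟫_ℂ = ∫ x, f x * ⟪Ψ, ContinuousLinearMap.adjoint (F.rep l x) Φ⟫_ℂ := by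
    simpa only [ContinuousLinearMap.adjoint_inner_right] using F.exists_fourier hf l
  rw [fourier, dif_pos h, h.choose_spec]
  simp only [ContinuousLinearMap.adjoint_inner_right]

/-- Reduces identities between Fourier transforms to identities between matrix coefficients. -/
theorem eq_fourier {f : V × Z → ℂ} (hf : Integrable f) {l : Z} {A : BddOp d}
    (hA : ∀ Φ Ψ : L2 d, ⟪Ψ, A Φ⟫_ℂ = ∫ x, f x * ⟪F.rep l x Ψ, Φ⟫_ℂ) : A = F.fourier f l :=
  ContinuousLinearMap.ext fun Φ => ext_inner_left ℂ fun Ψ => by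
    rw [hA, F.inner_fourier hf]

theorem norm_fourier_le {f : V × Z → ℂ} (hf : Integrable f) (l : Z) :
    ‖F.fourier f l‖ ≤ ∫ x, ‖f x‖ := by
  refine ContinuousLinearMap.opNorm_le_of_re_inner_le (by positivity) fun Φ Ψ hΦ hΨ => ?_
  refine (RCLike.re_le_norm _).trans ?_
  rw [← inner_conj_symm, RCLike.norm_conj, F.inner_fourier hf]
  simpa [hΦ, hΨ] using F.norm_integral_mul_inner_rep_le hf l Φ Ψ

theorem fourier_add {f g : V × Z → ℂ} (hf : Integrable f) (hg : Integrable g) (l : Z) :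
    F.fourier (fun x => f x + g x) l = F.fourier f l + F.fourier g l := by
  refine (F.eq_fourier (hf.add hg) fun Φ Ψ => ?_).symm
  rw [add_apply, inner_add_right, F.inner_fourier hf, F.inner_fourier hg,
    ← integral_add (F.integrable_mul_inner_rep hf l Φ Ψ) (F.integrable_mul_inner_rep hg l Φ Ψ)]
  simp only [Pi.add_apply, add_mul]

theorem fourier_smul (c : ℝ) {f : V × Z → ℂ} (hf : Integrable f) (l : Z) :
    F.fourier (fun x => c • f x) l = c • F.fourier f l := by
  refine (F.eq_fourier (hf.smul c) fun Φ Ψ => ?_).symm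
  have h : (c • F.fourier f l) Φ = (c : ℂ) • F.fourier f l Φ := by
    rw [smul_apply]
    exact (Complex.coe_smul c _).symm
  rw [h, inner_smul_right, F.inner_fourier hf, ← integral_const_mul]
  congr 1 with x
  simp [mul_assoc]

/-- The Fourier transform at `l` as a continuous linear map on the Schwartz space. -/
def fourierCLM (l : Z) : 𝓢(V × Z, ℂ) →L[ℝ] BddOp d where
  toFun f := F.fourier f l
  map_add' f g := F.fourier_add f.integrable g.integrable l
  map_smul' c f := F.fourier_smul c f.integrable l
  cont := by
    rw [continuous_iff_continuousAt]
    intro f₀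
    rw [ContinuousAt, tendsto_iff_norm_sub_tendsto_zero]
    have hT : Continuous fun f : 𝓢(V × Z, ℂ) =>
        ‖SchwartzMap.toLpCLM ℝ ℂ 1 (volume : Measure (V × Z)) (f - f₀)‖ := by fun_prop
    have h0 := hT.tendsto f₀
    simp only [sub_self, map_zero, norm_zero] at h0
    refine squeeze_zero (fun _ => norm_nonneg _) (fun f => ?_) h0
    have hsub : F.fourier f l - F.fourier f₀ l = F.fourier (f - f₀ : 𝓢(V × Z, ℂ)) l := by
      rw [sub_eq_iff_eq_add, ← F.fourier_add (f - f₀).integrable f₀.integrable]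
      simp
    rw [hsub]
    refine (F.norm_fourier_le (f - f₀).integrable l).trans_eq ?_
    exact SchwartzMap.norm_toLp_one.symm

theorem fourierCLM_apply (l : Z) (f : 𝓢(V × Z, ℂ)) : F.fourierCLM l f = F.fourier f l := rfl

/-- Since (π_x^*)^* = π_{-x}^*, taking adjoints conjugates `f` and inverts its argument. -/
theorem adjoint_fourier {f : V × Z → ℂ} (hf : Integrable f) {l : Z} (hl : l ≠ 0) :
    ContinuousLinearMap.adjoint (F.fourier f l) =
      F.fourier (fun y => (starRingEnd ℂ) (f (-y))) l := by
  have hint : Integrable fun y => (starRingEnd ℂ) (f (-y)) :=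
    Complex.conjCLE.toContinuousLinearMap.integrable_comp hf.comp_neg
  refine F.eq_fourier hint fun Φ Ψ => ?_
  rw [ContinuousLinearMap.adjoint_inner_right, ← inner_conj_symm, F.inner_fourier hf,
    ← integral_conj, ← integral_neg_eq_self]
  congr 1 with x
  rw [map_mul, inner_conj_symm, ← F.inner_rep_left hl]

/-- π_x π_y^* = π_{y x⁻¹}^*, and right translations preserve the measure. -/
theorem rep_comp_fourier {f : V × Z → ℂ} (hf : Integrable f) {l : Z} (hl : l ≠ 0) (x : V × Z) :
    (F.rep l x).comp (F.fourier f l) = F.fourier (fun y => f (𝔤.mul y x)) l := by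
  have hmp := 𝔤.measurePreserving_mul_right x
  refine F.eq_fourier (hmp.integrable_comp_of_integrable hf) fun Φ Ψ => ?_
  have h := F.inner_rep_left hl (-x) Ψ (F.fourier f l Φ)
  rw [neg_neg] at h
  rw [ContinuousLinearMap.comp_apply, ← h, F.inner_fourier hf]
  simp only [F.rep_comp_apply hl]
  rw [← 𝔤.integral_mul_right' _ x]
  simp

/-- The adjoints in the definition of 𝓕 reverse products, π_w^* π_x^* = π_{xw}^*; hence the reversed
order in the convolution, where `f` is the factor taken at w. -/
theorem fourier_comp_fourier (f g : 𝓢(V × Z, ℂ)) {l : Z} (hl : l ≠ 0) :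
    (F.fourier f l).comp (F.fourier g l) = F.fourier (𝔤.conv g f) l := by
  refine F.eq_fourier (𝔤.conv g f).integrable fun Φ Ψ => ?_
  have h1 : ∀ w, ⟪F.rep l w Ψ, F.fourier g l Φ⟫_ℂ =
      ∫ x, g (𝔤.mul x (-w)) * ⟪F.rep l x Ψ, Φ⟫_ℂ := fun w => by
    rw [F.inner_fourier g.integrable, ← 𝔤.integral_mul_right' _ (-w)]
    simp only [F.rep_comp_apply hl, mul_cancel_neg_right]
  rw [ContinuousLinearMap.comp_apply, F.inner_fourier f.integrable]
  simp only [h1, conv_apply, ← integral_const_mul, ← integral_mul_const]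
  rw [integral_integral_swap]
  · congr 1 with x
    congr 1 with w
    ring
  · have hprod : Integrable (fun p : (V × Z) × (V × Z) => f p.1 * g (𝔤.mul p.2 (-p.1)))
        (volume.prod volume) := by
      have hmp : MeasurePreserving (fun p : (V × Z) × (V × Z) => (p.1, 𝔤.mul p.2 (-p.1)))
          (volume.prod volume) (volume.prod volume) :=
        (MeasurePreserving.id volume).skew_product
          (g := fun w x => 𝔤.mul x (-w)) (Continuous.measurable (by
            unfold Function.uncurry
            fun_prop))
          (Eventually.of_forall fun w => (𝔤.measurePreserving_mul_right (-w)).map_eq)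
      exact hmp.integrable_comp_of_integrable (f.integrable.mul_prod g.integrable)
    have hM : AEStronglyMeasurable (fun p : (V × Z) × (V × Z) => ⟪F.rep l p.2 Ψ, Φ⟫_ℂ)
        (volume.prod volume) :=
      ((F.stronglyMeasurable_inner_rep l Φ Ψ).comp_measurable measurable_snd).aestronglyMeasurable
    refine (hprod.mul_bdd (c := ‖Ψ‖ * ‖Φ‖) hM
      (Eventually.of_forall fun p => F.norm_inner_rep_le l p.2 Φ Ψ)).congr
      (Eventually.of_forall fun p => ?_)
    simp [Function.uncurry, mul_assoc]

/-! ### Dilations -/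

/-- The Jacobian of the inverse dilation. -/
def dilJac (V Z : Type*) [NormedAddCommGroup V] [InnerProductSpace ℝ V]
    [NormedAddCommGroup Z] [InnerProductSpace ℝ Z] (ε : ℝ) : ℝ :=
  |(LinearMap.det (dil (V := V) (Z := Z) ε).toLinearMap)⁻¹|

theorem det_dil_ne_zero {ε : ℝ} (hε : ε ≠ 0) :
    LinearMap.det (dil (V := V) (Z := Z) ε).toLinearMap ≠ 0 :=
  (LinearEquiv.isUnit_det' (dilEquiv (V := V) (Z := Z) ε hε).toLinearEquiv).ne_zero

theorem map_dil {ε : ℝ} (hε : ε ≠ 0) :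
    (volume : Measure (V × Z)).map (dil ε) = ENNReal.ofReal (dilJac V Z ε) • volume :=
  Measure.map_linearMap_addHaar_eq_smul_addHaar volume (det_dil_ne_zero hε)

theorem integral_dil {ε : ℝ} (hε : ε ≠ 0) (g : V × Z → ℂ) :
    ∫ w, g (dil ε w) = (dilJac V Z ε : ℂ) * ∫ w, g w := by
  have h := (dilEquiv (V := V) (Z := Z) ε hε).toHomeomorph.measurableEmbedding.integral_map
    (μ := (volume : Measure (V × Z))) g
  have h' : (volume : Measure (V × Z)).map (dilEquiv (V := V) (Z := Z) ε hε).toHomeomorph =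
      ENNReal.ofReal (dilJac V Z ε) • volume := map_dil hε
  rw [h', integral_smul_measure, ENNReal.toReal_ofReal (show 0 ≤ dilJac V Z ε from abs_nonneg _)] at h
  exact h.symm.trans (Complex.coe_smul _ _).symm

theorem dil_inv_dil {ε : ℝ} (hε : ε ≠ 0) (x : V × Z) : dil ε⁻¹ (dil ε x) = x :=
  (dilEquiv (V := V) (Z := Z) ε hε).symm_apply_apply x

/-- The frame is the same at λ and ε²λ, while √|ε²λ| = ε√|λ|; scaling λ thus amounts to dilating x.
-/
theorem rep_smul {l : Z} (hl : l ≠ 0) {ε : ℝ} (hε : 0 < ε) (x : V × Z) :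
    F.rep (ε ^ 2 • l) x = F.rep l (dil ε x) := by
  have hb := F.basis_smul l hl (ε ^ 2) (by positivity)
  have hp : F.pCoord (ε ^ 2 • l) x = F.pCoord l x := by simp [pCoord, hb]
  have hq : F.qCoord (ε ^ 2 • l) x = F.qCoord l x := by simp [qCoord, hb]
  have hp' : F.pCoord l (dil ε x) = ε • F.pCoord l x := by
    ext j; simp [pCoord, inner_smul_right]
  have hq' : F.qCoord l (dil ε x) = ε • F.qCoord l x := by
    ext j; simp [qCoord, inner_smul_right]
  have hn : ‖ε ^ 2 • l‖ = ε ^ 2 * ‖l‖ := by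
    rw [norm_smul, Real.norm_eq_abs, abs_of_pos (by positivity)]
  have hs : √‖ε ^ 2 • l‖ = ε * √‖l‖ := by
    rw [hn, Real.sqrt_mul (by positivity), Real.sqrt_sq hε.le]
  have h1 : F.phase (ε ^ 2 • l) x = F.phase l (dil ε x) := by
    funext ξ
    rw [phase, phase, hp, hq, hp', hq', hs, hn]
    simp only [inner_smul_left, inner_smul_right, dil_apply, conj_trivial]
    ring
  have h2 : √‖ε ^ 2 • l‖ • F.pCoord (ε ^ 2 • l) x = √‖l‖ • F.pCoord l (dil ε x) := by
    rw [hs, hp, hp', smul_smul, mul_comm]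
  simp only [rep, h1, h2]

/-- The Schwartz function `y ↦ |det δ_ε|⁻¹ f (δ_ε⁻¹ y)`. -/
def dilSchwartz (ε : ℝ) (hε : ε ≠ 0) (f : 𝓢(V × Z, ℂ)) : 𝓢(V × Z, ℂ) :=
  dilJac V Z ε •
    SchwartzMap.compCLMOfContinuousLinearEquiv ℝ (dilEquiv (V := V) (Z := Z) ε hε).symm f

theorem dilSchwartz_apply {ε : ℝ} (hε : ε ≠ 0) (f : 𝓢(V × Z, ℂ)) (x : V × Z) :
    dilSchwartz ε hε f x = (dilJac V Z ε : ℂ) * f (dil ε⁻¹ x) :=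
  (Complex.coe_smul _ _).symm

/-- The semiclassical parameter moves from the symbol to its kernel. -/
theorem fourier_smul_arg (f : 𝓢(V × Z, ℂ)) {l : Z} (hl : l ≠ 0) {ε : ℝ} (hε : 0 < ε) :
    F.fourier f (ε ^ 2 • l) = F.fourier (dilSchwartz ε hε.ne' f) l := by
  refine F.eq_fourier (dilSchwartz ε hε.ne' f).integrable fun Φ Ψ => ?_
  rw [F.inner_fourier f.integrable]
  simp only [dilSchwartz_apply, mul_assoc]
  rw [integral_const_mul, ← integral_dil hε.ne']
  simp only [F.rep_smul hl hε, dil_inv_dil hε.ne']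

end Frame

end HTypeAlgebra

/-! ### Hilbert-Schmidt operators on `L²(ℝ^d)` given by kernels -/

/-- Distinct orthonormal vectors are at distance √2, so the balls of radius 1/2 around them are
disjoint open sets in a separable space. -/
theorem Orthonormal.countable' {ι H : Type*} [NormedAddCommGroup H] [InnerProductSpace ℂ H]
    [TopologicalSpace.SeparableSpace H] {v : ι → H} (hv : Orthonormal ℂ v) : Countable ι := by
  refine Pairwise.countable_of_isOpen_disjoint (s := fun i => Metric.ball (v i) (1 / 2)) ?_
    (fun i => Metric.isOpen_ball) (fun i => ⟨v i, Metric.mem_ball_self (by norm_num)⟩)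
  intro i j hij
  refine Metric.ball_disjoint_ball ?_
  have h : ‖v i - v j‖ ^ 2 = 2 := by
    rw [@norm_sub_sq ℂ, hv.1 i, hv.1 j, hv.2 hij]
    norm_num
  rw [dist_eq_norm]
  nlinarith [norm_nonneg (v i - v j)]

theorem HilbertBasis.hasSum_norm_inner_sq {ι H : Type*} [NormedAddCommGroup H]
    [InnerProductSpace ℂ H] (b : HilbertBasis ι ℂ H) (x : H) :
    HasSum (fun i => ‖⟪x, b i⟫_ℂ‖ ^ 2) (‖x‖ ^ 2) := by
  have h := b.hasSum_inner_mul_inner x x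
  rw [inner_self_eq_norm_sq_to_K] at h
  have h' : (fun i => ⟪x, b i⟫_ℂ * ⟪b i, x⟫_ℂ) = fun i => ((‖⟪x, b i⟫_ℂ‖ ^ 2 : ℝ) : ℂ) := by
    funext i
    rw [← inner_conj_symm (b i) x, RCLike.mul_conj]
    norm_cast
  rw [h'] at h
  refine Complex.hasSum_ofReal.1 ?_
  rw [Complex.ofReal_pow]
  exact h

section HilbertSchmidt

variable {d : ℕ}

/-- For almost every ξ, summing over the basis is Parseval's identity for the rows kA(ξ), kB(ξ). The
sum and the integral are exchanged by dominated convergence, so no theory of trace-class operators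
is involved. -/
theorem opTrace_adjoint_comp_eq_integral_inner {A B : BddOp d}
    {kA kB : EuclideanSpace ℝ (Fin d) → L2 d}
    (hA : ∀ Φ, A Φ =ᵐ[volume] fun ξ => ⟪kA ξ, Φ⟫_ℂ)
    (hB : ∀ Φ, B Φ =ᵐ[volume] fun ξ => ⟪kB ξ, Φ⟫_ℂ)
    (iA : Integrable fun ξ => ‖kA ξ‖ ^ 2) (iB : Integrable fun ξ => ‖kB ξ‖ ^ 2) :
    opTrace ((ContinuousLinearMap.adjoint A).comp B) = ∫ ξ, ⟪kB ξ, kA ξ⟫_ℂ := by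
  rw [opTrace]
  generalize (exists_hilbertBasis ℂ (L2 d)).choose_spec.choose = b
  have h2top : Fact ((2 : ℝ≥0∞) ≠ ∞) := ⟨by simp⟩
  have hc : Countable (exists_hilbertBasis ℂ (L2 d)).choose := b.orthonormal.countable'
  have hterm : ∀ i, ⟪b i, ((ContinuousLinearMap.adjoint A).comp B) (b i)⟫_ℂ =
      ∫ ξ, ⟪A (b i) ξ, B (b i) ξ⟫_ℂ := fun i => by
    rw [ContinuousLinearMap.comp_apply, ContinuousLinearMap.adjoint_inner_right, L2.inner_def]
  simp only [hterm]
  -- Countability of the basis provides one null set for all its vectors.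
  have hae : ∀ᵐ ξ, ∀ i, A (b i) ξ = ⟪kA ξ, b i⟫_ℂ ∧ B (b i) ξ = ⟪kB ξ, b i⟫_ℂ :=
    ae_all_iff.2 fun i => (hA (b i)).and (hB (b i))
  have hsum : ∀ ξ, HasSum (fun i => ‖⟪kA ξ, b i⟫_ℂ‖ ^ 2 + ‖⟪kB ξ, b i⟫_ℂ‖ ^ 2)
      (‖kA ξ‖ ^ 2 + ‖kB ξ‖ ^ 2) := fun ξ =>
    (b.hasSum_norm_inner_sq _).add (b.hasSum_norm_inner_sq _)
  refine (hasSum_integral_of_dominated_convergence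
    (fun i ξ => ‖⟪kA ξ, b i⟫_ℂ‖ ^ 2 + ‖⟪kB ξ, b i⟫_ℂ‖ ^ 2) (fun i => ?_) (fun i => ?_)
    (Eventually.of_forall fun ξ => (hsum ξ).summable) ?_ ?_).tsum_eq
  · exact (Lp.aestronglyMeasurable _).inner (Lp.aestronglyMeasurable _)
  · filter_upwards [hae] with ξ hξ
    rw [(hξ i).1, (hξ i).2]
    refine (norm_inner_le_norm _ _).trans ?_
    nlinarith [sq_nonneg (‖⟪kA ξ, b i⟫_ℂ‖ - ‖⟪kB ξ, b i⟫_ℂ‖), sq_nonneg ‖⟪kA ξ, b i⟫_ℂ‖,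
      sq_nonneg ‖⟪kB ξ, b i⟫_ℂ‖]
  · simp only [(hsum _).tsum_eq]
    exact iA.add iB
  · filter_upwards [hae] with ξ hξ
    refine (b.hasSum_inner_mul_inner (kB ξ) (kA ξ)).congr_fun ?_
    intro i
    rw [(hξ i).1, (hξ i).2, RCLike.inner_apply, inner_conj_symm]

/-- `A` is the integral operator with kernel `a ∈ L²`. -/
structure IsIntegralOp (A : BddOp d)
    (a : EuclideanSpace ℝ (Fin d) × EuclideanSpace ℝ (Fin d) → ℂ) : Prop where
  meas : StronglyMeasurable a
  integrable_sq : Integrable (fun p => ‖a p‖ ^ 2) (volume.prod volume)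
  apply_ae : ∀ Φ, A Φ =ᵐ[volume] fun ξ => ∫ η, a (ξ, η) * Φ η

/-- The rows of an integral kernel as elements of `L²`. -/
def kernelRow (a : EuclideanSpace ℝ (Fin d) × EuclideanSpace ℝ (Fin d) → ℂ)
    (ξ : EuclideanSpace ℝ (Fin d)) : L2 d :=
  open Classical in
  if h : MemLp (fun η => (starRingEnd ℂ) (a (ξ, η))) 2 volume then h.toLp _ else 0

theorem ae_memLp_row {a : EuclideanSpace ℝ (Fin d) × EuclideanSpace ℝ (Fin d) → ℂ}
    (ha : StronglyMeasurable a) (hi : Integrable (fun p => ‖a p‖ ^ 2) (volume.prod volume)) :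
    ∀ᵐ ξ, MemLp (fun η => (starRingEnd ℂ) (a (ξ, η))) 2 volume := by
  filter_upwards [hi.prod_right_ae] with ξ hξ
  have hm : StronglyMeasurable fun η => a (ξ, η) := ha.comp_measurable measurable_prodMk_left
  refine (memLp_two_iff_integrable_sq_norm ?_).2 ?_
  · exact (Complex.continuous_conj.comp_stronglyMeasurable hm).aestronglyMeasurable
  · simpa using hξ

theorem inner_kernelRow_left {a : EuclideanSpace ℝ (Fin d) × EuclideanSpace ℝ (Fin d) → ℂ}
    {ξ : EuclideanSpace ℝ (Fin d)}
    (h : MemLp (fun η => (starRingEnd ℂ) (a (ξ, η))) 2 volume) (Φ : L2 d) :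
    ⟪kernelRow a ξ, Φ⟫_ℂ = ∫ η, a (ξ, η) * Φ η := by
  rw [kernelRow, dif_pos h, L2.inner_def]
  refine integral_congr_ae ?_
  filter_upwards [h.coeFn_toLp] with η hη
  rw [hη, RCLike.inner_apply, RCLike.conj_conj, mul_comm]

theorem norm_kernelRow_sq {a : EuclideanSpace ℝ (Fin d) × EuclideanSpace ℝ (Fin d) → ℂ}
    {ξ : EuclideanSpace ℝ (Fin d)}
    (h : MemLp (fun η => (starRingEnd ℂ) (a (ξ, η))) 2 volume) :
    ‖kernelRow a ξ‖ ^ 2 = ∫ η, ‖a (ξ, η)‖ ^ 2 := by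
  have h1 := inner_kernelRow_left h (kernelRow a ξ)
  rw [inner_self_eq_norm_sq_to_K] at h1
  have h2 : ∫ η, a (ξ, η) * kernelRow a ξ η = ((∫ η, ‖a (ξ, η)‖ ^ 2 : ℝ) : ℂ) := by
    rw [← integral_complex_ofReal]
    refine integral_congr_ae ?_
    rw [kernelRow, dif_pos h]
    filter_upwards [h.coeFn_toLp] with η hη
    rw [hη, RCLike.mul_conj]
    norm_cast
  rw [h2] at h1
  refine Complex.ofReal_injective ?_
  rw [Complex.ofReal_pow]
  exact h1

theorem integrable_norm_kernelRow_sq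
    {a : EuclideanSpace ℝ (Fin d) × EuclideanSpace ℝ (Fin d) → ℂ}
    (ha : StronglyMeasurable a) (hi : Integrable (fun p => ‖a p‖ ^ 2) (volume.prod volume)) :
    Integrable fun ξ => ‖kernelRow a ξ‖ ^ 2 := by
  refine hi.integral_prod_left.congr ?_
  filter_upwards [ae_memLp_row ha hi] with ξ hξ
  rw [norm_kernelRow_sq hξ]

/-- The Hilbert–Schmidt inner product of operators is the L² inner product of their kernels, by the
formula for rows and Fubini. -/
theorem IsIntegralOp.opTrace_adjoint_comp {A B : BddOp d}
    {a b : EuclideanSpace ℝ (Fin d) × EuclideanSpace ℝ (Fin d) → ℂ}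
    (hA : IsIntegralOp A a) (hB : IsIntegralOp B b) :
    opTrace ((ContinuousLinearMap.adjoint A).comp B) =
      ∫ p, (starRingEnd ℂ) (a p) * b p ∂(volume.prod volume) := by
  have key : ∀ {A : BddOp d} {a}, IsIntegralOp A a →
      ∀ Φ, A Φ =ᵐ[volume] fun ξ => ⟪kernelRow a ξ, Φ⟫_ℂ := by
    intro A a hA Φ
    filter_upwards [hA.apply_ae Φ, ae_memLp_row hA.meas hA.integrable_sq] with ξ h1 h2
    rw [h1, inner_kernelRow_left h2]
  rw [opTrace_adjoint_comp_eq_integral_inner (key hA) (key hB)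
    (integrable_norm_kernelRow_sq hA.meas hA.integrable_sq)
    (integrable_norm_kernelRow_sq hB.meas hB.integrable_sq), integral_prod]
  · refine integral_congr_ae ?_
    filter_upwards [ae_memLp_row hA.meas hA.integrable_sq,
      ae_memLp_row hB.meas hB.integrable_sq] with ξ h1 h2
    rw [inner_kernelRow_left h2]
    refine integral_congr_ae ?_
    rw [kernelRow, dif_pos h1]
    filter_upwards [h1.coeFn_toLp] with η hη
    rw [hη, mul_comm]
  · refine (hA.integrable_sq.add hB.integrable_sq).mono'
      ((Complex.continuous_conj.comp_stronglyMeasurable hA.meas).mul hB.meas).aestronglyMeasurable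
      (Eventually.of_forall fun p => ?_)
    rw [norm_mul, RCLike.norm_conj]
    simp only [Pi.add_apply]
    nlinarith [sq_nonneg (‖a p‖ - ‖b p‖), sq_nonneg ‖a p‖, sq_nonneg ‖b p‖]

/-- An operator is determined by its weak integral kernel. -/
theorem IsIntegralOp.of_inner {A : BddOp d}
    {a : EuclideanSpace ℝ (Fin d) × EuclideanSpace ℝ (Fin d) → ℂ}
    (ha : StronglyMeasurable a) (hi : Integrable (fun p => ‖a p‖ ^ 2) (volume.prod volume))
    (h : ∀ Φ Ψ : L2 d, ⟪Ψ, A Φ⟫_ℂ = ∫ ξ, (∫ η, a (ξ, η) * Φ η) * (starRingEnd ℂ) (Ψ ξ)) :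
    IsIntegralOp A a := by
  refine ⟨ha, hi, fun Φ => ?_⟩
  have hm : StronglyMeasurable fun ξ => ∫ η, a (ξ, η) * Φ η :=
    StronglyMeasurable.integral_prod_right' (f := fun p : EuclideanSpace ℝ (Fin d) ×
      EuclideanSpace ℝ (Fin d) => a p * Φ p.2)
      (ha.mul ((Lp.stronglyMeasurable Φ).comp_measurable measurable_snd))
  have hL : MemLp (fun ξ => ∫ η, a (ξ, η) * Φ η) 2 volume := by
    refine (memLp_two_iff_integrable_sq_norm hm.aestronglyMeasurable).2 ?_
    refine ((integrable_norm_kernelRow_sq ha hi).mul_const (‖Φ‖ ^ 2)).mono'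
      (hm.norm.pow 2).aestronglyMeasurable ?_
    filter_upwards [ae_memLp_row ha hi] with ξ hξ
    rw [← inner_kernelRow_left hξ, Real.norm_eq_abs, abs_of_nonneg (by positivity), ← mul_pow]
    gcongr
    exact norm_inner_le_norm _ _
  have heq : A Φ = hL.toLp _ := ext_inner_left ℂ fun Ψ => by
    rw [h, L2.inner_def]
    refine integral_congr_ae ?_
    filter_upwards [hL.coeFn_toLp] with ξ hξ
    rw [hξ, RCLike.inner_apply]
  rw [heq]
  exact hL.coeFn_toLp

end HilbertSchmidt

/-- Almost everywhere measurability of the integrand takes the place of the map being an embedding.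
-/
theorem MeasureTheory.MeasurePreserving.integral_comp_of_aestronglyMeasurable {α β G : Type*}
    [MeasurableSpace α] [MeasurableSpace β] [NormedAddCommGroup G] [NormedSpace ℝ G]
    {μ : Measure α} {ν : Measure β} {f : α → β} (hf : MeasurePreserving f μ ν) {g : β → G}
    (hg : AEStronglyMeasurable g ν) : ∫ x, g (f x) ∂μ = ∫ y, g y ∂ν := by
  conv_rhs => rw [← hf.map_eq]
  rw [integral_map hf.aemeasurable (by rwa [hf.map_eq])]

theorem integrable_conj_mul_of_sq {α : Type*} [MeasurableSpace α] {μ : Measure α} {f g : α → ℂ}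
    (hf : AEStronglyMeasurable f μ) (hg : AEStronglyMeasurable g μ)
    (hf2 : Integrable (fun x => ‖f x‖ ^ 2) μ) (hg2 : Integrable (fun x => ‖g x‖ ^ 2) μ) :
    Integrable (fun x => (starRingEnd ℂ) (f x) * g x) μ := by
  refine (hf2.add hg2).mono'
    ((Complex.continuous_conj.comp_aestronglyMeasurable hf).mul hg)
    (Eventually.of_forall fun p => ?_)
  rw [norm_mul, RCLike.norm_conj]
  simp only [Pi.add_apply]
  nlinarith [sq_nonneg (‖f p‖ - ‖g p‖), sq_nonneg ‖f p‖, sq_nonneg ‖g p‖]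

namespace HTypeAlgebra

/-! ### The Parseval formula for the partial Fourier transform -/

section Parseval

variable {V Z : Type*} [NormedAddCommGroup V] [InnerProductSpace ℝ V] [FiniteDimensional ℝ V]
  [MeasurableSpace V] [BorelSpace V]
  [NormedAddCommGroup Z] [InnerProductSpace ℝ Z] [FiniteDimensional ℝ Z]
  [MeasurableSpace Z] [BorelSpace Z]

/-- The restriction `z ↦ f (v, z)` of a Schwartz function. -/
def sliceSchwartz (f : 𝓢(V × Z, ℂ)) (v : V) : 𝓢(Z, ℂ) :=
  SchwartzMap.compCLMOfAntilipschitz ℝ (K := 1) (g := fun z : Z => (v, z))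
    (by
      have h : (fun z : Z => (v, z)) = fun z => ContinuousLinearMap.inr ℝ V Z z + (v, 0) := by
        ext z <;> simp
      rw [h]
      fun_prop)
    (fun z z' => by simp [Prod.edist_eq]) f

theorem sliceSchwartz_apply (f : 𝓢(V × Z, ℂ)) (v : V) (z : Z) :
    sliceSchwartz f v z = f (v, z) := rfl

/-- The characters e^{-i⟨l,z⟩} and those of `𝓕` differ by the scaling l ↦ l/(2π), the source of the
powers of 2π in Parseval's formula. -/
theorem partialFourier_eq_fourier (f : 𝓢(V × Z, ℂ)) (l : Z) (v : V) :
    partialFourier f l v = 𝓕 (sliceSchwartz f v) ((2 * Real.pi)⁻¹ • l) := by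
  rw [partialFourier_apply, SchwartzMap.fourier_coe, Real.fourier_eq']
  congr 1 with z
  rw [smul_eq_mul, sliceSchwartz_apply, real_inner_smul_right, real_inner_comm]
  have h : -2 * Real.pi * ((2 * Real.pi)⁻¹ * ⟪z, l⟫_ℝ) = -⟪z, l⟫_ℝ := by
    field_simp
  rw [h]
  push_cast
  rfl

theorem stronglyMeasurable_partialFourier (f : 𝓢(V × Z, ℂ)) :
    StronglyMeasurable fun p : V × Z => partialFourier f p.2 p.1 := by
  simp only [partialFourier_apply]
  refine StronglyMeasurable.integral_prod_right' (f := fun q : (V × Z) × Z =>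
    Complex.exp (-(⟪q.1.2, q.2⟫_ℝ : ℂ) * Complex.I) * f (q.1.1, q.2)) ?_
  exact Continuous.stronglyMeasurable (by fun_prop)

theorem integral_comp_two_pi_inv_smul (g : Z → ℂ) :
    ∫ l, g ((2 * Real.pi)⁻¹ • l) = ((2 * Real.pi) ^ Module.finrank ℝ Z : ℝ) * ∫ l, g l := by
  rw [Measure.integral_comp_inv_smul_of_nonneg volume g (by positivity)]
  exact (Complex.coe_smul _ _).symm

theorem integral_conj_partialFourier_mul (f g : 𝓢(V × Z, ℂ)) (v : V) :
    ∫ l, (starRingEnd ℂ) (partialFourier f l v) * partialFourier g l v =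
      ((2 * Real.pi) ^ Module.finrank ℝ Z : ℝ) * ∫ z, (starRingEnd ℂ) (f (v, z)) * g (v, z) := by
  simp only [partialFourier_eq_fourier]
  rw [integral_comp_two_pi_inv_smul (fun l => (starRingEnd ℂ) (𝓕 (sliceSchwartz f v) l) *
    𝓕 (sliceSchwartz g v) l)]
  have h := SchwartzMap.integral_inner_fourier_fourier (sliceSchwartz f v) (sliceSchwartz g v)
  simp only [RCLike.inner_apply', sliceSchwartz_apply] at h
  rw [h]

theorem SchwartzMap.integrable_norm_sq (f : 𝓢(Z, ℂ)) : Integrable fun z => ‖f z‖ ^ 2 :=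
  (memLp_two_iff_integrable_sq_norm f.continuous.aestronglyMeasurable).1 (f.memLp 2)

theorem integrable_norm_sq_schwartz_prod (f : 𝓢(V × Z, ℂ)) :
    Integrable (fun p => ‖f p‖ ^ 2) ((volume : Measure V).prod (volume : Measure Z)) :=
  (memLp_two_iff_integrable_sq_norm f.continuous.aestronglyMeasurable).1 (f.memLp 2 volume)

theorem integrable_norm_partialFourier_sq (f : 𝓢(V × Z, ℂ)) :
    Integrable (fun p : V × Z => ‖partialFourier f p.2 p.1‖ ^ 2)
      ((volume : Measure V).prod (volume : Measure Z)) := by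
  refine (integrable_prod_iff
    ((stronglyMeasurable_partialFourier f).norm.pow 2).aestronglyMeasurable).2 ⟨?_, ?_⟩
  · refine Eventually.of_forall fun v => ?_
    simp only [partialFourier_eq_fourier]
    exact (SchwartzMap.integrable_norm_sq (𝓕 (sliceSchwartz f v))).comp_smul
      (inv_ne_zero (by positivity : 2 * Real.pi ≠ 0))
  · refine ((integrable_norm_sq_schwartz_prod f).integral_prod_left.const_mul
      ((2 * Real.pi) ^ Module.finrank ℝ Z)).congr (Eventually.of_forall fun v => ?_)
    -- The real identity is the complex Plancherel formula with both functions equal to `f`.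
    refine Complex.ofReal_injective ?_
    have h := integral_conj_partialFourier_mul f f v
    simp only [RCLike.conj_mul] at h
    simp only [Pi.pow_apply, norm_pow, norm_norm]
    rw [Complex.ofReal_mul, ← integral_complex_ofReal, ← integral_complex_ofReal]
    push_cast at h ⊢
    exact h.symm

theorem integrable_conj_partialFourier_mul (f g : 𝓢(V × Z, ℂ)) :
    Integrable (fun p : V × Z => (starRingEnd ℂ) (partialFourier f p.2 p.1) *
      partialFourier g p.2 p.1) ((volume : Measure V).prod (volume : Measure Z)) :=
  integrable_conj_mul_of_sq (stronglyMeasurable_partialFourier f).aestronglyMeasurable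
    (stronglyMeasurable_partialFourier g).aestronglyMeasurable
    (integrable_norm_partialFourier_sq f) (integrable_norm_partialFourier_sq g)

theorem parseval_partialFourier (f g : 𝓢(V × Z, ℂ)) :
    ∫ p : V × Z, (starRingEnd ℂ) (partialFourier f p.2 p.1) * partialFourier g p.2 p.1
        ∂((volume : Measure V).prod (volume : Measure Z)) =
      ((2 * Real.pi) ^ Module.finrank ℝ Z : ℝ) * ∫ p : V × Z, (starRingEnd ℂ) (f p) * g p := by
  have hfg : Integrable (fun p => (starRingEnd ℂ) (f p) * g p)
      ((volume : Measure V).prod (volume : Measure Z)) :=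
    integrable_conj_mul_of_sq f.continuous.aestronglyMeasurable
      g.continuous.aestronglyMeasurable (integrable_norm_sq_schwartz_prod f)
      (integrable_norm_sq_schwartz_prod g)
  rw [integral_prod _ (integrable_conj_partialFourier_mul f g), Measure.volume_eq_prod,
    integral_prod _ hfg, ← integral_const_mul]
  exact integral_congr_ae (Eventually.of_forall fun v => integral_conj_partialFourier_mul f g v)

end Parseval

/-! ### Coordinates attached to `l` -/

variable {V Z : Type*} [NormedAddCommGroup V] [InnerProductSpace ℝ V] [FiniteDimensional ℝ V]
  [MeasurableSpace V] [BorelSpace V]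
  [NormedAddCommGroup Z] [InnerProductSpace ℝ Z] [FiniteDimensional ℝ Z]
  [MeasurableSpace Z] [BorelSpace Z]

namespace Frame

variable {𝔤 : HTypeAlgebra V Z} {d : ℕ} (F : 𝔤.Frame d)

/-- The isometry between `ℝ^d × ℝ^d` and `𝔳` given by the basis attached to `l`. -/
def coordIso (l : Z) :
    WithLp 2 (EuclideanSpace ℝ (Fin d) × EuclideanSpace ℝ (Fin d)) ≃ₗᵢ[ℝ] V :=
  (((EuclideanSpace.basisFun (Fin d) ℝ).prod (EuclideanSpace.basisFun (Fin d) ℝ)).equiv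
    (F.basis l) (Equiv.refl _))

/-- The linear isomorphism `(p, q) ↦ ∑ p_j P_j + ∑ q_j Q_j`. -/
def coordEquiv (l : Z) : (EuclideanSpace ℝ (Fin d) × EuclideanSpace ℝ (Fin d)) ≃L[ℝ] V :=
  (WithLp.prodContinuousLinearEquiv 2 ℝ _ _).symm.trans
    (F.coordIso l).toContinuousLinearEquiv

theorem measurePreserving_coordEquiv (l : Z) :
    MeasurePreserving (F.coordEquiv l) (volume.prod volume) volume :=
  (F.coordIso l).measurePreserving.comp (WithLp.volume_preserving_toLp _ _)

theorem pCoord_coordEquiv (l : Z) (w : EuclideanSpace ℝ (Fin d) × EuclideanSpace ℝ (Fin d))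
    (z : Z) : F.pCoord l (F.coordEquiv l w, z) = w.1 := by
  ext j
  have h := (F.coordIso l).inner_map_map
    (((EuclideanSpace.basisFun (Fin d) ℝ).prod (EuclideanSpace.basisFun (Fin d) ℝ)) (Sum.inl j))
    (WithLp.toLp 2 w)
  rw [coordIso, OrthonormalBasis.equiv_apply_basis] at h
  refine h.trans ?_
  simp [EuclideanSpace.inner_single_left]

theorem qCoord_coordEquiv (l : Z) (w : EuclideanSpace ℝ (Fin d) × EuclideanSpace ℝ (Fin d))
    (z : Z) : F.qCoord l (F.coordEquiv l w, z) = w.2 := by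
  ext j
  have h := (F.coordIso l).inner_map_map
    (((EuclideanSpace.basisFun (Fin d) ℝ).prod (EuclideanSpace.basisFun (Fin d) ℝ)) (Sum.inr j))
    (WithLp.toLp 2 w)
  rw [coordIso, OrthonormalBasis.equiv_apply_basis] at h
  refine h.trans ?_
  simp [EuclideanSpace.inner_single_left]

end Frame

end HTypeAlgebra

theorem integrable_norm_sq_L2 {d : ℕ} (Φ : L2 d) : Integrable fun ξ => ‖Φ ξ‖ ^ 2 :=
  (memLp_two_iff_integrable_sq_norm (Lp.aestronglyMeasurable Φ)).1 (Lp.memLp Φ)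

theorem integral_norm_sq_L2 {d : ℕ} (Φ : L2 d) : ∫ ξ, ‖Φ ξ‖ ^ 2 = ‖Φ‖ ^ 2 := by
  have h : ⟪Φ, Φ⟫_ℂ = ∫ ξ, ⟪Φ ξ, Φ ξ⟫_ℂ := L2.inner_def Φ Φ
  simp only [inner_self_eq_norm_sq_to_K] at h
  refine Complex.ofReal_injective ?_
  rw [← integral_complex_ofReal, Complex.ofReal_pow]
  push_cast
  exact h.symm

/-! ### Weyl coordinates for operator kernels -/

section KernelCoordinates

variable {d : ℕ}

/-- The unimodular change of variables `(ξ, η) ↦ ((ξ - η) / s, s (ξ + η) / 2)`. -/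
def weylCoord (s : ℝ) (p : EuclideanSpace ℝ (Fin d) × EuclideanSpace ℝ (Fin d)) :
    EuclideanSpace ℝ (Fin d) × EuclideanSpace ℝ (Fin d) :=
  (s⁻¹ • (p.1 - p.2), s • (p.1 - (2⁻¹ : ℝ) • (p.1 - p.2)))

/-- A composition of two maps that are isometries in each fibre, a swap, and a scaling by s⁻¹ and s
whose Jacobians cancel. -/
theorem measurePreserving_weylCoord {s : ℝ} (hs : 0 < s) :
    MeasurePreserving (weylCoord (d := d) s) (volume.prod volume) (volume.prod volume) := by
  have h1 : MeasurePreserving (fun p : EuclideanSpace ℝ (Fin d) × EuclideanSpace ℝ (Fin d) =>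
      (p.1, p.1 - p.2)) (volume.prod volume) (volume.prod volume) :=
    (MeasurePreserving.id volume).skew_product (g := fun ξ η => ξ - η)
      (Continuous.measurable (by unfold Function.uncurry; fun_prop))
      (Eventually.of_forall fun ξ => (Measure.measurePreserving_sub_left volume ξ).map_eq)
  have h2 : MeasurePreserving (fun p : EuclideanSpace ℝ (Fin d) × EuclideanSpace ℝ (Fin d) =>
      (p.1, p.2 - (2⁻¹ : ℝ) • p.1)) (volume.prod volume) (volume.prod volume) :=
    (MeasurePreserving.id volume).skew_product (g := fun u ξ => ξ - (2⁻¹ : ℝ) • u)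
      (Continuous.measurable (by unfold Function.uncurry; fun_prop))
      (Eventually.of_forall fun u => (measurePreserving_sub_right volume _).map_eq)
  have h3 : MeasurePreserving (Prod.map (fun u : EuclideanSpace ℝ (Fin d) => s⁻¹ • u)
      (fun m : EuclideanSpace ℝ (Fin d) => s • m)) (volume.prod volume)
      (volume.prod volume) := by
    refine ⟨Continuous.measurable (by fun_prop), ?_⟩
    rw [← Measure.map_prod_map _ _ (by fun_prop) (by fun_prop),
      Measure.map_addHaar_smul _ hs.ne', Measure.map_addHaar_smul _ (inv_ne_zero hs.ne'),
      Measure.prod_smul_left, Measure.prod_smul_right, smul_smul,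
      ← ENNReal.ofReal_mul (abs_nonneg _), ← abs_mul]
    simp [hs.ne']
  exact h3.comp (h2.comp (Measure.measurePreserving_swap.comp h1))

end KernelCoordinates

/-! ### Fourier transforms as Hilbert–Schmidt operators -/

namespace HTypeAlgebra

variable {V Z : Type*} [NormedAddCommGroup V] [InnerProductSpace ℝ V] [FiniteDimensional ℝ V]
  [MeasurableSpace V] [BorelSpace V]
  [NormedAddCommGroup Z] [InnerProductSpace ℝ Z] [FiniteDimensional ℝ Z]
  [MeasurableSpace Z] [BorelSpace Z]

namespace Frame

variable {𝔤 : HTypeAlgebra V Z} {d : ℕ} (F : 𝔤.Frame d)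

/-- The partial Fourier transform at `l`, in the coordinates attached to `l`. -/
def coordFourier (g : 𝓢(V × Z, ℂ)) (l : Z) :
    𝓢(EuclideanSpace ℝ (Fin d) × EuclideanSpace ℝ (Fin d), ℂ) :=
  SchwartzMap.compCLMOfContinuousLinearEquiv ℝ (F.coordEquiv l) (partialFourier g l)

/-- The integral kernel of the Fourier transform. -/
def fourierKernel (g : 𝓢(V × Z, ℂ)) (l : Z)
    (p : EuclideanSpace ℝ (Fin d) × EuclideanSpace ℝ (Fin d)) : ℂ :=
  ((√‖l‖ ^ d)⁻¹ : ℝ) * partialFourier (F.coordFourier g l) (weylCoord √‖l‖ p).2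
    (weylCoord √‖l‖ p).1

theorem stronglyMeasurable_fourierKernel (g : 𝓢(V × Z, ℂ)) {l : Z} (hl : l ≠ 0) :
    StronglyMeasurable (F.fourierKernel g l) :=
  ((stronglyMeasurable_partialFourier (F.coordFourier g l)).comp_measurable
    (measurePreserving_weylCoord (Real.sqrt_pos.2 (norm_pos_iff.2 hl))).measurable).const_mul _

theorem integrable_fourierKernel_sq (g : 𝓢(V × Z, ℂ)) {l : Z} (hl : l ≠ 0) :
    Integrable (fun p => ‖F.fourierKernel g l p‖ ^ 2) (volume.prod volume) := by
  have h := (measurePreserving_weylCoord (Real.sqrt_pos.2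
    (norm_pos_iff.2 hl))).integrable_comp_of_integrable
    (integrable_norm_partialFourier_sq (F.coordFourier g l))
  refine (h.const_mul (((√‖l‖ ^ d)⁻¹) ^ 2)).congr (Eventually.of_forall fun p => ?_)
  simp [fourierKernel, mul_pow, abs_of_nonneg (Real.sqrt_nonneg _)]

/-- The centre acts by a character, which turns the integral over 𝔷 into a partial Fourier
transform. -/
theorem rep_central (l : Z) (v : V) (z : Z) (Φ : L2 d) :
    F.rep l (v, z) Φ = Complex.exp (⟪l, z⟫_ℝ * Complex.I) • F.rep l (v, 0) Φ := by
  refine Lp.ext ?_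
  filter_upwards [F.coeFn_rep l (v, z) Φ, F.coeFn_rep l (v, 0) Φ,
    Lp.coeFn_smul (Complex.exp (⟪l, z⟫_ℝ * Complex.I)) (F.rep l (v, 0) Φ)] with ξ h1 h2 h3
  rw [h1, h3, Pi.smul_apply, h2, smul_eq_mul, ← mul_assoc, ← Complex.exp_add]
  have hp : F.pCoord l (v, z) = F.pCoord l (v, 0) := rfl
  have hph : F.phase l (v, z) ξ = ⟪l, z⟫_ℝ + F.phase l (v, 0) ξ := by
    have hq : F.qCoord l (v, z) = F.qCoord l (v, 0) := rfl
    simp only [phase, hp, hq, inner_zero_right]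
    ring
  rw [hp, hph]
  push_cast
  ring_nf

theorem inner_fourier_eq_integral_partialFourier (g : 𝓢(V × Z, ℂ)) (l : Z) (Φ Ψ : L2 d) :
    ⟪Ψ, F.fourier g l Φ⟫_ℂ = ∫ v, partialFourier g l v * ⟪F.rep l (v, 0) Ψ, Φ⟫_ℂ := by
  rw [F.inner_fourier g.integrable, Measure.volume_eq_prod, integral_prod _
    (F.integrable_mul_inner_rep g.integrable l Φ Ψ)]
  congr 1 with v
  rw [partialFourier_apply, ← integral_mul_const]
  congr 1 with z
  rw [F.rep_central, inner_smul_left, ← Complex.exp_conj, map_mul, Complex.conj_I,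
    Complex.conj_ofReal]
  ring_nf

theorem inner_fourier_eq_integral_coord (g : 𝓢(V × Z, ℂ)) (l : Z) (Φ Ψ : L2 d) :
    ⟪Ψ, F.fourier g l Φ⟫_ℂ = ∫ w, F.coordFourier g l w *
      ⟪F.rep l (F.coordEquiv l w, 0) Ψ, Φ⟫_ℂ ∂(volume.prod volume) := by
  rw [inner_fourier_eq_integral_partialFourier]
  refine ((F.measurePreserving_coordEquiv l).integral_comp
    (F.coordEquiv l).toHomeomorph.measurableEmbedding
    (fun v => partialFourier g l v * ⟪F.rep l (v, 0) Ψ, Φ⟫_ℂ)).symm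

/-- The integrand of the matrix coefficients in Schrödinger coordinates. -/
def weylIntegrand (g : 𝓢(V × Z, ℂ)) (l : Z) (Φ Ψ : L2 d)
    (w : EuclideanSpace ℝ (Fin d) × EuclideanSpace ℝ (Fin d)) (ξ : EuclideanSpace ℝ (Fin d)) : ℂ :=
  F.coordFourier g l w * (Complex.exp (-(⟪√‖l‖ • (ξ - (2⁻¹ * √‖l‖) • w.1), w.2⟫_ℝ : ℂ) *
    Complex.I) * Φ (ξ - √‖l‖ • w.1) * (starRingEnd ℂ) (Ψ ξ))

theorem coeFn_rep_neg_coord (l : Z)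
    (w : EuclideanSpace ℝ (Fin d) × EuclideanSpace ℝ (Fin d)) (Φ : L2 d) :
    F.rep l (-(F.coordEquiv l w, 0)) Φ =ᵐ[volume] fun ξ =>
      Complex.exp (-(⟪√‖l‖ • (ξ - (2⁻¹ * √‖l‖) • w.1), w.2⟫_ℝ : ℂ) * Complex.I) *
        Φ (ξ - √‖l‖ • w.1) := by
  have hp : F.pCoord l (-(F.coordEquiv l w, 0)) = -w.1 := by
    rw [← F.pCoord_coordEquiv l w 0]; ext j; simp [pCoord]
  have hq : F.qCoord l (-(F.coordEquiv l w, 0)) = -w.2 := by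
    rw [← F.qCoord_coordEquiv l w 0]; ext j; simp [qCoord]
  filter_upwards [F.coeFn_rep l (-(F.coordEquiv l w, 0)) Φ] with ξ h
  have h2 : √‖l‖ * √‖l‖ = ‖l‖ := Real.mul_self_sqrt (norm_nonneg l)
  have hph : F.phase l (-(F.coordEquiv l w, 0)) ξ =
      -⟪√‖l‖ • (ξ - (2⁻¹ * √‖l‖) • w.1), w.2⟫_ℝ := by
    simp only [phase, hp, hq, inner_neg_left, inner_neg_right, inner_smul_left, inner_sub_left,
      conj_trivial, Prod.snd_neg, neg_zero, inner_zero_right]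
    linear_combination -(2⁻¹ * ⟪w.1, w.2⟫_ℝ) * h2
  rw [h, hp, hph, smul_neg, ← sub_eq_add_neg]
  push_cast
  ring_nf

theorem inner_rep_coord {l : Z} (hl : l ≠ 0)
    (w : EuclideanSpace ℝ (Fin d) × EuclideanSpace ℝ (Fin d)) (Φ Ψ : L2 d) :
    ⟪F.rep l (F.coordEquiv l w, 0) Ψ, Φ⟫_ℂ =
      ∫ ξ, Complex.exp (-(⟪√‖l‖ • (ξ - (2⁻¹ * √‖l‖) • w.1), w.2⟫_ℝ : ℂ) *
        Complex.I) * Φ (ξ - √‖l‖ • w.1) * (starRingEnd ℂ) (Ψ ξ) := by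
  rw [F.inner_rep_left hl, L2.inner_def]
  refine integral_congr_ae ?_
  filter_upwards [F.coeFn_rep_neg_coord l w Φ] with ξ h
  rw [h, RCLike.inner_apply]

theorem stronglyMeasurable_weylIntegrand (g : 𝓢(V × Z, ℂ)) (l : Z) (Φ Ψ : L2 d) :
    StronglyMeasurable (Function.uncurry (F.weylIntegrand g l Φ Ψ)) := by
  unfold weylIntegrand Function.uncurry
  have h1 : Continuous fun p : (EuclideanSpace ℝ (Fin d) × EuclideanSpace ℝ (Fin d)) ×
      EuclideanSpace ℝ (Fin d) => F.coordFourier g l p.1 := by fun_prop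
  have h2 : Continuous fun p : (EuclideanSpace ℝ (Fin d) × EuclideanSpace ℝ (Fin d)) ×
      EuclideanSpace ℝ (Fin d) => Complex.exp
        (-(⟪√‖l‖ • (p.2 - (2⁻¹ * √‖l‖) • p.1.1), p.1.2⟫_ℝ : ℂ) * Complex.I) := by fun_prop
  have h3 : Measurable fun p : (EuclideanSpace ℝ (Fin d) × EuclideanSpace ℝ (Fin d)) ×
      EuclideanSpace ℝ (Fin d) => p.2 - √‖l‖ • p.1.1 := Continuous.measurable (by fun_prop)
  exact h1.stronglyMeasurable.mul ((h2.stronglyMeasurable.mul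
    ((Lp.stronglyMeasurable Φ).comp_measurable h3)).mul
    (Complex.continuous_conj.comp_stronglyMeasurable
      ((Lp.stronglyMeasurable Ψ).comp_measurable measurable_snd)))

/-- Justifies Fubini in (p, q, ξ): |ΦΨ| is at most |Φ|² + |Ψ|², whose integral in ξ is unaffected by
the translation of Φ. -/
theorem integrable_weylIntegrand (g : 𝓢(V × Z, ℂ)) (l : Z) (Φ Ψ : L2 d) :
    Integrable (Function.uncurry (F.weylIntegrand g l Φ Ψ))
      (((volume : Measure (EuclideanSpace ℝ (Fin d))).prod volume).prod volume) := by
  have hm := F.stronglyMeasurable_weylIntegrand g l Φ Ψ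
  have hbd : ∀ w ξ, ‖F.weylIntegrand g l Φ Ψ w ξ‖ ≤
      ‖F.coordFourier g l w‖ * (‖Φ (ξ - √‖l‖ • w.1)‖ ^ 2 + ‖Ψ ξ‖ ^ 2) := by
    intro w ξ
    rw [weylIntegrand, norm_mul, norm_mul, norm_mul, RCLike.norm_conj, ← Complex.ofReal_neg,
      Complex.norm_exp_ofReal_mul_I, one_mul]
    gcongr
    nlinarith [sq_nonneg (‖Φ (ξ - √‖l‖ • w.1)‖ - ‖Ψ ξ‖), sq_nonneg ‖Φ (ξ - √‖l‖ • w.1)‖,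
      sq_nonneg ‖Ψ ξ‖]
  have hiw : ∀ w : EuclideanSpace ℝ (Fin d) × EuclideanSpace ℝ (Fin d),
      Integrable fun ξ => ‖F.coordFourier g l w‖ * (‖Φ (ξ - √‖l‖ • w.1)‖ ^ 2 + ‖Ψ ξ‖ ^ 2) :=
    fun w => (((integrable_norm_sq_L2 Φ).comp_sub_right _).add
      (integrable_norm_sq_L2 Ψ)).const_mul _
  have hcf : Integrable (F.coordFourier g l) (volume.prod volume) :=
    (F.coordFourier g l).integrable (μ := volume)
  refine (integrable_prod_iff hm.aestronglyMeasurable).2 ⟨Eventually.of_forall fun w => ?_, ?_⟩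
  · exact (hiw w).mono' (hm.comp_measurable measurable_prodMk_left).aestronglyMeasurable
      (Eventually.of_forall fun ξ => hbd w ξ)
  · refine (hcf.norm.mul_const (‖Φ‖ ^ 2 + ‖Ψ‖ ^ 2)).mono' ?_
      (Eventually.of_forall fun w => ?_)
    · exact (StronglyMeasurable.integral_prod_right' hm.norm).aestronglyMeasurable
    · rw [Real.norm_eq_abs, abs_of_nonneg (integral_nonneg fun _ => norm_nonneg _)]
      refine (integral_mono_of_nonneg (Eventually.of_forall fun _ => norm_nonneg _) (hiw w)
        (Eventually.of_forall fun ξ => hbd w ξ)).trans_eq ?_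
      rw [integral_const_mul, integral_add ((integrable_norm_sq_L2 Φ).comp_sub_right _)
        (integrable_norm_sq_L2 Ψ), integral_sub_right_eq_self (fun ξ => ‖Φ ξ‖ ^ 2),
        integral_norm_sq_L2, integral_norm_sq_L2]

/-- At fixed ξ and p, the q-integral of a coefficient is a partial Fourier transform at frequency
√|λ|(ξ - √|λ|p/2). With η = ξ - √|λ|p this is √|λ|(ξ + η)/2, and the substitution produces the
factor √|λ|^{-d}. -/
theorem isIntegralOp_fourier (g : 𝓢(V × Z, ℂ)) {l : Z} (hl : l ≠ 0) :
    IsIntegralOp (F.fourier g l) (F.fourierKernel g l) := by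
  refine .of_inner (F.stronglyMeasurable_fourierKernel g hl) (F.integrable_fourierKernel_sq g hl)
    fun Φ Ψ => ?_
  have hs : 0 < √‖l‖ := Real.sqrt_pos.2 (norm_pos_iff.2 hl)
  have hi := F.integrable_weylIntegrand g l Φ Ψ
  rw [F.inner_fourier_eq_integral_coord]
  simp only [F.inner_rep_coord hl, ← integral_const_mul]
  refine (integral_integral_swap hi).trans ?_
  refine integral_congr_ae ?_
  filter_upwards [hi.prod_left_ae] with ξ hξ
  refine (integral_prod _ hξ).trans ?_
  have h1 : ∀ p, ∫ q, F.weylIntegrand g l Φ Ψ (p, q) ξ =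
      (partialFourier (F.coordFourier g l) (√‖l‖ • (ξ - (2⁻¹ * √‖l‖) • p)) p *
        Φ (ξ - √‖l‖ • p)) * (starRingEnd ℂ) (Ψ ξ) := by
    intro p
    rw [partialFourier_apply, ← integral_mul_const, ← integral_mul_const]
    congr 1 with q
    simp only [weylIntegrand]
    ring
  refine (integral_congr_ae (Eventually.of_forall h1)).trans ?_
  rw [integral_mul_const]
  congr 1
  set H : EuclideanSpace ℝ (Fin d) → ℂ := fun p =>
    partialFourier (F.coordFourier g l) (√‖l‖ • (ξ - (2⁻¹ * √‖l‖) • p)) p * Φ (ξ - √‖l‖ • p)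
    with hH
  have h2 : ∀ η, F.fourierKernel g l (ξ, η) * Φ η =
      ((√‖l‖ ^ d)⁻¹ : ℝ) * H ((√‖l‖)⁻¹ • (ξ - η)) := by
    intro η
    simp only [hH, fourierKernel, weylCoord, smul_smul, mul_assoc, mul_inv_cancel₀ hs.ne',
      mul_one, one_smul, sub_sub_cancel]
  simp only [h2]
  rw [integral_const_mul, integral_sub_left_eq_self (fun u => H ((√‖l‖)⁻¹ • u)),
    Measure.integral_comp_inv_smul_of_nonneg volume H hs.le, finrank_euclideanSpace_fin,
    Complex.real_smul, ← mul_assoc, ← Complex.ofReal_mul,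
    inv_mul_cancel₀ (pow_pos hs d).ne', Complex.ofReal_one, one_mul]

/-- The trace of a product of Fourier transforms of Schwartz functions. -/
theorem opTrace_adjoint_fourier_comp (f g : 𝓢(V × Z, ℂ)) {l : Z} (hl : l ≠ 0) :
    opTrace ((ContinuousLinearMap.adjoint (F.fourier f l)).comp (F.fourier g l)) *
      ((‖l‖ ^ d : ℝ) : ℂ) = ((2 * Real.pi) ^ d : ℝ) *
        ∫ v, (starRingEnd ℂ) (partialFourier f l v) * partialFourier g l v := by
  have hs : 0 < √‖l‖ := Real.sqrt_pos.2 (norm_pos_iff.2 hl)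
  have hpos : 0 < √‖l‖ ^ d := pow_pos hs d
  rw [(F.isIntegralOp_fourier f hl).opTrace_adjoint_comp (F.isIntegralOp_fourier g hl)]
  have h1 : ∀ p, (starRingEnd ℂ) (F.fourierKernel f l p) * F.fourierKernel g l p =
      (((√‖l‖ ^ d)⁻¹ ^ 2 : ℝ) : ℂ) * ((starRingEnd ℂ) (partialFourier (F.coordFourier f l)
        (weylCoord √‖l‖ p).2 (weylCoord √‖l‖ p).1) * partialFourier (F.coordFourier g l)
        (weylCoord √‖l‖ p).2 (weylCoord √‖l‖ p).1) := by
    intro p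
    simp only [fourierKernel, map_mul, Complex.conj_ofReal]
    push_cast
    ring
  simp only [h1]
  rw [integral_const_mul,
    (measurePreserving_weylCoord hs).integral_comp_of_aestronglyMeasurable
      (g := fun p => (starRingEnd ℂ) (partialFourier (F.coordFourier f l) p.2 p.1) *
        partialFourier (F.coordFourier g l) p.2 p.1)
      (integrable_conj_partialFourier_mul _ _).aestronglyMeasurable,
    parseval_partialFourier, finrank_euclideanSpace_fin]
  have h2 : ∫ p, (starRingEnd ℂ) (F.coordFourier f l p) * F.coordFourier g l p =
      ∫ v, (starRingEnd ℂ) (partialFourier f l v) * partialFourier g l v :=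
    (F.measurePreserving_coordEquiv l).integral_comp
      (F.coordEquiv l).toHomeomorph.measurableEmbedding
      (fun v => (starRingEnd ℂ) (partialFourier f l v) * partialFourier g l v)
  -- The density |λ|^d cancels the factors √|λ|^{-d} of the two kernels; only (2π)^d, from
  -- Plancherel in q, remains.
  have h3 : ‖l‖ ^ d = (√‖l‖ ^ d) ^ 2 := by
    rw [← pow_mul, mul_comm d 2, pow_mul, Real.sq_sqrt (norm_nonneg l)]
  have h4 : (((√‖l‖ ^ d)⁻¹ ^ 2 : ℝ) : ℂ) * (((√‖l‖ ^ d) ^ 2 : ℝ) : ℂ) = 1 := by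
    rw [← Complex.ofReal_mul, inv_pow, inv_mul_cancel₀ (pow_pos hpos 2).ne', Complex.ofReal_one]
  rw [h2, h3]
  linear_combination (((2 * Real.pi) ^ d : ℝ) : ℂ) *
    (∫ v, (starRingEnd ℂ) (partialFourier f l v) * partialFourier g l v) * h4

end Frame

end HTypeAlgebra

/-! ### The inversion formula -/

/-- The involution `f ↦ (y ↦ conj (f (-y)))` of the Schwartz space. -/
def SchwartzMap.conjNegCLM (E : Type*) [NormedAddCommGroup E] [NormedSpace ℝ E] :
    𝓢(E, ℂ) →L[ℝ] 𝓢(E, ℂ) :=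
  (SchwartzMap.postcompCLM (Complex.conjCLE : ℂ →L[ℝ] ℂ)).comp
    (SchwartzMap.compCLMOfContinuousLinearEquiv ℝ (ContinuousLinearEquiv.neg ℝ))

@[simp] theorem SchwartzMap.conjNegCLM_apply {E : Type*} [NormedAddCommGroup E] [NormedSpace ℝ E]
    (f : 𝓢(E, ℂ)) (y : E) :
    SchwartzMap.conjNegCLM E f y = (starRingEnd ℂ) (f (-y)) := rfl

namespace HTypeAlgebra

variable {V Z : Type*} [NormedAddCommGroup V] [InnerProductSpace ℝ V] [FiniteDimensional ℝ V]
  [MeasurableSpace V] [BorelSpace V]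
  [NormedAddCommGroup Z] [InnerProductSpace ℝ Z] [FiniteDimensional ℝ Z]
  [MeasurableSpace Z] [BorelSpace Z]

/-- The right translate `y ↦ f (y x)` of a Schwartz function. -/
def rightTranslate (𝔤 : HTypeAlgebra V Z) (x : V × Z) (f : 𝓢(V × Z, ℂ)) : 𝓢(V × Z, ℂ) :=
  SchwartzMap.compCLM ℝ (g := fun y => 𝔤.mul y x)
    (by
      have h : (fun y => 𝔤.mul y x) = fun y => 𝔤.rightLin (-x) y + x := by
        funext y
        rw [← neg_neg x, ← rightLin_add_neg, neg_neg]
      rw [h]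
      fun_prop)
    ⟨1, (1 + ‖𝔤.bracket‖) * (1 + ‖x‖), fun y => by
      have h := 𝔤.norm_mul_le' (𝔤.mul y x) (-x)
      rw [mul_neg_cancel_right', norm_neg] at h
      rw [pow_one]
      linarith⟩ f

@[simp] theorem rightTranslate_apply (𝔤 : HTypeAlgebra V Z) (x y : V × Z) (f : 𝓢(V × Z, ℂ)) :
    𝔤.rightTranslate x f y = f (𝔤.mul y x) := rfl

/-- Makes {0} a null set of 𝔷, so that omitting λ = 0 does not affect the integral. -/
theorem nontrivial_center (𝔤 : HTypeAlgebra V Z) : Nontrivial Z := by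
  obtain ⟨U, W, h⟩ := 𝔤.step_two
  exact ⟨_, _, h⟩

namespace Frame

variable {𝔤 : HTypeAlgebra V Z} {d : ℕ} (F : 𝔤.Frame d)

/-- Puts the trace of the quantization in the form Tr(𝓕g(λ)^* 𝓕f(λ)), a Hilbert–Schmidt inner
product. -/
theorem rep_comp_fourier_eq_adjoint (f : 𝓢(V × Z, ℂ)) {l : Z} (hl : l ≠ 0) (x : V × Z) :
    (F.rep l x).comp (F.fourier f l) = ContinuousLinearMap.adjoint
      (F.fourier (SchwartzMap.conjNegCLM (V × Z) (𝔤.rightTranslate x f)) l) := by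
  rw [F.rep_comp_fourier f.integrable hl,
    F.adjoint_fourier (SchwartzMap.integrable _) hl]
  simp only [SchwartzMap.conjNegCLM_apply, neg_neg, Complex.conj_conj, rightTranslate_apply]

/-- The inversion formula: the quantization of a symbol in terms of its kernel. -/
theorem quantize_eq {σ : V × Z → Z → BddOp d} {κ : V × Z → 𝓢(V × Z, ℂ)} (hκ : F.IsKernel σ κ)
    {ε : ℝ} (hε : 0 < ε) (f : 𝓢(V × Z, ℂ)) (x : V × Z) :
    F.quantize ε σ f x = ∫ y, κ x y * f (𝔤.mul x (-dil ε y)) := by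
  have := 𝔤.nontrivial_center
  set K := dilSchwartz ε hε.ne' (κ x) with hK
  set g := SchwartzMap.conjNegCLM (V × Z) (𝔤.rightTranslate x K) with hg
  have hint : ∀ l ∈ ({0}ᶜ : Set Z),
      opTrace ((F.rep l x).comp ((σ x (ε ^ 2 • l)).comp (F.fourier f l))) * ((‖l‖ ^ d : ℝ) : ℂ) =
      ((2 * Real.pi) ^ d : ℝ) *
        ∫ v, (starRingEnd ℂ) (partialFourier g l v) * partialFourier f l v := by
    intro l hl
    have hl0 : l ≠ 0 := hl
    have hl' : ε ^ 2 • l ≠ 0 := smul_ne_zero (by positivity) hl0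
    rw [← F.opTrace_adjoint_fourier_comp g f hl0, hκ.2.2 x _ hl', F.fourier_smul_arg _ hl0 hε,
      ← ContinuousLinearMap.comp_assoc, F.rep_comp_fourier_eq_adjoint _ hl0]
  rw [quantize, setIntegral_congr_fun (by measurability) hint, restrict_compl_singleton,
    integral_const_mul]
  have hpi := (integrable_conj_partialFourier_mul g f)
  have hsw := integral_prod_symm _ hpi
  rw [parseval_partialFourier] at hsw
  rw [← hsw]
  -- The substitution p = x u⁻¹ turns the argument p⁻¹x of `K` into u.
  have h1 : ∫ p, (starRingEnd ℂ) (g p) * f p = ∫ u, K u * f (𝔤.mul x (-u)) := by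
    rw [← 𝔤.integral_mul_left' _ x, ← integral_neg_eq_self]
    congr 1 with u
    simp only [hg, SchwartzMap.conjNegCLM_apply, Complex.conj_conj, rightTranslate_apply,
      neg_mul_rev, neg_neg, mul_cancel_neg_right]
  have h2 : ∫ u, K u * f (𝔤.mul x (-u)) = ∫ y, κ x y * f (𝔤.mul x (-dil ε y)) := by
    simp only [hK, dilSchwartz_apply, mul_assoc]
    rw [integral_const_mul, ← integral_dil hε.ne']
    simp only [dil_inv_dil hε.ne']
  -- The constant c₀ cancels (2π)^d from the trace and (2π)^p from Parseval in z.
  rw [h1, h2, ← mul_assoc, ← mul_assoc, ← Complex.ofReal_mul, ← Complex.ofReal_mul, mul_assoc,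
    ← pow_add, plancherelConst, inv_mul_cancel₀ (by positivity), Complex.ofReal_one, one_mul]

end Frame

end HTypeAlgebra

/-! ### Integral operators along families of measure preserving maps -/

/-- Cauchy–Schwarz for m^{1/2} and m^{1/2}g. -/
theorem sq_lintegral_mul_le {W : Type*} [MeasurableSpace W] {ν : Measure W} {m g : W → ℝ≥0∞}
    (hm : AEMeasurable m ν) (hg : AEMeasurable g ν) :
    (∫⁻ w, m w * g w ∂ν) ^ 2 ≤ (∫⁻ w, m w ∂ν) * ∫⁻ w, m w * g w ^ 2 ∂ν := by
  have hs : ∀ a : ℝ≥0∞, (a ^ (2⁻¹ : ℝ)) ^ (2 : ℝ) = a := fun a => by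
    rw [← ENNReal.rpow_mul]; norm_num
  have h := ENNReal.lintegral_mul_le_Lp_mul_Lq ν Real.HolderConjugate.two_two
    (hm.pow_const (2⁻¹ : ℝ)) ((hm.pow_const (2⁻¹ : ℝ)).mul hg)
  have e1 : ∀ w, ((fun w => m w ^ (2⁻¹ : ℝ)) * ((fun w => m w ^ (2⁻¹ : ℝ)) * g)) w
      = m w * g w := fun w => by
    simp only [Pi.mul_apply]
    rw [← mul_assoc, ← sq, ← ENNReal.rpow_natCast, Nat.cast_two, hs]
  simp only [e1, Pi.mul_apply, hs, ENNReal.mul_rpow_of_nonneg _ _ zero_le_two] at h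
  calc (∫⁻ w, m w * g w ∂ν) ^ 2 ≤ _ := pow_le_pow_left₀ (zero_le) h 2
    _ = _ := by
      rw [mul_pow, ← ENNReal.rpow_natCast, ← ENNReal.rpow_natCast, one_div, Nat.cast_two, hs, hs]
      simp only [← ENNReal.rpow_natCast, Nat.cast_two]

section KernelOperators

variable {X W : Type*} [MeasurableSpace X] [MeasurableSpace W] {μ : Measure X} {ν : Measure W}
  [SFinite μ] [SFinite ν]

/-- A jointly measurable family of measure preserving maps. -/
structure IsMeasurePreservingFamily (μ : Measure X) (A : X → W → X) : Prop where
  measurable : Measurable (Function.uncurry A)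
  measurePreserving : ∀ w, MeasurePreserving (fun x => A x w) μ μ

/-- A measurable kernel dominated by an integrable function of the second variable. -/
structure IsDominatedKernel (ν : Measure W) (K : X → W → ℂ) (m : W → ℝ) : Prop where
  measurable : Measurable (Function.uncurry K)
  norm_le : ∀ x w, ‖K x w‖ ≤ m w
  integrable : Integrable m ν

/-- `T` is the operator `f ↦ (x ↦ ∫ K(x, w) f(A(x, w)) dw)` on `L²`. -/
def IsKernelOp (ν : Measure W) (K : X → W → ℂ) (A : X → W → X)
    (T : Lp ℂ 2 μ →L[ℂ] Lp ℂ 2 μ) : Prop :=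
  ∀ f : Lp ℂ 2 μ, ∀ᵐ x ∂μ, Integrable (fun w => K x w * f (A x w)) ν ∧
    T f x = ∫ w, K x w * f (A x w) ∂ν

variable {A : X → W → X}

/-- Elements of L² are classes, so f(A(x, w)) must tolerate null sets. At fixed w the preimage of a
null set is null, hence it is null in the product. -/
theorem IsMeasurePreservingFamily.ae_ae (hA : IsMeasurePreservingFamily μ A) {p : X → Prop}
    (hp : ∀ᵐ x ∂μ, p x) : ∀ᵐ x ∂μ, ∀ᵐ w ∂ν, p (A x w) := by
  obtain ⟨N, hN, hNm, hN0⟩ := exists_measurable_superset_of_null (ae_iff.1 hp)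
  have h : (μ.prod ν) (Function.uncurry A ⁻¹' N) = 0 := by
    rw [Measure.prod_apply_symm (hA.measurable hNm)]
    refine (lintegral_congr fun w => ?_).trans lintegral_zero
    exact ((hA.measurePreserving w).measure_preimage hNm.nullMeasurableSet).trans hN0
  filter_upwards [Measure.ae_ae_of_ae_prod (measure_eq_zero_iff_ae_notMem.1 h)] with x hx
  filter_upwards [hx] with w hw
  by_contra hc
  exact hw (hN hc)

/-- After Cauchy–Schwarz and Tonelli, the integral in x no longer depends on w. The constant
involves `m` only and not the family, whence bounds uniform in ε. -/
theorem IsMeasurePreservingFamily.lintegral_sq_le (hA : IsMeasurePreservingFamily μ A)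
    {m : W → ℝ≥0∞} (hm : AEMeasurable m ν) {g : X → ℝ≥0∞} (hg : Measurable g) :
    ∫⁻ x, (∫⁻ w, m w * g (A x w) ∂ν) ^ 2 ∂μ ≤ (∫⁻ w, m w ∂ν) ^ 2 * ∫⁻ x, g x ^ 2 ∂μ := by
  have hgA : Measurable fun p : X × W => g (A p.1 p.2) := hg.comp hA.measurable
  calc ∫⁻ x, (∫⁻ w, m w * g (A x w) ∂ν) ^ 2 ∂μ
      ≤ ∫⁻ x, (∫⁻ w, m w ∂ν) * ∫⁻ w, m w * g (A x w) ^ 2 ∂ν ∂μ :=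
        lintegral_mono fun x => sq_lintegral_mul_le hm
          (hgA.comp measurable_prodMk_left).aemeasurable
    _ = (∫⁻ w, m w ∂ν) * ∫⁻ x, ∫⁻ w, m w * g (A x w) ^ 2 ∂ν ∂μ := by
        refine lintegral_const_mul'' _ ?_
        exact ((hm.comp_snd).mul (hgA.pow_const 2).aemeasurable).lintegral_prod_right'
    _ = (∫⁻ w, m w ∂ν) * ∫⁻ w, ∫⁻ x, m w * g (A x w) ^ 2 ∂μ ∂ν := by
        rw [lintegral_lintegral_swap]
        exact (hm.comp_snd).mul (hgA.pow_const 2).aemeasurable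
    _ = (∫⁻ w, m w ∂ν) * ∫⁻ w, m w * ∫⁻ x, g x ^ 2 ∂μ ∂ν := by
        congr 1
        refine lintegral_congr fun w => ?_
        have h : Measurable fun x => g (A x w) := hgA.comp measurable_prodMk_right
        rw [lintegral_const_mul _ (h.pow_const 2), ← (hA.measurePreserving w).lintegral_comp (hg.pow_const 2)]
    _ = _ := by rw [lintegral_mul_const'' _ hm, sq, mul_assoc]

theorem lintegral_enorm_sq_Lp_ne_top (f : Lp ℂ 2 μ) : ∫⁻ x, ‖f x‖ₑ ^ 2 ∂μ ≠ ∞ := by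
  have h := lintegral_rpow_enorm_lt_top_of_eLpNorm_lt_top two_ne_zero (by simp)
    (Lp.memLp f).eLpNorm_lt_top
  simpa using h.ne

variable {K : X → W → ℂ} {m : W → ℝ}

theorem IsDominatedKernel.nonneg (hK : IsDominatedKernel ν K m) [Nonempty X] (w : W) : 0 ≤ m w :=
  (norm_nonneg _).trans (hK.norm_le (Classical.arbitrary X) w)

theorem IsDominatedKernel.enorm_le (hK : IsDominatedKernel ν K m) (x : X) (w : W) :
    ‖K x w‖ₑ ≤ ‖m w‖ₑ :=
  enorm_le_iff_norm_le.2 ((hK.norm_le x w).trans (le_abs_self _))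

theorem IsDominatedKernel.measurable_mul (hK : IsDominatedKernel ν K m)
    (hA : IsMeasurePreservingFamily μ A) {f : X → ℂ} (hf : Measurable f) :
    Measurable fun p : X × W => K p.1 p.2 * f (A p.1 p.2) :=
  hK.measurable.mul (hf.comp hA.measurable)

theorem IsDominatedKernel.lintegral_sq_le (hK : IsDominatedKernel ν K m)
    (hA : IsMeasurePreservingFamily μ A) (f : Lp ℂ 2 μ) :
    ∫⁻ x, (∫⁻ w, ‖K x w * f (A x w)‖ₑ ∂ν) ^ 2 ∂μ ≤
      (∫⁻ w, ‖m w‖ₑ ∂ν) ^ 2 * ∫⁻ x, ‖f x‖ₑ ^ 2 ∂μ := by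
  refine le_trans (lintegral_mono fun x => ?_) (hA.lintegral_sq_le
    hK.integrable.aestronglyMeasurable.enorm (Lp.stronglyMeasurable f).measurable.enorm)
  refine pow_le_pow_left₀ zero_le (lintegral_mono fun w => ?_) 2
  rw [enorm_mul]
  exact mul_le_mul_left (hK.enorm_le x w) _

theorem IsDominatedKernel.ae_integrable (hK : IsDominatedKernel ν K m)
    (hA : IsMeasurePreservingFamily μ A) (f : Lp ℂ 2 μ) :
    ∀ᵐ x ∂μ, Integrable (fun w => K x w * f (A x w)) ν := by
  have hmeas := hK.measurable_mul hA (Lp.stronglyMeasurable f).measurable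
  have h := (hK.lintegral_sq_le hA f).trans_lt (ENNReal.mul_lt_top
    (ENNReal.pow_lt_top hK.integrable.2) (lintegral_enorm_sq_Lp_ne_top f).lt_top)
  filter_upwards [ae_lt_top (hmeas.enorm.lintegral_prod_right'.pow_const 2) h.ne] with x hx
  refine ⟨(hmeas.comp measurable_prodMk_left).aestronglyMeasurable, ?_⟩
  by_contra hc
  rw [HasFiniteIntegral, not_lt, top_le_iff] at hc
  rw [hc] at hx
  simp at hx

theorem IsDominatedKernel.eLpNorm_integral_le (hK : IsDominatedKernel ν K m)
    (hA : IsMeasurePreservingFamily μ A) (f : Lp ℂ 2 μ) :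
    eLpNorm (fun x => ∫ w, K x w * f (A x w) ∂ν) 2 μ ≤ (∫⁻ w, ‖m w‖ₑ ∂ν) * eLpNorm f 2 μ := by
  have hs : ∀ a : ℝ≥0∞, (a ^ 2) ^ (1 / 2 : ℝ) = a := fun a => by
    rw [← ENNReal.rpow_natCast, ← ENNReal.rpow_mul]; norm_num
  rw [eLpNorm_eq_lintegral_rpow_enorm_toReal two_ne_zero (by simp),
    eLpNorm_eq_lintegral_rpow_enorm_toReal two_ne_zero (by simp)]
  simp only [ENNReal.toReal_ofNat, ENNReal.rpow_ofNat]
  conv_rhs => rw [← hs (∫⁻ w, ‖m w‖ₑ ∂ν)]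
  rw [← ENNReal.mul_rpow_of_nonneg _ _ (by norm_num)]
  refine ENNReal.rpow_le_rpow (le_trans (lintegral_mono fun x => ?_)
    (hK.lintegral_sq_le hA f)) (by norm_num)
  exact pow_le_pow_left₀ zero_le (enorm_integral_le_lintegral_enorm _) 2

theorem IsDominatedKernel.memLp (hK : IsDominatedKernel ν K m)
    (hA : IsMeasurePreservingFamily μ A) (f : Lp ℂ 2 μ) :
    MemLp (fun x => ∫ w, K x w * f (A x w) ∂ν) 2 μ :=
  ⟨(hK.measurable_mul hA (Lp.stronglyMeasurable f).measurable).stronglyMeasurable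
      |>.integral_prod_right'.aestronglyMeasurable,
    (hK.eLpNorm_integral_le hA f).trans_lt
      (ENNReal.mul_lt_top hK.integrable.2 (Lp.eLpNorm_lt_top f))⟩

theorem IsDominatedKernel.lintegral_enorm (hK : IsDominatedKernel ν K m) [Nonempty X] :
    ∫⁻ w, ‖m w‖ₑ ∂ν = ENNReal.ofReal (∫ w, m w ∂ν) := by
  rw [ofReal_integral_eq_lintegral_ofReal hK.integrable
    (Eventually.of_forall hK.nonneg)]
  exact lintegral_congr fun w => Real.enorm_of_nonneg (hK.nonneg w)

theorem IsDominatedKernel.norm_toLp_le (hK : IsDominatedKernel ν K m) [Nonempty X]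
    (hA : IsMeasurePreservingFamily μ A) (f : Lp ℂ 2 μ) :
    ‖(hK.memLp hA f).toLp _‖ ≤ (∫ w, m w ∂ν) * ‖f‖ := by
  rw [Lp.norm_toLp, Lp.norm_def, ← ENNReal.toReal_ofReal (integral_nonneg hK.nonneg),
    ← ENNReal.toReal_mul, ← hK.lintegral_enorm]
  exact ENNReal.toReal_mono (ENNReal.mul_ne_top hK.integrable.2.ne (Lp.eLpNorm_ne_top f))
    (hK.eLpNorm_integral_le hA f)

theorem IsDominatedKernel.exists_isKernelOp (hK : IsDominatedKernel ν K m) [Nonempty X]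
    (hA : IsMeasurePreservingFamily μ A) :
    ∃ T : Lp ℂ 2 μ →L[ℂ] Lp ℂ 2 μ, IsKernelOp ν K A T := by
  refine ⟨LinearMap.mkContinuous
    { toFun := fun f => (hK.memLp hA f).toLp _
      map_add' := fun f g => ?_
      map_smul' := fun c f => ?_ } (∫ w, m w ∂ν) fun f => hK.norm_toLp_le hA f, fun f => ?_⟩
  · rw [← MemLp.toLp_add]
    refine MemLp.toLp_congr _ _ ?_
    filter_upwards [hA.ae_ae (ν := ν) (Lp.coeFn_add f g), hK.ae_integrable hA f,
      hK.ae_integrable hA g] with x h hf hg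
    rw [Pi.add_apply, ← integral_add hf hg]
    refine integral_congr_ae ?_
    filter_upwards [h] with w hw
    rw [hw, Pi.add_apply, mul_add]
  · rw [RingHom.id_apply, ← MemLp.toLp_const_smul]
    refine MemLp.toLp_congr _ _ ?_
    filter_upwards [hA.ae_ae (ν := ν) (Lp.coeFn_smul c f)] with x h
    rw [Pi.smul_apply, ← integral_smul]
    refine integral_congr_ae ?_
    filter_upwards [h] with w hw
    rw [hw, Pi.smul_apply, smul_eq_mul, smul_eq_mul, mul_left_comm]
  · filter_upwards [hK.ae_integrable hA f, (hK.memLp hA f).coeFn_toLp] with x h₁ h₂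
    exact ⟨h₁, h₂⟩

namespace IsKernelOp

variable {T T' : Lp ℂ 2 μ →L[ℂ] Lp ℂ 2 μ} {K' : X → W → ℂ}

theorem norm_le (hT : IsKernelOp ν K A T) (hK : IsDominatedKernel ν K m) [Nonempty X]
    (hA : IsMeasurePreservingFamily μ A) : ‖T‖ ≤ ∫ w, m w ∂ν := by
  refine T.opNorm_le_bound (integral_nonneg hK.nonneg) fun f => ?_
  have h : T f = (hK.memLp hA f).toLp _ := by
    refine Lp.ext ?_
    filter_upwards [hT f, (hK.memLp hA f).coeFn_toLp] with x h₁ h₂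
    rw [h₁.2, h₂]
  rw [h]
  exact hK.norm_toLp_le hA f

theorem sub (hT : IsKernelOp ν K A T) (hT' : IsKernelOp ν K' A T') :
    IsKernelOp ν (fun x w => K x w - K' x w) A (T - T') := by
  intro f
  filter_upwards [hT f, hT' f, Lp.coeFn_sub (T f) (T' f)] with x h₁ h₂ h₃
  simp only [sub_mul]
  refine ⟨h₁.1.sub h₂.1, ?_⟩
  rw [integral_sub h₁.1 h₂.1, _root_.sub_apply, h₃, Pi.sub_apply, h₁.2, h₂.2]

theorem const_smul (hT : IsKernelOp ν K A T) (c : ℂ) :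
    IsKernelOp ν (fun x w => c * K x w) A (c • T) := by
  intro f
  filter_upwards [hT f, Lp.coeFn_smul c (T f)] with x h₁ h₂
  simp only [mul_assoc]
  refine ⟨h₁.1.const_mul c, ?_⟩
  rw [integral_const_mul, _root_.smul_apply, h₂, Pi.smul_apply, h₁.2, smul_eq_mul]

/-- The kernel of a composition. -/
theorem comp {W' : Type*} [MeasurableSpace W'] {ν' : Measure W'} [SFinite ν'] {B : X → W' → X}
    {L : X → W' → ℂ} {m' : W × W' → ℝ} {S : Lp ℂ 2 μ →L[ℂ] Lp ℂ 2 μ}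
    (hT : IsKernelOp ν K A T) (hS : IsKernelOp ν' L B S)
    (hA : IsMeasurePreservingFamily μ A)
    (hKL : IsDominatedKernel (ν.prod ν') (fun x p => K x p.1 * L (A x p.1) p.2) m')
    (hAB : IsMeasurePreservingFamily μ fun x (p : W × W') => B (A x p.1) p.2) :
    IsKernelOp (ν.prod ν') (fun x p => K x p.1 * L (A x p.1) p.2)
      (fun x p => B (A x p.1) p.2) (T.comp S) := by
  intro f
  filter_upwards [hT (S f), hA.ae_ae (ν := ν) (hS f), hKL.ae_integrable hAB f] with x h₁ h₂ h₃
  refine ⟨h₃, ?_⟩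
  rw [ContinuousLinearMap.comp_apply, h₁.2, integral_prod _ h₃]
  refine integral_congr_ae ?_
  filter_upwards [h₂] with w hw
  simp only [hw.2, mul_assoc, integral_const_mul]

theorem _root_.IsMeasurePreservingFamily.prod (hA : IsMeasurePreservingFamily μ A) :
    MeasurePreserving (fun p : W × X => (p.1, A p.2 p.1)) (ν.prod μ) (ν.prod μ) :=
  (MeasurePreserving.id ν).skew_product (g := fun w x => A x w)
    (hA.measurable.comp measurable_swap) (Eventually.of_forall fun w => (hA.measurePreserving w).map_eq)

/-- Justifies Fubini in ⟨g, Tf⟩: the product |f(A)||g| is at most |f(A)|² + |g|², and (w, x) ↦ (w,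
A(x, w)) preserves the product measure. -/
theorem _root_.IsDominatedKernel.integrable_prod (hK : IsDominatedKernel ν K m) [Nonempty X]
    (hA : IsMeasurePreservingFamily μ A) (f g : Lp ℂ 2 μ) :
    Integrable (fun p : W × X => (K p.2 p.1 * f (A p.2 p.1)) * (starRingEnd ℂ) (g p.2))
      (ν.prod μ) := by
  have hsq : ∀ u : Lp ℂ 2 μ, Integrable (fun p : W × X => m p.1 * ‖u p.2‖ ^ 2) (ν.prod μ) :=
    fun u => hK.integrable.mul_prod
      ((memLp_two_iff_integrable_sq_norm (Lp.aestronglyMeasurable u)).1 (Lp.memLp u))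
  have hmeas := (hK.measurable_mul hA (Lp.stronglyMeasurable f).measurable).comp measurable_swap
  refine (((hA.prod (ν := ν)).integrable_comp_of_integrable (hsq f)).add (hsq g)).mono'
    (hmeas.mul (Complex.continuous_conj.measurable.comp
      ((Lp.stronglyMeasurable g).measurable.comp measurable_snd))).aestronglyMeasurable
    (Eventually.of_forall fun p => ?_)
  rw [norm_mul, norm_mul, RCLike.norm_conj]
  simp only [Pi.add_apply, Function.comp_apply]
  have h := hK.norm_le p.2 p.1
  have h0 := hK.nonneg p.1
  calc ‖K p.2 p.1‖ * ‖f (A p.2 p.1)‖ * ‖g p.2‖ ≤ m p.1 * ‖f (A p.2 p.1)‖ * ‖g p.2‖ := by gcongr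
    _ = m p.1 * (‖f (A p.2 p.1)‖ * ‖g p.2‖) := mul_assoc _ _ _
    _ ≤ m p.1 * (‖f (A p.2 p.1)‖ ^ 2 + ‖g p.2‖ ^ 2) := by
      gcongr
      nlinarith [sq_nonneg (‖f (A p.2 p.1)‖ - ‖g p.2‖), sq_nonneg (‖f (A p.2 p.1)‖),
        sq_nonneg ‖g p.2‖]
    _ = _ := mul_add _ _ _

/-- The kernel of the adjoint. -/
theorem adjoint (hT : IsKernelOp ν K A T) (hK : IsDominatedKernel ν K m) [Nonempty X]
    (hA : IsMeasurePreservingFamily μ A) {n : W → W} (hn : MeasurePreserving n ν ν)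
    (hAn : ∀ x w, A (A x w) (n w) = x) :
    IsKernelOp ν (fun x w => (starRingEnd ℂ) (K (A x w) (n w))) A
      (ContinuousLinearMap.adjoint T) := by
  have hK' : IsDominatedKernel ν (fun x w => (starRingEnd ℂ) (K (A x w) (n w)))
      (fun w => m (n w)) :=
    ⟨Complex.continuous_conj.measurable.comp
      (hK.measurable.comp (hA.measurable.prodMk (hn.measurable.comp measurable_snd))),
      fun x w => by rw [RCLike.norm_conj]; exact hK.norm_le _ _,
      hn.integrable_comp_of_integrable hK.integrable⟩
  obtain ⟨S, hS⟩ := hK'.exists_isKernelOp hA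
  -- An operator with the transposed kernel exists by domination; it remains to test it against `T`.
  suffices h : S = ContinuousLinearMap.adjoint T from h ▸ hS
  rw [ContinuousLinearMap.eq_adjoint_iff]
  intro g f
  have hΦ := hK.integrable_prod hA f g
  -- By `hAn`, this substitution exchanges x and A(x, w), and so the roles of f and g.
  have hΨ : MeasurePreserving (fun p : W × X => (n p.1, A p.2 p.1)) (ν.prod μ) (ν.prod μ) :=
    hn.skew_product (g := fun w x => A x w) (hA.measurable.comp measurable_swap)
      (Eventually.of_forall fun w => (hA.measurePreserving w).map_eq)
  rw [L2.inner_def, L2.inner_def]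
  calc ∫ x, ⟪S g x, f x⟫_ℂ ∂μ
      = ∫ x, ∫ w, (K (A x w) (n w) * f (A (A x w) (n w))) * (starRingEnd ℂ) (g (A x w)) ∂ν ∂μ := by
        refine integral_congr_ae ?_
        filter_upwards [hS g] with x hx
        rw [hx.2, RCLike.inner_apply, ← integral_conj, ← integral_const_mul]
        refine integral_congr_ae (Eventually.of_forall fun w => ?_)
        simp only [map_mul, Complex.conj_conj, hAn]
        ring
    _ = ∫ p, (K (A p.2 p.1) (n p.1) * f (A (A p.2 p.1) (n p.1))) *
          (starRingEnd ℂ) (g (A p.2 p.1)) ∂ν.prod μ :=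
        (integral_prod_symm _ (hΨ.integrable_comp_of_integrable hΦ)).symm
    _ = ∫ p, (K p.2 p.1 * f (A p.2 p.1)) * (starRingEnd ℂ) (g p.2) ∂ν.prod μ :=
        hΨ.integral_comp_of_aestronglyMeasurable hΦ.aestronglyMeasurable
    _ = ∫ x, ∫ w, (K x w * f (A x w)) * (starRingEnd ℂ) (g x) ∂ν ∂μ := integral_prod_symm _ hΦ
    _ = ∫ x, ⟪g x, T f x⟫_ℂ ∂μ := by
        refine integral_congr_ae ?_
        filter_upwards [hT f] with x hx
        rw [hx.2, RCLike.inner_apply, integral_mul_const]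

end IsKernelOp

end KernelOperators

/-! ### Compactly supported families of Schwartz functions -/

section Families

variable {X E : Type*} [TopologicalSpace X] [NormedAddCommGroup E] [NormedSpace ℝ E]
  {κ : X → 𝓢(E, ℂ)}

theorem Continuous.schwartz_eval {Y : Type*} [TopologicalSpace Y] {κ : Y → 𝓢(E, ℂ)} {g : Y → E}
    (hκ : Continuous κ) (hg : Continuous g) : Continuous fun y => κ y (g y) := by
  have h : Continuous fun y => SchwartzMap.toBoundedContinuousFunctionCLM ℝ E ℂ (κ y) :=
    (SchwartzMap.toBoundedContinuousFunctionCLM ℝ E ℂ).continuous.comp hκ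
  exact h.eval hg

/-- A weighted seminorm of κ_x is continuous with compact support in x, hence bounded: the decay in
y is uniform. -/
theorem exists_one_add_pow_mul_norm_le (hκ : Continuous κ) (hs : HasCompactSupport κ) (k : ℕ) :
    ∃ C, 0 ≤ C ∧ ∀ x y, ‖κ x y‖ ≤ C * ((1 + ‖y‖) ^ k)⁻¹ := by
  have hc : Continuous fun x => schwartzSup E k 0 (κ x) := (continuous_schwartzSup k 0).comp hκ
  have hs' : HasCompactSupport fun x => schwartzSup E k 0 (κ x) :=
    hs.comp_left (g := schwartzSup E k 0) (map_zero _)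
  obtain ⟨C, hC⟩ := hs'.exists_bound_of_continuous hc
  refine ⟨2 ^ k * max C 0, by positivity, fun x y => ?_⟩
  have h := one_add_pow_mul_norm_le_schwartzSup (κ x) k y
  rw [← div_eq_mul_inv, le_div_iff₀ (by positivity), mul_comm]
  refine h.trans ?_
  gcongr
  exact (le_abs_self _).trans ((hC x).trans (le_max_left _ _))

end Families

/-! ### Quantizations as kernel operators on L²(G) -/

namespace HTypeAlgebra

variable {V Z : Type*} [NormedAddCommGroup V] [InnerProductSpace ℝ V] [FiniteDimensional ℝ V]
  [MeasurableSpace V] [BorelSpace V]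
  [NormedAddCommGroup Z] [InnerProductSpace ℝ Z] [FiniteDimensional ℝ Z]
  [MeasurableSpace Z] [BorelSpace Z]

/-- An integrable power of the weight `1 + ‖y‖`. -/
def weight (V Z : Type*) [NormedAddCommGroup V] [InnerProductSpace ℝ V] [FiniteDimensional ℝ V]
    [MeasurableSpace V] [BorelSpace V] [NormedAddCommGroup Z] [InnerProductSpace ℝ Z]
    [FiniteDimensional ℝ Z] [MeasurableSpace Z] [BorelSpace Z] (y : V × Z) : ℝ :=
  ((1 + ‖y‖) ^ (volume : Measure (V × Z)).integrablePower)⁻¹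

theorem integrable_weight : Integrable (weight V Z) volume :=
  integrable_one_add_norm_pow_inv volume

theorem weight_nonneg (y : V × Z) : 0 ≤ weight V Z y := by
  unfold weight; positivity

theorem exists_norm_le_weight {X : Type*} [TopologicalSpace X] {κ : X → 𝓢(V × Z, ℂ)}
    (hκ : Continuous κ) (hs : HasCompactSupport κ) (k : ℕ) :
    ∃ C, 0 ≤ C ∧ ∀ x y, (1 + ‖y‖) ^ k * ‖κ x y‖ ≤ C * weight V Z y := by
  obtain ⟨C, hC0, hC⟩ := exists_one_add_pow_mul_norm_le hκ hs
    (k + (volume : Measure (V × Z)).integrablePower)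
  refine ⟨C, hC0, fun x y => ?_⟩
  calc (1 + ‖y‖) ^ k * ‖κ x y‖
      ≤ (1 + ‖y‖) ^ k * (C * ((1 + ‖y‖) ^ (k + (volume : Measure (V × Z)).integrablePower))⁻¹) := by
        gcongr; exact hC x y
    _ = C * weight V Z y := by
        rw [weight, pow_add]
        have : 0 < 1 + ‖y‖ := by positivity
        field_simp

/-- The map `(x, y) ↦ x (δ_ε y)⁻¹`. -/
def dilShift (𝔤 : HTypeAlgebra V Z) (ε : ℝ) (x y : V × Z) : V × Z := 𝔤.mul x (-dil ε y)

variable (𝔤 : HTypeAlgebra V Z)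

theorem continuous_dilShift (ε : ℝ) : Continuous (Function.uncurry (𝔤.dilShift ε)) := by
  unfold Function.uncurry dilShift
  fun_prop

theorem dilShift_family (ε : ℝ) : IsMeasurePreservingFamily volume (𝔤.dilShift ε) :=
  ⟨(𝔤.continuous_dilShift ε).measurable, fun y => 𝔤.measurePreserving_mul_right (-dil ε y)⟩

theorem dilShift_prod_family (ε : ℝ) : IsMeasurePreservingFamily volume
    fun x (p : (V × Z) × (V × Z)) => 𝔤.dilShift ε (𝔤.dilShift ε x p.1) p.2 := by
  refine ⟨Continuous.measurable ?_, fun p => ?_⟩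
  · have h := 𝔤.continuous_dilShift ε
    exact h.comp ((h.comp (continuous_fst.prodMk (continuous_fst.comp continuous_snd))).prodMk
      (continuous_snd.comp continuous_snd))
  · exact ((𝔤.dilShift_family ε).measurePreserving p.2).comp
      ((𝔤.dilShift_family ε).measurePreserving p.1)

theorem dilShift_dilShift_neg (ε : ℝ) (x y : V × Z) :
    𝔤.dilShift ε (𝔤.dilShift ε x y) (-y) = x := by
  rw [dilShift, dilShift, map_neg, neg_neg, mul_cancel_neg_right]

theorem exists_isDominatedKernel {κ : V × Z → 𝓢(V × Z, ℂ)} (hκ : Continuous κ)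
    (hs : HasCompactSupport κ) :
    ∃ m, IsDominatedKernel (volume : Measure (V × Z)) (fun x y => κ x y) m := by
  obtain ⟨C, -, hC⟩ := exists_norm_le_weight hκ hs 0
  exact ⟨fun y => C * weight V Z y,
    ((hκ.comp continuous_fst).schwartz_eval continuous_snd).measurable,
    fun x y => by simpa using hC x y, integrable_weight.const_mul C⟩

namespace Frame

variable {𝔤 : HTypeAlgebra V Z} {d : ℕ} (F : 𝔤.Frame d)

/-- The operator of kernel `κ` is the quantization of the symbol of kernel `κ`. -/
theorem IsKernel.isQuantization {σ : V × Z → Z → BddOp d} {κ : V × Z → 𝓢(V × Z, ℂ)}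
    (hκ : F.IsKernel σ κ) {ε : ℝ} (hε : 0 < ε)
    {T : Lp ℂ 2 (volume : Measure (V × Z)) →L[ℂ] Lp ℂ 2 (volume : Measure (V × Z))}
    (hT : IsKernelOp volume (fun x y => κ x y) (𝔤.dilShift ε) T) : F.IsQuantization ε σ T := by
  intro f
  filter_upwards [hT (f.toLp 2 volume),
    (𝔤.dilShift_family ε).ae_ae (ν := volume) (f.coeFn_toLp 2 volume)] with x h₁ h₂
  rw [h₁.2, F.quantize_eq hκ hε]
  refine integral_congr_ae ?_
  filter_upwards [h₂] with y hy
  rw [hy, dilShift]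

/-- The kernel operator is a bounded extension of the quantization, so by uniqueness it is the one
selected by `op`. -/
theorem IsKernel.exists_quantization {σ : V × Z → Z → BddOp d} {κ : V × Z → 𝓢(V × Z, ℂ)}
    (hκ : F.IsKernel σ κ) {ε : ℝ} (hε : 0 < ε) :
    F.IsQuantization ε σ (F.op ε σ) ∧
      IsKernelOp volume (fun x y => κ x y) (𝔤.dilShift ε) (F.op ε σ) := by
  obtain ⟨m, hm⟩ := exists_isDominatedKernel hκ.1.continuous hκ.2.1
  obtain ⟨T, hT⟩ := hm.exists_isKernelOp (𝔤.dilShift_family ε)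
  have hq := IsKernel.isQuantization F hκ hε hT
  have h : ∃ T, F.IsQuantization ε σ T := ⟨T, hq⟩
  have h' : F.IsQuantization ε σ (F.op ε σ) := by
    rw [op, dif_pos h]
    exact h.choose_spec
  exact ⟨h', IsQuantization.unique F hq h' ▸ hT⟩

theorem isQuantization_op {σ : V × Z → Z → BddOp d} (hσ : σ ∈ F.A0) {ε : ℝ} (hε : 0 < ε) :
    F.IsQuantization ε σ (F.op ε σ) := by
  obtain ⟨κ, hκ⟩ := hσ
  exact (IsKernel.exists_quantization F hκ hε).1

theorem IsKernel.isKernelOp {σ : V × Z → Z → BddOp d} {κ : V × Z → 𝓢(V × Z, ℂ)}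
    (hκ : F.IsKernel σ κ) {ε : ℝ} (hε : 0 < ε) :
    IsKernelOp volume (fun x y => κ x y) (𝔤.dilShift ε) (F.op ε σ) :=
  (IsKernel.exists_quantization F hκ hε).2

/-- The difference operators are defined with the same choice of kernel, so uniqueness of kernels is
not needed. -/
theorem isKernel_kernel {σ : V × Z → Z → BddOp d} (hσ : σ ∈ F.A0) :
    F.IsKernel σ (F.kernel σ) := by
  have h : ∃ κ, F.IsKernel σ κ := hσ
  rw [kernel, dif_pos h]
  exact h.choose_spec

end Frame

end HTypeAlgebra

/-! ### Left-invariant derivatives of families of Schwartz functions -/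

theorem HasDirDeriv.sum_smul {E F ι : Type*} [NormedAddCommGroup E] [NormedSpace ℝ E]
    [NormedAddCommGroup F] [NormedSpace ℝ F] {f : E → F} (s : Finset ι) (c : ι → ℝ) {e : ι → E}
    {g : ι → E → F} (h : ∀ i, HasDirDeriv f (e i) (g i)) (hg : ∀ i, Continuous (g i)) :
    HasDirDeriv f (∑ i ∈ s, c i • e i) fun x => ∑ i ∈ s, c i • g i x := by
  classical
  induction s using Finset.induction_on with
  | empty => intro x; simp
  | insert a s ha ih =>
    simp only [Finset.sum_insert ha]
    exact ((h a).smul (c a)).add_dir ih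
      (continuous_finsetSum s fun i _ => continuous_const.smul (hg i))

/-- Evaluation of Schwartz functions at a point. -/
def SchwartzMap.evalCLM' {E : Type*} [NormedAddCommGroup E] [NormedSpace ℝ E] (y : E) :
    𝓢(E, ℂ) →L[ℝ] ℂ :=
  (BoundedContinuousFunction.evalCLM ℝ y).comp (SchwartzMap.toBoundedContinuousFunctionCLM ℝ E ℂ)

@[simp] theorem SchwartzMap.evalCLM'_apply {E : Type*} [NormedAddCommGroup E] [NormedSpace ℝ E]
    (y : E) (f : 𝓢(E, ℂ)) : SchwartzMap.evalCLM' y f = f y := rfl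

@[simp] theorem SchwartzMap.sum_apply' {E ι : Type*} [NormedAddCommGroup E] [NormedSpace ℝ E]
    (s : Finset ι) (f : ι → 𝓢(E, ℂ)) (y : E) : (∑ i ∈ s, f i) y = ∑ i ∈ s, f i y := by
  simp only [← SchwartzMap.evalCLM'_apply, map_sum]

/-- Additivity in the direction was shown for normed targets, so it is checked after evaluation at
each point. -/
theorem dirDeriv_sum_smul {E E' ι : Type*} [NormedAddCommGroup E] [NormedSpace ℝ E]
    [NormedAddCommGroup E'] [NormedSpace ℝ E'] {κ : E → 𝓢(E', ℂ)} (hκ : IsSmoothTVS κ)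
    (s : Finset ι) (c : ι → ℝ) (e : ι → E) (x : E) :
    dirDeriv κ (∑ i ∈ s, c i • e i) x = ∑ i ∈ s, c i • dirDeriv κ (e i) x := by
  ext y
  have h : ∀ a, HasDirDeriv (fun x => SchwartzMap.evalCLM' y (κ x)) a
      (fun x => SchwartzMap.evalCLM' y (dirDeriv κ a x)) := fun a =>
    (hκ.hasDirDeriv a).clm_comp _
  have h' := (h (∑ i ∈ s, c i • e i)).unique (HasDirDeriv.sum_smul s c (fun i => h (e i))
    fun i => (SchwartzMap.evalCLM' y).continuous.comp (hκ.dirDeriv _).continuous)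
  simpa using congrFun h' x

namespace HTypeAlgebra

variable {V Z : Type*} [NormedAddCommGroup V] [InnerProductSpace ℝ V] [FiniteDimensional ℝ V]
  [MeasurableSpace V] [BorelSpace V]
  [NormedAddCommGroup Z] [InnerProductSpace ℝ Z] [FiniteDimensional ℝ Z]
  [MeasurableSpace Z] [BorelSpace Z]

variable (𝔤 : HTypeAlgebra V Z)

/-- The left-invariant derivative of a family of Schwartz functions in the direction `u ∈ 𝔳`. -/
def leftDir (κ : V × Z → 𝓢(V × Z, ℂ)) (u : V) (x : V × Z) : 𝓢(V × Z, ℂ) :=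
  dirDeriv κ (u, 0) x + ∑ k, (2⁻¹ * ⟪stdOrthonormalBasis ℝ Z k, 𝔤.bracket x.1 u⟫_ℝ) •
    dirDeriv κ (0, stdOrthonormalBasis ℝ Z k) x

variable {κ : V × Z → 𝓢(V × Z, ℂ)}

theorem isSmoothTVS_leftDir (hκ : IsSmoothTVS κ) (u : V) : IsSmoothTVS (𝔤.leftDir κ u) := by
  refine (hκ.dirDeriv _).add (IsSmoothTVS.sum _ fun k _ => ?_)
  exact (hκ.dirDeriv _).clm_smul ((2⁻¹ : ℝ) • (innerSL ℝ (stdOrthonormalBasis ℝ Z k)).comp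
    ((𝔤.bracket.flip u).comp (ContinuousLinearMap.fst ℝ V Z)))

theorem hasCompactSupport_leftDir (hκ : IsSmoothTVS κ) (hs : HasCompactSupport κ) (u : V) :
    HasCompactSupport (𝔤.leftDir κ u) := by
  refine HasCompactSupport.intro hs fun x hx => ?_
  simp [leftDir, dirDeriv_eq_zero_of_notMem_tsupport hκ _ hx]

/-- The left-invariant field of u has value (u, [x_𝔳, u]/2) at x. Its expansion in constant
directions, with coefficients linear in x, is the form of `leftDir` in which smoothness is visible.
-/
theorem dirDeriv_eq_leftDir (hκ : IsSmoothTVS κ) (u : V) (x : V × Z) :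
    dirDeriv κ (u, (2⁻¹ : ℝ) • 𝔤.bracket x.1 u) x = 𝔤.leftDir κ u x := by
  have h := dirDeriv_sum_smul hκ Finset.univ
    (fun o : Option (Fin (Module.finrank ℝ Z)) => o.elim 1
      fun k => 2⁻¹ * ⟪stdOrthonormalBasis ℝ Z k, 𝔤.bracket x.1 u⟫_ℝ)
    (fun o => o.elim (u, 0) fun k => (0, stdOrthonormalBasis ℝ Z k)) x
  simp only [Fintype.sum_option, Option.elim, one_smul] at h
  rw [leftDir, ← h]
  congr 1
  ext
  · simp [Prod.fst_sum]
  · simp only [Prod.snd_add, Prod.snd_sum, Prod.smul_snd, zero_add, mul_smul, ← Finset.smul_sum,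
      (stdOrthonormalBasis ℝ Z).sum_repr']

theorem leftDir_sum_smul (hκ : IsSmoothTVS κ) {ι : Type*} (s : Finset ι) (c : ι → ℝ) (u : ι → V)
    (x : V × Z) : 𝔤.leftDir κ (∑ i ∈ s, c i • u i) x = ∑ i ∈ s, c i • 𝔤.leftDir κ (u i) x := by
  simp only [← 𝔤.dirDeriv_eq_leftDir hκ, ← dirDeriv_sum_smul hκ]
  congr 1
  ext
  · simp [Prod.fst_sum]
  · simp [Prod.snd_sum, Finset.smul_sum, smul_smul, mul_comm]

theorem mul_smul_fst (x : V × Z) (t : ℝ) (u : V) :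
    𝔤.mul x (t • u, 0) = x + t • (u, (2⁻¹ : ℝ) • 𝔤.bracket x.1 u) := by
  ext
  · simp [mul]
  · simp [mul, smul_smul, mul_comm]

/-- The derivative along the integral curves of a left-invariant vector field. -/
theorem hasDerivAt_leftDir (hκ : IsSmoothTVS κ) {N : Type*} [NormedAddCommGroup N]
    [NormedSpace ℝ N] (L : 𝓢(V × Z, ℂ) →L[ℝ] N) (u : V) (x : V × Z) (t : ℝ) :
    HasDerivAt (fun s : ℝ => L (κ (𝔤.mul x (s • u, 0))))
      (L (𝔤.leftDir κ u (𝔤.mul x (t • u, 0)))) t := by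
  simp only [mul_smul_fst]
  have h := ((hκ.hasDirDeriv (u, (2⁻¹ : ℝ) • 𝔤.bracket x.1 u)).clm_comp L).hasDerivAt x t
  -- As [u, u] = 0, the field is constant along the integral curve, a straight line.
  have h' := 𝔤.dirDeriv_eq_leftDir hκ u (x + t • (u, (2⁻¹ : ℝ) • 𝔤.bracket x.1 u))
  simp only [Prod.fst_add, Prod.smul_fst, map_add, map_smul, add_apply, smul_apply, bracket_self,
    smul_zero, add_zero] at h'
  rwa [← h']

theorem leftDeriv_clm (hκ : IsSmoothTVS κ) {N : Type*} [NormedAddCommGroup N]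
    [NormedSpace ℝ N] (L : 𝓢(V × Z, ℂ) →L[ℝ] N) (u : V) (x : V × Z) :
    𝔤.leftDeriv u (fun y => L (κ y)) x = L (𝔤.leftDir κ u x) := by
  have h := (𝔤.hasDerivAt_leftDir hκ L u x 0).deriv
  rw [leftDeriv, h]
  congr 2
  simp [mul]

/-- Multiplication by the coordinate `y ↦ ⟪b, y_𝔳⟫`. -/
def coordMul (b : V) : 𝓢(V × Z, ℂ) →L[ℝ] 𝓢(V × Z, ℂ) :=
  SchwartzMap.smulLeftCLM ℂ ((innerSL ℝ b).comp (ContinuousLinearMap.fst ℝ V Z))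

@[simp] theorem coordMul_apply (b : V) (f : 𝓢(V × Z, ℂ)) (y : V × Z) :
    coordMul b f y = (⟪b, y.1⟫_ℝ : ℂ) * f y := by
  rw [coordMul, SchwartzMap.smulLeftCLM_apply_apply (by fun_prop)]
  simp

/-- The kernel of `P · Δ_p^λ τ + Q · Δ_q^λ τ`. -/
def adjointKernel (κ : V × Z → 𝓢(V × Z, ℂ)) (x : V × Z) : 𝓢(V × Z, ℂ) :=
  ∑ i, coordMul (stdOrthonormalBasis ℝ V i) (𝔤.leftDir κ (stdOrthonormalBasis ℝ V i) x)

/-- The kernel of `Δ_p^λ σ₁ · P σ₂ + Δ_q^λ σ₁ · Q σ₂`. -/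
def compKernel (κ₁ κ₂ : V × Z → 𝓢(V × Z, ℂ)) (x : V × Z) : 𝓢(V × Z, ℂ) :=
  ∑ i, 𝔤.conv (𝔤.leftDir κ₂ (stdOrthonormalBasis ℝ V i) x)
    (coordMul (stdOrthonormalBasis ℝ V i) (κ₁ x))

/-- Linearity in the direction and v = ∑ ⟨b_i, v⟩ b_i. The sum is thus the same in every orthonormal
basis, which frees the correction terms from the λ-dependent frame. -/
theorem sum_inner_mul_leftDir_apply (hκ : IsSmoothTVS κ) {ι : Type*} [Fintype ι]
    (b : OrthonormalBasis ι ℝ V) (x : V × Z) (v : V) (y : V × Z) :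
    ∑ i, (⟪b i, v⟫_ℝ : ℂ) * 𝔤.leftDir κ (b i) x y = 𝔤.leftDir κ v x y := by
  conv_rhs => rw [← b.sum_repr' v, 𝔤.leftDir_sum_smul hκ]
  simp

theorem sum_coordMul_leftDir (hκ : IsSmoothTVS κ) {ι : Type*} [Fintype ι]
    (b : OrthonormalBasis ι ℝ V) (x y : V × Z) :
    (∑ i, coordMul (b i) (𝔤.leftDir κ (b i) x)) y = 𝔤.leftDir κ y.1 x y := by
  simp [𝔤.sum_inner_mul_leftDir_apply hκ]

theorem adjointKernel_apply (hκ : IsSmoothTVS κ) (x y : V × Z) :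
    𝔤.adjointKernel κ x y = 𝔤.leftDir κ y.1 x y :=
  𝔤.sum_coordMul_leftDir hκ _ x y

/-- The coordinate multiplies the factor taken at w, so the sum reassembles the derivative in the
direction of w_𝔳. -/
theorem sum_conv_leftDir (κ₁ : V × Z → 𝓢(V × Z, ℂ)) (hκ : IsSmoothTVS κ) {ι : Type*} [Fintype ι]
    (b : OrthonormalBasis ι ℝ V) (x y : V × Z) :
    (∑ i, 𝔤.conv (𝔤.leftDir κ (b i) x) (coordMul (b i) (κ₁ x))) y =
      ∫ w, κ₁ x w * 𝔤.leftDir κ w.1 x (𝔤.mul y (-w)) := by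
  simp only [SchwartzMap.sum_apply', conv_apply]
  rw [← integral_finsetSum _ fun i _ => 𝔤.integrable_conv _ _ y]
  congr 1 with w
  simp only [coordMul_apply, ← 𝔤.sum_inner_mul_leftDir_apply hκ b x w.1, Finset.mul_sum]
  exact Finset.sum_congr rfl fun i _ => by ring

theorem isSmoothTVS_adjointKernel (hκ : IsSmoothTVS κ) : IsSmoothTVS (𝔤.adjointKernel κ) :=
  IsSmoothTVS.sum _ fun _ _ => (𝔤.isSmoothTVS_leftDir hκ _).clm_comp _

theorem hasCompactSupport_adjointKernel (hκ : IsSmoothTVS κ) (hs : HasCompactSupport κ) :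
    HasCompactSupport (𝔤.adjointKernel κ) := by
  refine HasCompactSupport.intro hs fun x hx => ?_
  simp [adjointKernel, leftDir, dirDeriv_eq_zero_of_notMem_tsupport hκ _ hx]

theorem isSmoothTVS_conv {κ₁ κ₂ : V × Z → 𝓢(V × Z, ℂ)} (h₁ : IsSmoothTVS κ₁)
    (h₂ : IsSmoothTVS κ₂) : IsSmoothTVS fun x => 𝔤.conv (κ₁ x) (κ₂ x) :=
  h₁.bilin 𝔤.convₗ 𝔤.continuous_conv h₂

theorem conv_zero (f : 𝓢(V × Z, ℂ)) : 𝔤.conv f 0 = 0 := map_zero (𝔤.convₗ f)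

theorem isSmoothTVS_compKernel {κ₁ κ₂ : V × Z → 𝓢(V × Z, ℂ)} (h₁ : IsSmoothTVS κ₁)
    (h₂ : IsSmoothTVS κ₂) : IsSmoothTVS (𝔤.compKernel κ₁ κ₂) :=
  IsSmoothTVS.sum _ fun _ _ => 𝔤.isSmoothTVS_conv (𝔤.isSmoothTVS_leftDir h₂ _) (h₁.clm_comp _)

theorem hasCompactSupport_compKernel {κ₁ κ₂ : V × Z → 𝓢(V × Z, ℂ)} (hs : HasCompactSupport κ₁) :
    HasCompactSupport (𝔤.compKernel κ₁ κ₂) := by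
  refine HasCompactSupport.intro hs fun x hx => ?_
  simp [compKernel, image_eq_zero_of_notMem_tsupport hx, conv_zero]

namespace Frame

variable {𝔤 : HTypeAlgebra V Z} {d : ℕ} (F : 𝔤.Frame d)

theorem IsKernel.star {σ : V × Z → Z → BddOp d} (hκ : F.IsKernel σ κ) :
    F.IsKernel (star σ) fun x => SchwartzMap.conjNegCLM (V × Z) (κ x) := by
  refine ⟨hκ.1.clm_comp _, hκ.2.1.comp_left (map_zero _), fun x l hl => ?_⟩
  rw [Pi.star_apply, Pi.star_apply, hκ.2.2 x l hl, ContinuousLinearMap.star_eq_adjoint,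
    F.adjoint_fourier (κ x).integrable hl]
  rfl

theorem IsKernel.mul {σ₁ σ₂ : V × Z → Z → BddOp d} {κ₁ κ₂ : V × Z → 𝓢(V × Z, ℂ)}
    (h₁ : F.IsKernel σ₁ κ₁) (h₂ : F.IsKernel σ₂ κ₂) :
    F.IsKernel (σ₁ * σ₂) fun x => 𝔤.conv (κ₂ x) (κ₁ x) := by
  refine ⟨𝔤.isSmoothTVS_conv h₂.1 h₁.1, ?_, fun x l hl => ?_⟩
  · refine HasCompactSupport.intro h₁.2.1 fun x hx => ?_
    simp [image_eq_zero_of_notMem_tsupport hx, conv_zero]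
  · rw [Pi.mul_apply, Pi.mul_apply, h₁.2.2 x l hl, h₂.2.2 x l hl, ContinuousLinearMap.mul_def,
      F.fourier_comp_fourier _ _ hl]

theorem diffP_eq (j : Fin d) (σ : V × Z → Z → BddOp d) (x : V × Z) (l : Z) :
    F.diffP j σ x l = F.fourierCLM l (coordMul (F.basis l (Sum.inl j)) (F.kernel σ x)) := by
  rw [diffP, diffOp, fourierCLM_apply]
  congr 1 with y
  simp [pCoord]

theorem diffQ_eq (j : Fin d) (σ : V × Z → Z → BddOp d) (x : V × Z) (l : Z) :
    F.diffQ j σ x l = F.fourierCLM l (coordMul (F.basis l (Sum.inr j)) (F.kernel σ x)) := by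
  rw [diffQ, diffOp, fourierCLM_apply]
  congr 1 with y
  simp [qCoord]

/-- At fixed λ the Fourier transform is continuous and linear, hence commutes with the
left-invariant derivatives. The P_j and Q_j together form an orthonormal basis, so the sum agrees
with that over the standard basis and its kernel does not depend on λ. -/
theorem isKernel_adjointTerm {τ : V × Z → Z → BddOp d} (hτ : τ ∈ F.A0) :
    F.IsKernel (F.adjointTerm τ) (𝔤.adjointKernel (F.kernel τ)) := by
  have hκ := F.isKernel_kernel hτ
  refine ⟨𝔤.isSmoothTVS_adjointKernel hκ.1, 𝔤.hasCompactSupport_adjointKernel hκ.1 hκ.2.1,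
    fun x l _ => ?_⟩
  have h : ∀ i, 𝔤.leftDeriv (F.basis l i)
      (fun y => F.fourierCLM l (coordMul (F.basis l i) (F.kernel τ y))) x =
      F.fourierCLM l (coordMul (F.basis l i) (𝔤.leftDir (F.kernel τ) (F.basis l i) x)) :=
    fun i => 𝔤.leftDeriv_clm hκ.1 ((F.fourierCLM l).comp (coordMul (F.basis l i))) _ x
  simp only [adjointTerm, diffP_eq, diffQ_eq, h]
  rw [Finset.sum_add_distrib, ← Fintype.sum_sum_type fun i => F.fourierCLM l
    (coordMul (F.basis l i) (𝔤.leftDir (F.kernel τ) (F.basis l i) x)), ← map_sum, fourierCLM_apply]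
  congr 1
  funext y
  rw [𝔤.sum_coordMul_leftDir hκ.1, 𝔤.adjointKernel_apply hκ.1]

/-- The symbol `σ₂` enters through its values only, so any of its kernels serves. -/
theorem isKernel_compTerm {σ₁ σ₂ : V × Z → Z → BddOp d} (hσ₁ : σ₁ ∈ F.A0)
    {κ₂ : V × Z → 𝓢(V × Z, ℂ)} (h₂ : F.IsKernel σ₂ κ₂) :
    F.IsKernel (F.compTerm σ₁ σ₂) (𝔤.compKernel (F.kernel σ₁) κ₂) := by
  have h₁ := F.isKernel_kernel hσ₁
  refine ⟨𝔤.isSmoothTVS_compKernel h₁.1 h₂.1, 𝔤.hasCompactSupport_compKernel h₁.2.1,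
    fun x l hl => ?_⟩
  have h : ∀ i, 𝔤.leftDeriv (F.basis l i) (fun y => σ₂ y l) x =
      F.fourierCLM l (𝔤.leftDir κ₂ (F.basis l i) x) := fun i => by
    rw [← 𝔤.leftDeriv_clm h₂.1 (F.fourierCLM l)]
    congr 1
    funext y
    exact h₂.2.2 y l hl
  have h' : ∀ i, (F.fourierCLM l (coordMul (F.basis l i) (F.kernel σ₁ x))).comp
      (F.fourierCLM l (𝔤.leftDir κ₂ (F.basis l i) x)) =
      F.fourierCLM l (𝔤.conv (𝔤.leftDir κ₂ (F.basis l i) x)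
        (coordMul (F.basis l i) (F.kernel σ₁ x))) := fun i => F.fourier_comp_fourier _ _ hl
  simp only [compTerm, diffP_eq, diffQ_eq, h, h']
  rw [Finset.sum_add_distrib, ← Fintype.sum_sum_type fun i => F.fourierCLM l
    (𝔤.conv (𝔤.leftDir κ₂ (F.basis l i) x) (coordMul (F.basis l i) (F.kernel σ₁ x))),
    ← map_sum, fourierCLM_apply]
  congr 1
  funext y
  rw [𝔤.sum_conv_leftDir _ h₂.1, compKernel, 𝔤.sum_conv_leftDir _ h₂.1]

end Frame

end HTypeAlgebra

namespace HTypeAlgebra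

variable {V Z : Type*} [NormedAddCommGroup V] [InnerProductSpace ℝ V] [FiniteDimensional ℝ V]
  [MeasurableSpace V] [BorelSpace V]
  [NormedAddCommGroup Z] [InnerProductSpace ℝ Z] [FiniteDimensional ℝ Z]
  [MeasurableSpace Z] [BorelSpace Z]

/-! ### The Taylor formula -/

/-- An integrable weight with second moments. -/
def weight₂ (V Z : Type*) [NormedAddCommGroup V] [InnerProductSpace ℝ V] [FiniteDimensional ℝ V]
    [MeasurableSpace V] [BorelSpace V] [NormedAddCommGroup Z] [InnerProductSpace ℝ Z]
    [FiniteDimensional ℝ Z] [MeasurableSpace Z] [BorelSpace Z] (y : V × Z) : ℝ :=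
  ((1 + ‖y‖) ^ 2)⁻¹ * weight V Z y

theorem weight₂_nonneg (y : V × Z) : 0 ≤ weight₂ V Z y :=
  mul_nonneg (by positivity) (weight_nonneg y)

theorem sq_mul_weight₂ (y : V × Z) : (1 + ‖y‖) ^ 2 * weight₂ V Z y = weight V Z y := by
  rw [weight₂, mul_inv_cancel_left₀ (by positivity)]

theorem weight₂_le_weight (y : V × Z) : weight₂ V Z y ≤ weight V Z y := by
  rw [← sq_mul_weight₂]
  exact le_mul_of_one_le_left (weight₂_nonneg y) (one_le_pow₀ (by simp))

theorem exists_norm_le_weight₂ {X : Type*} [TopologicalSpace X] {κ : X → 𝓢(V × Z, ℂ)}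
    (hκ : Continuous κ) (hs : HasCompactSupport κ) :
    ∃ C, 0 ≤ C ∧ ∀ x y, ‖κ x y‖ ≤ C * weight₂ V Z y := by
  obtain ⟨C, hC0, hC⟩ := exists_norm_le_weight hκ hs 2
  refine ⟨C, hC0, fun x y => ?_⟩
  rw [weight₂, mul_left_comm, ← div_eq_inv_mul, le_div_iff₀' (by positivity)]
  exact hC x y

/-- Linear combinations of dominated families are dominated. -/
theorem exists_norm_sum_le_weight₂ {ι : Type*} [Fintype ι] {κ : ι → V × Z → 𝓢(V × Z, ℂ)}
    (hκ : ∀ i, Continuous (κ i)) (hs : ∀ i, HasCompactSupport (κ i)) :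
    ∃ C, 0 ≤ C ∧ ∀ (c : ι → ℝ) (r : ℝ), (∀ i, |c i| ≤ r) → ∀ x y,
      ‖∑ i, (c i : ℂ) * κ i x y‖ ≤ C * r * weight₂ V Z y := by
  choose C hC0 hC using fun i => exists_norm_le_weight₂ (hκ i) (hs i)
  refine ⟨∑ i, C i, Finset.sum_nonneg fun i _ => hC0 i, fun c r hc x y => ?_⟩
  rw [Finset.sum_mul, Finset.sum_mul]
  refine norm_sum_le_of_le _ fun i _ => ?_
  rw [norm_mul, Complex.norm_real, Real.norm_eq_abs, mul_comm (C i), mul_assoc]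
  exact mul_le_mul (hc i) (hC i x y) (norm_nonneg _) ((abs_nonneg _).trans (hc i))

variable (𝔤 : HTypeAlgebra V Z) {κ : V × Z → 𝓢(V × Z, ℂ)}

theorem abs_stdOrthonormalBasis_inner_le {E : Type*} [NormedAddCommGroup E]
    [InnerProductSpace ℝ E] [FiniteDimensional ℝ E] (i) (v : E) :
    |⟪stdOrthonormalBasis ℝ E i, v⟫_ℝ| ≤ ‖v‖ := by
  simpa using abs_real_inner_le_norm (stdOrthonormalBasis ℝ E i) v

/-- Expansion in a fixed basis gives one constant for all directions v. -/
theorem exists_norm_leftDir_le (hκ : IsSmoothTVS κ) (hs : HasCompactSupport κ) :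
    ∃ C, 0 ≤ C ∧ ∀ v x y, ‖𝔤.leftDir κ v x y‖ ≤ C * ‖v‖ * weight₂ V Z y := by
  obtain ⟨C, hC0, hC⟩ := exists_norm_sum_le_weight₂
    (fun i => (𝔤.isSmoothTVS_leftDir hκ (stdOrthonormalBasis ℝ V i)).continuous)
    (fun i => 𝔤.hasCompactSupport_leftDir hκ hs (stdOrthonormalBasis ℝ V i))
  refine ⟨C, hC0, fun v x y => ?_⟩
  rw [← 𝔤.sum_inner_mul_leftDir_apply hκ (stdOrthonormalBasis ℝ V)]
  exact hC _ _ (fun i => abs_stdOrthonormalBasis_inner_le i v) x y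

/-- The sum is the second derivative along v. One direction is expanded in a fixed basis, so that
finitely many smooth families control all v. -/
theorem exists_norm_leftDir_leftDir_le (hκ : IsSmoothTVS κ) (hs : HasCompactSupport κ) :
    ∃ C, 0 ≤ C ∧ ∀ v x y,
      ‖∑ i, (⟪stdOrthonormalBasis ℝ V i, v⟫_ℝ : ℂ) *
        𝔤.leftDir (𝔤.leftDir κ (stdOrthonormalBasis ℝ V i)) v x y‖ ≤
      C * ‖v‖ ^ 2 * weight₂ V Z y := by
  choose C hC0 hC using fun i => 𝔤.exists_norm_leftDir_le
    (𝔤.isSmoothTVS_leftDir hκ (stdOrthonormalBasis ℝ V i))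
    (𝔤.hasCompactSupport_leftDir hκ hs (stdOrthonormalBasis ℝ V i))
  refine ⟨∑ i, C i, Finset.sum_nonneg fun i _ => hC0 i, fun v x y => ?_⟩
  rw [Finset.sum_mul, Finset.sum_mul]
  refine norm_sum_le_of_le _ fun i _ => ?_
  rw [norm_mul, Complex.norm_real, Real.norm_eq_abs]
  calc _ ≤ ‖v‖ * (C i * ‖v‖ * weight₂ V Z y) :=
        mul_le_mul (abs_stdOrthonormalBasis_inner_le i v) (hC i v x y) (norm_nonneg _)
          (norm_nonneg _)
    _ = _ := by ring

theorem exists_norm_dirDeriv_center_le (hκ : IsSmoothTVS κ) (hs : HasCompactSupport κ) :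
    ∃ C, 0 ≤ C ∧ ∀ (z : Z) (x y : V × Z),
      ‖dirDeriv κ (0, z) x y‖ ≤ C * ‖z‖ * weight₂ V Z y := by
  obtain ⟨C, hC0, hC⟩ := exists_norm_sum_le_weight₂
    (fun k => (hκ.dirDeriv ((0 : V), stdOrthonormalBasis ℝ Z k)).continuous)
    (fun k => HasCompactSupport.intro hs fun x hx =>
      dirDeriv_eq_zero_of_notMem_tsupport hκ _ hx)
  refine ⟨C, hC0, fun z x y => ?_⟩
  have hz : ((0 : V), z) = ∑ k, ⟪stdOrthonormalBasis ℝ Z k, z⟫_ℝ •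
      ((0 : V), stdOrthonormalBasis ℝ Z k) := by
    ext
    · simp [Prod.fst_sum]
    · simp only [Prod.snd_sum, Prod.smul_snd, (stdOrthonormalBasis ℝ Z).sum_repr']
  rw [hz, dirDeriv_sum_smul hκ]
  simpa using hC _ _ (fun i => abs_stdOrthonormalBasis_inner_le i z) x y

/-- The curve t ↦ x Exp(tv) is an integral curve of the left-invariant field of v, so the first two
derivatives along it are `leftDir` and its iterate. -/
theorem exists_norm_taylor_horizontal_le (hκ : IsSmoothTVS κ) (hs : HasCompactSupport κ) :
    ∃ C, 0 ≤ C ∧ ∀ (v : V) (t : ℝ) (x y : V × Z),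
      ‖κ (𝔤.mul x (t • v, 0)) y - κ x y - t • 𝔤.leftDir κ v x y‖ ≤
        C * ‖v‖ ^ 2 * weight₂ V Z y * t ^ 2 := by
  obtain ⟨C, hC0, hC⟩ := 𝔤.exists_norm_leftDir_leftDir_le hκ hs
  refine ⟨C, hC0, fun v t x y => ?_⟩
  have hx : 𝔤.mul x ((0 : ℝ) • v, 0) = x := by simp [mul]
  have h := norm_sub_sub_smul_le_of_hasDerivAt
    (𝔤.hasDerivAt_leftDir hκ (SchwartzMap.evalCLM' y) v x) (u'' := fun t =>
      ∑ i, (⟪stdOrthonormalBasis ℝ V i, v⟫_ℝ : ℂ) *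
        𝔤.leftDir (𝔤.leftDir κ (stdOrthonormalBasis ℝ V i)) v (𝔤.mul x (t • v, 0)) y)
    (fun t => by
      simp only [SchwartzMap.evalCLM'_apply,
        ← 𝔤.sum_inner_mul_leftDir_apply hκ (stdOrthonormalBasis ℝ V) _ v]
      exact HasDerivAt.fun_sum fun i _ => (𝔤.hasDerivAt_leftDir
        (𝔤.isSmoothTVS_leftDir hκ _) (SchwartzMap.evalCLM' y) v x t).const_mul _)
    (fun t => hC v _ y) t
  simpa only [hx, SchwartzMap.evalCLM'_apply] using h

/-- First-order control suffices in the centre, where the displacement will be of size ε². -/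
theorem exists_norm_center_sub_le (hκ : IsSmoothTVS κ) (hs : HasCompactSupport κ) :
    ∃ C, 0 ≤ C ∧ ∀ (z : Z) (x y : V × Z),
      ‖κ (x + (0, z)) y - κ x y‖ ≤ C * ‖z‖ * weight₂ V Z y := by
  obtain ⟨C, hC0, hC⟩ := exists_norm_dirDeriv_center_le hκ hs
  refine ⟨C, hC0, fun z x y => ?_⟩
  have h := convex_univ.norm_image_sub_le_of_norm_hasDerivWithin_le (x := (0 : ℝ)) (y := 1)
    (f := fun t : ℝ => SchwartzMap.evalCLM' y (κ (x + t • ((0 : V), z))))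
    (fun t _ => (((hκ.hasDirDeriv (0, z)).clm_comp
      (SchwartzMap.evalCLM' y)).hasDerivAt x t).hasDerivWithinAt)
    (fun t _ => hC z _ y) (Set.mem_univ _) (Set.mem_univ _)
  simpa using h

/-- The Taylor formula of order one along the dilations of the group. -/
theorem exists_norm_taylor_le (hκ : IsSmoothTVS κ) (hs : HasCompactSupport κ) :
    ∃ C, 0 ≤ C ∧ ∀ (ε : ℝ) (x w y : V × Z),
      ‖κ (𝔤.dilShift ε x w) y - (κ x y - ε * 𝔤.leftDir κ w.1 x y)‖ ≤
        C * ε ^ 2 * ((1 + ‖w‖) ^ 2 * weight₂ V Z y) := by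
  obtain ⟨C₁, h₁0, h₁⟩ := 𝔤.exists_norm_taylor_horizontal_le hκ hs
  obtain ⟨C₂, h₂0, h₂⟩ := exists_norm_center_sub_le hκ hs
  refine ⟨C₁ + C₂, by positivity, fun ε x w y => ?_⟩
  -- The displacement is a horizontal step by -ε w_𝔳 followed by a central step by -ε² w_𝔷. Only the
  -- first contributes a linear term.
  have hd : 𝔤.dilShift ε x w = 𝔤.mul x ((-ε) • w.1, 0) + (0, (-ε ^ 2) • w.2) := by
    ext
    · simp [dilShift, mul, dil_apply]
    · simp [dilShift, mul, dil_apply]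
      abel
  have hw1 : ‖w.1‖ ≤ ‖w‖ := norm_fst_le w
  have hw2 : ‖w.2‖ ≤ ‖w‖ := norm_snd_le w
  have hW := weight₂_nonneg (V := V) (Z := Z) y
  have e₁ : ‖w.1‖ ^ 2 ≤ (1 + ‖w‖) ^ 2 := by gcongr; linarith
  have e₂ : ‖w.2‖ ≤ (1 + ‖w‖) ^ 2 := by nlinarith [norm_nonneg w]
  have b₁ := h₁ w.1 (-ε) x y
  have b₂ := h₂ ((-ε ^ 2) • w.2) (𝔤.mul x ((-ε) • w.1, 0)) y
  rw [norm_smul, norm_neg, Real.norm_of_nonneg (by positivity)] at b₂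
  rw [hd]
  calc _ = ‖(κ (𝔤.mul x ((-ε) • w.1, 0) + (0, (-ε ^ 2) • w.2)) y
          - κ (𝔤.mul x ((-ε) • w.1, 0)) y) +
        (κ (𝔤.mul x ((-ε) • w.1, 0)) y - κ x y - (-ε) • 𝔤.leftDir κ w.1 x y)‖ := by
        congr 1
        rw [Complex.real_smul]
        push_cast
        ring
    _ ≤ C₂ * (ε ^ 2 * ‖w.2‖) * weight₂ V Z y + C₁ * ‖w.1‖ ^ 2 * weight₂ V Z y * (-ε) ^ 2 :=
        (norm_add_le _ _).trans (add_le_add b₂ b₁)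
    _ = ε ^ 2 * weight₂ V Z y * (C₂ * ‖w.2‖ + C₁ * ‖w.1‖ ^ 2) := by ring
    _ ≤ ε ^ 2 * weight₂ V Z y * (C₂ * (1 + ‖w‖) ^ 2 + C₁ * (1 + ‖w‖) ^ 2) := by gcongr
    _ = _ := by ring

/-! ### Convolution kernels -/

/-- Dilations are automorphisms and inversion reverses products, so the shift by y w is the shift by
w followed by the shift by y. -/
theorem dilShift_mul (ε : ℝ) (x y w : V × Z) :
    𝔤.dilShift ε x (𝔤.mul y w) = 𝔤.dilShift ε (𝔤.dilShift ε x w) y := by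
  simp only [dilShift, dil_mul, neg_mul_rev, mul_assoc']

/-- The operator whose kernel is a superposition of translates. -/
theorem isKernelOp_prod {k : V × Z → V × Z → ℂ} {L : V × Z → V × Z → V × Z → ℂ}
    {m : (V × Z) × (V × Z) → ℝ} {ε : ℝ}
    {T : Lp ℂ 2 (volume : Measure (V × Z)) →L[ℂ] Lp ℂ 2 (volume : Measure (V × Z))}
    (hT : IsKernelOp volume k (𝔤.dilShift ε) T)
    (hL : IsDominatedKernel (volume.prod volume) (fun x p => L x p.1 p.2) m)
    (hk : ∀ x y, k x y = ∫ w, L x w (𝔤.mul y (-w))) :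
    IsKernelOp (volume.prod volume) (fun x p => L x p.1 p.2)
      (fun x p => 𝔤.dilShift ε (𝔤.dilShift ε x p.1) p.2) T := by
  intro f
  filter_upwards [hT f, hL.ae_integrable (𝔤.dilShift_prod_family ε) f] with x h₁ h₂
  refine ⟨h₂, ?_⟩
  -- Replacing y by y w⁻¹ at fixed w turns the double shift into the single shift by y and unfolds
  -- the convolution.
  have hΨ : MeasurePreserving (fun p : (V × Z) × (V × Z) => (p.1, 𝔤.mul p.2 (-p.1)))
      (volume.prod volume) (volume.prod volume) :=
    (MeasurePreserving.id volume).skew_product (g := fun w y => 𝔤.mul y (-w))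
      (Continuous.measurable (by unfold Function.uncurry; fun_prop))
      (Eventually.of_forall fun w => (𝔤.measurePreserving_mul_right (-w)).map_eq)
  rw [h₁.2, ← hΨ.integral_comp_of_aestronglyMeasurable h₂.aestronglyMeasurable]
  refine Eq.trans ?_ (integral_prod_symm _ (hΨ.integrable_comp_of_integrable h₂)).symm
  refine integral_congr_ae (Eventually.of_forall fun y => ?_)
  simp only [Function.comp_apply, ← dilShift_mul, mul_cancel_neg_right, integral_mul_const, hk]

theorem measurable_leftDir (hκ : IsSmoothTVS κ) :
    Measurable fun q : (V × Z) × (V × Z) × (V × Z) => 𝔤.leftDir κ q.2.1.1 q.1 q.2.2 := by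
  have h : (fun q : (V × Z) × (V × Z) × (V × Z) => 𝔤.leftDir κ q.2.1.1 q.1 q.2.2) = _ :=
    funext fun q => (𝔤.sum_inner_mul_leftDir_apply hκ (stdOrthonormalBasis ℝ V) _ _ _).symm
  rw [h]
  refine Continuous.measurable (continuous_finsetSum _ fun i _ => ?_)
  refine Continuous.mul (by fun_prop) ?_
  exact ((𝔤.isSmoothTVS_leftDir hκ _).continuous.comp continuous_fst).schwartz_eval
    (continuous_snd.comp continuous_snd)

theorem measurable_eval (hκ : IsSmoothTVS κ) {Y : Type*} [MeasurableSpace Y] {a b : Y → V × Z}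
    (ha : Measurable a) (hb : Measurable b) : Measurable fun p => κ (a p) (b p) :=
  ((hκ.continuous.comp continuous_fst).schwartz_eval continuous_snd).measurable.comp
    (ha.prodMk hb)

theorem integrable_weight_prod : Integrable (fun p : (V × Z) × (V × Z) =>
    weight V Z p.1 * weight V Z p.2) (volume.prod volume) :=
  integrable_weight.mul_prod integrable_weight

/-- The product of a family of Schwartz functions with a kernel of quadratic growth. -/
theorem isDominatedKernel_mul {C₁ C : ℝ} (hκ : IsSmoothTVS κ)
    (hC₁ : 0 ≤ C₁) (hb : ∀ x y, ‖κ x y‖ ≤ C₁ * weight₂ V Z y) {L : V × Z → V × Z → V × Z → ℂ}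
    (hL : Measurable fun q : (V × Z) × (V × Z) × (V × Z) => L q.1 q.2.1 q.2.2)
    (hbL : ∀ x w y, ‖L x w y‖ ≤ C * ((1 + ‖w‖) ^ 2 * weight V Z y)) :
    IsDominatedKernel (volume.prod volume)
      (fun x (p : (V × Z) × (V × Z)) => κ x p.1 * L x p.1 p.2)
      (fun p => C₁ * C * (weight V Z p.1 * weight V Z p.2)) := by
  refine ⟨(measurable_eval hκ measurable_fst (measurable_fst.comp measurable_snd)).mul hL,
    fun x p => ?_, integrable_weight_prod.const_mul _⟩
  rw [norm_mul]
  calc _ ≤ (C₁ * weight₂ V Z p.1) * (C * ((1 + ‖p.1‖) ^ 2 * weight V Z p.2)) :=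
        mul_le_mul (hb _ _) (hbL _ _ _) (norm_nonneg _) (mul_nonneg hC₁ (weight₂_nonneg _))
    _ = _ := by rw [← sq_mul_weight₂ p.1]; ring

theorem mul_weight₂_le {C a : ℝ} (hC : 0 ≤ C) (w y : V × Z) (ha : a ≤ (1 + ‖w‖) ^ 2) :
    C * a * weight₂ V Z y ≤ C * ((1 + ‖w‖) ^ 2 * weight V Z y) := by
  rw [mul_assoc]
  exact mul_le_mul_of_nonneg_left (mul_le_mul ha (weight₂_le_weight y) (weight₂_nonneg y)
    (by positivity)) hC

/-! ### Expansions of the adjoint and of the composition -/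

namespace Frame

variable {𝔤 : HTypeAlgebra V Z} {d : ℕ} (F : 𝔤.Frame d)

theorem star_mem_A0 {σ : V × Z → Z → BddOp d} (hσ : σ ∈ F.A0) : star σ ∈ F.A0 := by
  obtain ⟨κ, hκ⟩ := hσ
  exact ⟨_, IsKernel.star F hκ⟩

theorem adjointTerm_mem_A0 {τ : V × Z → Z → BddOp d} (hτ : τ ∈ F.A0) : F.adjointTerm τ ∈ F.A0 :=
  ⟨_, F.isKernel_adjointTerm hτ⟩

theorem mul_mem_A0 {σ₁ σ₂ : V × Z → Z → BddOp d} (h₁ : σ₁ ∈ F.A0) (h₂ : σ₂ ∈ F.A0) :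
    σ₁ * σ₂ ∈ F.A0 := by
  obtain ⟨κ₁, h₁⟩ := h₁
  obtain ⟨κ₂, h₂⟩ := h₂
  exact ⟨_, IsKernel.mul F h₁ h₂⟩

theorem compTerm_mem_A0 {σ₁ σ₂ : V × Z → Z → BddOp d} (h₁ : σ₁ ∈ F.A0) (h₂ : σ₂ ∈ F.A0) :
    F.compTerm σ₁ σ₂ ∈ F.A0 := by
  obtain ⟨κ₂, h₂⟩ := h₂
  exact ⟨_, F.isKernel_compTerm h₁ h₂⟩

/-- The kernel of the adjoint of the quantization of `τ^*`. -/
theorem isKernelOp_adjoint {τ : V × Z → Z → BddOp d} (hκ : F.IsKernel τ κ) {ε : ℝ} (hε : 0 < ε) :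
    IsKernelOp volume (fun x y => κ (𝔤.dilShift ε x y) y) (𝔤.dilShift ε)
      (ContinuousLinearMap.adjoint (F.op ε (star τ))) := by
  have hκ' := IsKernel.star F hκ
  obtain ⟨m, hm⟩ := exists_isDominatedKernel hκ'.1.continuous hκ'.2.1
  have h := (IsKernel.isKernelOp F hκ' hε).adjoint hm (𝔤.dilShift_family ε)
    (Measure.measurePreserving_neg volume) (𝔤.dilShift_dilShift_neg ε)
  simpa using h

/-- The kernel of the difference is the Taylor remainder of κ with displacement w = y; the factor
(1+|y|)² is absorbed by `weight₂`. -/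
theorem exists_norm_adjoint_le {τ : V × Z → Z → BddOp d} (hτ : τ ∈ F.A0) :
    ∃ C : ℝ, ∀ ε : ℝ, 0 < ε →
      ‖ContinuousLinearMap.adjoint (F.op ε (star τ)) -
        (F.op ε τ - (ε : ℂ) • F.op ε (F.adjointTerm τ))‖ ≤ C * ε ^ 2 := by
  have hκ := F.isKernel_kernel hτ
  have hκ' := F.isKernel_adjointTerm hτ
  obtain ⟨C, hC0, hC⟩ := 𝔤.exists_norm_taylor_le hκ.1 hκ.2.1
  refine ⟨C * ∫ y, weight V Z y, fun ε hε => ?_⟩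
  have hT := (F.isKernelOp_adjoint hκ hε).sub ((IsKernel.isKernelOp F hκ hε).sub
    ((IsKernel.isKernelOp F hκ' hε).const_smul (ε : ℂ)))
  refine (hT.norm_le (m := fun y => C * ε ^ 2 * weight V Z y) ⟨?_, fun x y => ?_,
    integrable_weight.const_mul _⟩ (𝔤.dilShift_family ε)).trans_eq ?_
  · have hA := (𝔤.continuous_dilShift ε).measurable
    exact (measurable_eval hκ.1 hA measurable_snd).sub
      ((measurable_eval hκ.1 measurable_fst measurable_snd).sub
        ((measurable_eval hκ'.1 measurable_fst measurable_snd).const_mul _))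
  · rw [𝔤.adjointKernel_apply hκ.1, ← sq_mul_weight₂]
    exact hC ε x y y
  · rw [integral_const_mul]
    ring

/-- All three operators are written over pairs (w, y) along the same maps x ↦ x(δ_ε w)⁻¹(δ_ε y)⁻¹.
The kernel of the difference is then κ₁_x(w) times the Taylor remainder of κ₂, and the decay of κ₁
absorbs (1+|w|)². -/
theorem exists_norm_comp_le {σ₁ σ₂ : V × Z → Z → BddOp d} (h₁ : σ₁ ∈ F.A0) (h₂ : σ₂ ∈ F.A0) :
    ∃ C : ℝ, ∀ ε : ℝ, 0 < ε →
      ‖(F.op ε σ₁).comp (F.op ε σ₂) -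
        (F.op ε (σ₁ * σ₂) - (ε : ℂ) • F.op ε (F.compTerm σ₁ σ₂))‖ ≤ C * ε ^ 2 := by
  have k₁ := F.isKernel_kernel h₁
  have k₂ := F.isKernel_kernel h₂
  set κ₁ := F.kernel σ₁
  set κ₂ := F.kernel σ₂
  have k₁₂ := IsKernel.mul F k₁ k₂
  have kc := F.isKernel_compTerm h₁ k₂
  obtain ⟨C, hC0, hC⟩ := 𝔤.exists_norm_taylor_le k₂.1 k₂.2.1
  obtain ⟨C₁, hC₁0, hC₁⟩ := exists_norm_le_weight₂ k₁.1.continuous k₁.2.1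
  obtain ⟨C₂, hC₂0, hC₂⟩ := exists_norm_le_weight₂ k₂.1.continuous k₂.2.1
  obtain ⟨C₃, hC₃0, hC₃⟩ := 𝔤.exists_norm_leftDir_le k₂.1 k₂.2.1
  refine ⟨C₁ * C * ∫ p : (V × Z) × (V × Z), weight V Z p.1 * weight V Z p.2 ∂volume.prod volume,
    fun ε hε => ?_⟩
  have m₂ : Measurable fun q : (V × Z) × (V × Z) × (V × Z) => κ₂ q.1 q.2.2 :=
    measurable_eval k₂.1 measurable_fst (measurable_snd.comp measurable_snd)
  have m₃ : Measurable fun q : (V × Z) × (V × Z) × (V × Z) =>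
      κ₂ (𝔤.dilShift ε q.1 q.2.1) q.2.2 :=
    measurable_eval k₂.1 ((𝔤.continuous_dilShift ε).measurable.comp
      (measurable_fst.prodMk (measurable_fst.comp measurable_snd)))
      (measurable_snd.comp measurable_snd)
  have m₄ := 𝔤.measurable_leftDir k₂.1
  have b₂ : ∀ x w y : V × Z, ‖κ₂ x y‖ ≤ C₂ * ((1 + ‖w‖) ^ 2 * weight V Z y) := fun x w y => by
    have h := mul_weight₂_le hC₂0 w y (one_le_pow₀ (by simp))
    rw [mul_one] at h
    exact (hC₂ x y).trans h
  have t₀ := (IsKernel.isKernelOp F k₁ hε).comp (IsKernel.isKernelOp F k₂ hε)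
    (𝔤.dilShift_family ε) (isDominatedKernel_mul k₁.1 hC₁0 hC₁
      (L := fun x w y => κ₂ (𝔤.dilShift ε x w) y) m₃ fun x w y => b₂ _ w y)
    (𝔤.dilShift_prod_family ε)
  -- The operators with convolution kernels are brought to the form of the composition by unfolding
  -- the convolutions.
  have t₁ := 𝔤.isKernelOp_prod (L := fun x w y => κ₁ x w * κ₂ x y)
    (IsKernel.isKernelOp F k₁₂ hε) (isDominatedKernel_mul k₁.1 hC₁0 hC₁
      (L := fun x _ y => κ₂ x y) m₂ b₂) fun x y => 𝔤.conv_apply _ _ y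
  have t₂ := 𝔤.isKernelOp_prod (L := fun x w y => κ₁ x w * 𝔤.leftDir κ₂ w.1 x y)
    (IsKernel.isKernelOp F kc hε) (isDominatedKernel_mul k₁.1 hC₁0 hC₁
      (L := fun x w y => 𝔤.leftDir κ₂ w.1 x y) m₄ fun x w y => (hC₃ _ _ _).trans
        (mul_weight₂_le hC₃0 w y (by nlinarith [norm_nonneg w, norm_fst_le w])))
    fun x y => 𝔤.sum_conv_leftDir κ₁ k₂.1 _ x y
  have hd := isDominatedKernel_mul k₁.1 hC₁0 hC₁ (C := C * ε ^ 2)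
    (L := fun x w y => κ₂ (𝔤.dilShift ε x w) y - (κ₂ x y - ε * 𝔤.leftDir κ₂ w.1 x y))
    (m₃.sub (m₂.sub (m₄.const_mul _))) fun x w y => (hC ε x w y).trans (by
      have := weight₂_le_weight y
      gcongr)
  have he : (fun x (p : (V × Z) × (V × Z)) => κ₁ x p.1 * κ₂ (𝔤.dilShift ε x p.1) p.2 -
      (κ₁ x p.1 * κ₂ x p.2 - ε * (κ₁ x p.1 * 𝔤.leftDir κ₂ p.1.1 x p.2))) = fun x p => κ₁ x p.1 *
      (κ₂ (𝔤.dilShift ε x p.1) p.2 - (κ₂ x p.2 - ε * 𝔤.leftDir κ₂ p.1.1 x p.2)) := by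
    funext x p
    ring
  have ht := t₀.sub (t₁.sub (t₂.const_smul (ε : ℂ)))
  rw [he] at ht
  refine (ht.norm_le hd (𝔤.dilShift_prod_family ε)).trans_eq ?_
  rw [integral_const_mul]
  ring

end Frame

end HTypeAlgebra

end

theorem mainTheorem4 {V Z : Type*}
    [NormedAddCommGroup V] [InnerProductSpace ℝ V] [FiniteDimensional ℝ V]
    [MeasurableSpace V] [BorelSpace V]
    [NormedAddCommGroup Z] [InnerProductSpace ℝ Z] [FiniteDimensional ℝ Z]
    [MeasurableSpace Z] [BorelSpace Z]
    (𝔤 : HTypeAlgebra V Z) {d : ℕ} (F : 𝔤.Frame d) :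
    -- every symbol of the class is quantized to a bounded operator on `L²(G)`
    (∀ σ ∈ F.A0, ∀ ε : ℝ, 0 < ε → F.IsQuantization ε σ (F.op ε σ)) ∧
    -- the adjoint
    (∀ σ ∈ F.A0, star σ ∈ F.A0 ∧ F.adjointTerm (star σ) ∈ F.A0 ∧
      ∃ C : ℝ, ∀ ε : ℝ, 0 < ε →
        ‖ContinuousLinearMap.adjoint (F.op ε σ) -
          (F.op ε (star σ) - (ε : ℂ) • F.op ε (F.adjointTerm (star σ)))‖ ≤ C * ε ^ 2) ∧
    -- the composition
    (∀ σ₁ ∈ F.A0, ∀ σ₂ ∈ F.A0, σ₁ * σ₂ ∈ F.A0 ∧ F.compTerm σ₁ σ₂ ∈ F.A0 ∧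
      ∃ C : ℝ, ∀ ε : ℝ, 0 < ε →
        ‖(F.op ε σ₁).comp (F.op ε σ₂) -
          (F.op ε (σ₁ * σ₂) - (ε : ℂ) • F.op ε (F.compTerm σ₁ σ₂))‖ ≤ C * ε ^ 2) := by
  refine ⟨fun σ hσ ε hε => F.isQuantization_op hσ hε, fun σ hσ => ?_, fun σ₁ h₁ σ₂ h₂ =>
    ⟨F.mul_mem_A0 h₁ h₂, F.compTerm_mem_A0 h₁ h₂, F.exists_norm_comp_le h₁ h₂⟩⟩
  -- Applied to τ = σ*, for which τ* = σ.
  have h := F.exists_norm_adjoint_le (F.star_mem_A0 hσ)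
  rw [star_star] at h
  exact ⟨F.star_mem_A0 hσ, F.adjointTerm_mem_A0 (F.star_mem_A0 hσ), h⟩
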